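/- Let $M$ be a smooth (Hausdorff) manifold of dimension $n$. A $C^0$-Finsler structure on $M$ is a continuous $F:TM\to[0,\infty)$ whose restriction to every $T_xM$ is an asymmetric norm ($F(y)=0$ iff $y=0$, positively homogeneous of degree one, subadditive). It is of Pontryagin type if around every point there are a coordinate system on an open set $U$ and a family of $C^1$ vector fields $X_u=f^i(x,u)\frac{\partial}{\partial x^i}$ on $U$, $u\in S^{n-1}$, such that $u\mapsto X_u(x)$ is a homeomorphism from $S^{n-1}$ onto $\{y\in T_xM: F(x,y)=1\}$ for every $x\in U$, and $f$ and $\partial f/\partial x^i$ are continuous in $(x,u)$. Let $F_*(x,\alpha)=\sup\{\alpha(y): F(x,y)\le 1\}$. The extended geodesic field $\mathcal E$ associates to $(x,\alpha)\in T^*M\setminus 0$ the set $\mathcal E(x,\alpha)$ of the vectors $$f^i(x,u)\frac{\partial}{\partial x^i}-\alpha_j\frac{\partial f^j}{\partial x^i}(x,u)\frac{\partial}{\partial\alpha_i},\qquad u\in S^{n-1},\quad \alpha(X_u(x))=\max_{v\in S^{n-1}}\alpha(X_v(x)),$$ and $F_*\mathcal E$ is the correspondence $(x,\alpha)\mapsto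 F_*(x,\alpha)\,\mathcal E(x,\alpha)$. An integral curve of such a correspondence is an absolutely continuous curve $\gamma:[a,b]\to T^*M$ whose derivative at $t$ belongs to the correspondence at $\gamma(t)$ for almost every $t$. A minimizing path is an absolutely continuous path $x:[a,b]\to M$, $a<b$, whose length $\int_a^b F(x(t),x'(t))\,dt$ is at most that of every absolutely continuous path in $M$ with the same endpoints; it has constant speed $c$ if $F(x(t),x'(t))=c$ for almost every $t$, and is parameterized by arclength if $c=1$. Theorem. The correspondences $\mathcal E$ and $F_*\mathcal E$ generalize the geodesic spray of Finsler geometry, in the following sense. (1) Let $F$ be a Finsler structure: $F\ge 0$ is smooth on $TM\setminus 0$, positively homogeneous of degree one, and $g_{ij}=\frac12\frac{\partial^2F^2}{\partial y^i\partial y^j}$ is positive definite on $TM\setminus 0$. Then $F$ is of Pontryagin type, the Legendre transform $(x,y)\mapsto(x,g_{ij}(x,y)y^j\,dx^i)$ is a bijection from $TM\setminus0$ onto $T^*M\setminus0$, and, if $\mathcal G$ denotes the push-forward by this bijection of the geodesic spray $y^i\frac{\partial}{\partial x^i}-\gamma^i{}_{jk}y^jy^k\frac{\partial}{\partial y^i}$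 of $F$ (where $\gamma^i{}_{jk}=\frac12g^{is}\left(\frac{\partial g_{sj}}{\partial x^k}+\frac{\partial g_{sk}}{\partial x^j}-\frac{\partial g_{jk}}{\partial x^s}\right)$), then $\mathcal E$ is single-valued and $\mathcal G=F_*\mathcal E$ on $T^*M\setminus 0$. (2) Let $F$ be a $C^0$-Finsler structure of Pontryagin type and let $x:[a,b]\to M$ be a minimizing path. (a) $x$ is parameterized by arclength if and only if it is the projection of an integral curve of $\mathcal E$. (b) $x$ has constant positive speed if and only if it is the projection of an integral curve of $F_*\mathcal E$. (c) If $(x(t),\alpha(t))$ is an integral curve of $\mathcal E$, then $F_*(x(t),\alpha(t))$ is a positive constant and $(x(t),c\,\alpha(t))$ is an integral curve of $\mathcal E$ for every $c>0$. If moreover $F_*(x(t),\alpha(t))=1$ for all $t$, then for every $c>0$ the curve $(x(ct),c\,\alpha(ct))$, $t\in[a/c,b/c]$, is an integral curve of $F_*\mathcal E$. In particular, for every $c>0$, $t\mapsto x(ct)$ is the projection of an integral curve of $F_*\mathcal E$. (d) If $(x(t),\alpha(t))$ is an integral curve of $F_*\mathcal E$, then there is $c>0$ such that $F_*(x(t),\alpha(t))=c$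 for all $t\in[a,b]$, $x$ has constant speed $c$, $t\mapsto x(t/c)$, $t\in[ca,cb]$, is parameterized by arclength, and $(x(t/c),\alpha(t/c))$ is an integral curve of $\mathcal E$. -/

import Mathlib

open Set MeasureTheory
open scoped Manifold ContDiff

noncomputable section

namespace PontryaginFinsler

/-! ### Asymmetric norms -/

/-- An asymmetric norm on a real vector space. -/
structure IsAsymmetricNorm {V : Type*} [AddCommGroup V] [Module ℝ V] (N : V → ℝ) : Prop where
  nonneg : ∀ y, 0 ≤ N y
  eq_zero_iff : ∀ y, N y = 0 ↔ y = 0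
  smul_pos : ∀ (c : ℝ) (y : V), 0 < c → N (c • y) = c * N y
  add_le : ∀ y z, N (y + z) ≤ N y + N z

/-- The dual asymmetric norm `N_*(a) = sup {a y | N y ≤ 1}`. -/
def dualNorm {V : Type*} [AddCommGroup V] [Module ℝ V] [TopologicalSpace V]
    (N : V → ℝ) (a : V →L[ℝ] ℝ) : ℝ :=
  sSup ((fun y => a y) '' {y | N y ≤ 1})

/-! ### Coordinates -/

/-- The coordinate space `ℝⁿ`. -/
abbrev Coord (n : ℕ) : Type := EuclideanSpace ℝ (Fin n)

/-- The space of coordinates `(x¹, …, xⁿ, α₁, …, αₙ)` of the cotangent bundle; the second component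
is the covector `∑ αᵢ dxⁱ` on `ℝⁿ`.  Tangent vectors of the cotangent bundle, in these coordinates,
are elements of the same space. -/
abbrev CotCoord (n : ℕ) : Type := Coord n × (Coord n →L[ℝ] ℝ)

variable {n : ℕ} {M : Type*} [TopologicalSpace M] [ChartedSpace (Coord n) M]

/-- The cotangent space of `M` at `x`. -/
abbrev CotangentSpace (n : ℕ) {M : Type*} [TopologicalSpace M] [ChartedSpace (Coord n) M]
    (x : M) : Type :=
  TangentSpace (𝓡 n) x →L[ℝ] ℝ

/-- `φ` is a smooth coordinate system of `M`, with domain `φ.source`. -/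
def IsCoordSystem (φ : OpenPartialHomeomorph M (Coord n)) : Prop :=
  φ ∈ IsManifold.maximalAtlas (𝓡 n) ∞ M

/-- The expression of `F : TM → ℝ` in the natural coordinates of `TM` associated with `φ`:
`F` of the tangent vector at `φ⁻¹ ξ` whose components are `η`. -/
def inChart (F : TangentBundle (𝓡 n) M → ℝ) (φ : OpenPartialHomeomorph M (Coord n))
    (ξ η : Coord n) : ℝ :=
  F ⟨φ.symm ξ, mfderiv 𝓘(ℝ, Coord n) (𝓡 n) φ.symm ξ η⟩

/-- The natural coordinates `(x, α)` of the covector `α ∈ T*ₓM` associated with `φ`: the second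
component is `α ∘ (dφₓ)⁻¹`. -/
def covectorCoord (φ : OpenPartialHomeomorph M (Coord n)) (x : M) (α : CotangentSpace n x) :
    CotCoord n :=
  (φ x, α ∘L (mfderiv (𝓡 n) 𝓘(ℝ, Coord n) φ x).inverse)

/-! ### Pontryagin type `C⁰`-Finsler structures -/

/-- A `C⁰`-Finsler structure on `M`. -/
structure IsC0Finsler [IsManifold (𝓡 n) ∞ M] (F : TangentBundle (𝓡 n) M → ℝ) : Prop where
  continuous : Continuous F
  asymmetricNorm : ∀ x : M, IsAsymmetricNorm fun y : TangentSpace (𝓡 n) x => F ⟨x, y⟩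

/-- `f` is, in the coordinates `φ` and on the open set `φ⁻¹ Ω`, a family of `C¹` unit vector fields
`X_u = f u`, parameterized by the Euclidean unit sphere, such that `u ↦ X_u(x)` is a homeomorphism
onto the unit sphere of `F` at each point, and such that the components of `X_u(x)` and their
partial derivatives with respect to `x` are continuous in `(x, u)`. -/
structure IsControlFamily (F : TangentBundle (𝓡 n) M → ℝ)
    (φ : OpenPartialHomeomorph M (Coord n)) (Ω : Set (Coord n))
    (f : Metric.sphere (0 : Coord n) 1 → Coord n → Coord n) : Prop where
  isOpen : IsOpen Ω
  subset_target : Ω ⊆ φ.target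
  contDiffOn : ∀ u, ContDiffOn ℝ 1 (f u) Ω
  homeo : ∀ ξ ∈ Ω, ∃ e : Metric.sphere (0 : Coord n) 1 ≃ₜ {η : Coord n // inChart F φ ξ η = 1},
    ∀ u, (e u : Coord n) = f u ξ
  continuousOn : ContinuousOn (fun p : Coord n × Metric.sphere (0 : Coord n) 1 => f p.2 p.1)
    (Ω ×ˢ univ)
  continuousOn_fderiv :
    ContinuousOn (fun p : Coord n × Metric.sphere (0 : Coord n) 1 => fderiv ℝ (f p.2) p.1)
      (Ω ×ˢ univ)

/-- A `C⁰`-Finsler structure of Pontryagin type on `M`. -/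
structure IsPontryaginType [IsManifold (𝓡 n) ∞ M] (F : TangentBundle (𝓡 n) M → ℝ) : Prop
    extends IsC0Finsler F where
  exists_family : ∀ p : M, ∃ φ : OpenPartialHomeomorph M (Coord n),
    IsCoordSystem φ ∧ p ∈ φ.source ∧ ∃ Ω f, φ p ∈ Ω ∧ IsControlFamily F φ Ω f

/-! ### The extended geodesic field -/

/-- The Hamiltonian vector field of `H(ξ, a) = a (X ξ)` in the coordinates of the cotangent bundle:
`X^i ∂/∂xⁱ - α_j (∂X^j/∂xⁱ) ∂/∂αᵢ`. -/
def hamiltonianField (X : Coord n → Coord n) (p : CotCoord n) : CotCoord n :=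
  (X p.1, -(p.2 ∘L fderiv ℝ X p.1))

/-- A set-valued rule on `T*M`: to each coordinate system and each point of `T*M` (given by its
coordinates) it associates a set of tangent vectors of `T*M` (given by their coordinates). -/
abbrev Correspondence (n : ℕ) (M : Type*) [TopologicalSpace M] : Type _ :=
  OpenPartialHomeomorph M (Coord n) → CotCoord n → Set (CotCoord n)

/-- The extended geodesic field `𝓔` on `T*M ∖ 0`: at `(ξ, a)`, the Hamiltonian fields of those
controls `u` which maximize `H_u(ξ, a) = a (X_u ξ)`.  (The vectors obtained do not depend on which
family of unit vector fields is used near the point.) -/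
def extendedField (F : TangentBundle (𝓡 n) M → ℝ) : Correspondence n M := fun φ p =>
  {V | p.2 ≠ 0 ∧ ∃ Ω f, IsControlFamily F φ Ω f ∧ p.1 ∈ Ω ∧
    ∃ u, (∀ v, p.2 (f v p.1) ≤ p.2 (f u p.1)) ∧ V = hamiltonianField (f u) p}

/-- The correspondence `F_* · 𝓔`. -/
def scaledField (F : TangentBundle (𝓡 n) M → ℝ) : Correspondence n M := fun φ p =>
  (fun V => dualNorm (inChart F φ p.1) p.2 • V) '' extendedField F φ p

/-! ### Curves -/

/-- `x : [a, b] → M` is an absolutely continuous path. -/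
def IsACPath (n : ℕ) {M : Type*} [TopologicalSpace M] [ChartedSpace (Coord n) M]
    (x : ℝ → M) (a b : ℝ) : Prop :=
  ContinuousOn x (Icc a b) ∧
    ∀ φ : OpenPartialHomeomorph M (Coord n), IsCoordSystem φ →
      ∀ c d, a ≤ c → c ≤ d → d ≤ b → MapsTo x (Icc c d) φ.source →
        AbsolutelyContinuousOnInterval (fun t => φ (x t)) c d

/-- The velocity `x'(t)`, as a point of the tangent bundle. -/
def velocity (n : ℕ) {M : Type*} [TopologicalSpace M] [ChartedSpace (Coord n) M]
    (x : ℝ → M) (t : ℝ) : TangentBundle (𝓡 n) M :=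
  ⟨x t, mfderiv 𝓘(ℝ, ℝ) (𝓡 n) x t (1 : ℝ)⟩

/-- The length `∫ F(x(t), x'(t)) dt` of a path on `[a, b]`. -/
def pathLength (F : TangentBundle (𝓡 n) M → ℝ) (x : ℝ → M) (a b : ℝ) : ENNReal :=
  ∫⁻ t in Icc a b, ENNReal.ofReal (F (velocity n x t))

/-- `x : [a, b] → M` is a minimizing path: no absolutely continuous path of `M` from `x a` to `x b`
is shorter. -/
def IsMinimizing (F : TangentBundle (𝓡 n) M → ℝ) (x : ℝ → M) (a b : ℝ) : Prop :=
  IsACPath n x a b ∧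
    ∀ (y : ℝ → M) (c d : ℝ), c ≤ d → IsACPath n y c d → y c = x a → y d = x b →
      pathLength F x a b ≤ pathLength F y c d

/-- `x` has constant speed `c` on `[a, b]`. -/
def HasSpeed (F : TangentBundle (𝓡 n) M → ℝ) (x : ℝ → M) (a b c : ℝ) : Prop :=
  ∀ᵐ t ∂volume.restrict (Icc a b), F (velocity n x t) = c

/-- The curve `t ↦ (x t, α t)` in `T*M`, defined on `[a, b]`, is an integral curve of `Φ`: it is
absolutely continuous and its derivative belongs to `Φ` for almost every `t`. -/
def IsIntegralCurve (Φ : Correspondence n M) (x : ℝ → M) (α : ∀ t, CotangentSpace n (x t))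
    (a b : ℝ) : Prop :=
  ContinuousOn x (Icc a b) ∧
    ∀ φ : OpenPartialHomeomorph M (Coord n), IsCoordSystem φ →
      ∀ c d, a ≤ c → c ≤ d → d ≤ b → MapsTo x (Icc c d) φ.source →
        AbsolutelyContinuousOnInterval (fun t => covectorCoord φ (x t) (α t)) c d ∧
        ∀ᵐ t ∂volume.restrict (Icc c d), ∃ V ∈ Φ φ (covectorCoord φ (x t) (α t)),
          HasDerivAt (fun s => covectorCoord φ (x s) (α s)) V t

/-- `F_*(x, α)`, the fiberwise dual asymmetric norm. -/
def dualF (F : TangentBundle (𝓡 n) M → ℝ) (x : M) (α : CotangentSpace n x) : ℝ :=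
  dualNorm (fun y : TangentSpace (𝓡 n) x => F ⟨x, y⟩) α

/-! ### Finsler geometry -/

/-- Second vertical derivatives: the fundamental tensor `g_ij = ½ ∂²F²/∂yⁱ∂yʲ` at `(ξ, η)`. -/
def fundamentalTensor (F : TangentBundle (𝓡 n) M → ℝ) (φ : OpenPartialHomeomorph M (Coord n))
    (ξ η : Coord n) : Matrix (Fin n) (Fin n) ℝ := fun i j =>
  (1 / 2 : ℝ) * fderiv ℝ
    (fun η' => fderiv ℝ (fun η'' => inChart F φ ξ η'' ^ 2) η' (EuclideanSpace.single j 1))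
    η (EuclideanSpace.single i 1)

/-- A (smooth) Finsler structure: nonnegative, smooth off the zero section, positively homogeneous
of degree one, with positive definite fundamental tensor off the zero section. -/
structure IsFinsler [IsManifold (𝓡 n) ∞ M] (F : TangentBundle (𝓡 n) M → ℝ) : Prop where
  nonneg : ∀ v, 0 ≤ F v
  smooth : ContMDiffOn (𝓡 n).tangent 𝓘(ℝ, ℝ) ∞ F {v | v.2 ≠ 0}
  smul_pos : ∀ (x : M) (y : TangentSpace (𝓡 n) x) (c : ℝ), 0 < c → F ⟨x, c • y⟩ = c * F ⟨x, y⟩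
  posDef : ∀ φ : OpenPartialHomeomorph M (Coord n), IsCoordSystem φ →
    ∀ ξ ∈ φ.target, ∀ η, η ≠ 0 → (fundamentalTensor F φ ξ η).PosDef

/-- `∂g_ij/∂xᵏ` at `(ξ, η)`. -/
def tensorDeriv (F : TangentBundle (𝓡 n) M → ℝ) (φ : OpenPartialHomeomorph M (Coord n))
    (ξ η : Coord n) (i j k : Fin n) : ℝ :=
  fderiv ℝ (fun ξ' => fundamentalTensor F φ ξ' η i j) ξ (EuclideanSpace.single k 1)

/-- The formal Christoffel symbols of the second kind `γⁱ_jk` at `(ξ, η)`. -/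
def christoffel (F : TangentBundle (𝓡 n) M → ℝ) (φ : OpenPartialHomeomorph M (Coord n))
    (ξ η : Coord n) (i j k : Fin n) : ℝ :=
  (1 / 2 : ℝ) * ∑ s, (fundamentalTensor F φ ξ η)⁻¹ i s *
    (tensorDeriv F φ ξ η s j k + tensorDeriv F φ ξ η s k j - tensorDeriv F φ ξ η j k s)

/-- The geodesic spray `yⁱ ∂/∂xⁱ - γⁱ_jk yʲ yᵏ ∂/∂yⁱ` on `TM ∖ 0`, in the natural coordinates of
`TM`; its integral curves are the curves `(x, x')` with `x'' + γ(x, x') x' x' = 0`. -/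
def geodesicSpray (F : TangentBundle (𝓡 n) M → ℝ) (φ : OpenPartialHomeomorph M (Coord n))
    (q : Coord n × Coord n) : Coord n × Coord n :=
  (q.2, WithLp.toLp 2 fun i => -∑ j, ∑ k, christoffel F φ q.1 q.2 i j k * q.2 j * q.2 k)

/-- The Legendre transform `(x, y) ↦ (x, g_ij(x, y) yʲ dxⁱ)`, in natural coordinates. -/
def legendre (F : TangentBundle (𝓡 n) M → ℝ) (φ : OpenPartialHomeomorph M (Coord n))
    (q : Coord n × Coord n) : CotCoord n :=
  (q.1, ∑ i, (∑ j, fundamentalTensor F φ q.1 q.2 i j * q.2 j) •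
    (EuclideanSpace.proj i : Coord n →L[ℝ] ℝ))

/-- The geodesic spray `𝓖` on `T*M ∖ 0`: the push-forward of the geodesic spray on `TM ∖ 0` by the
Legendre transform. -/
def cotangentSpray (F : TangentBundle (𝓡 n) M → ℝ) : Correspondence n M := fun φ p =>
  {V | ∃ q : Coord n × Coord n, q.2 ≠ 0 ∧ legendre F φ q = p ∧
    V = fderiv ℝ (legendre F φ) q (geodesicSpray F φ q)}

end PontryaginFinsler

end

/-!
A minimizing path of speed one solves a time-optimal control problem: locally its velocity is
`f(x, u(t))` for a control `u(t)` in the sphere, and `𝓔` is the Hamiltonian system of the Pontryagin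
maximum principle for this problem. The statements about minimizing paths therefore rest on a proof of
the maximum principle, which does not differentiate in `u`, and on the conservation of the maximized
Hamiltonian, which is `F_*`.

The maximum principle (`exists_integralCurve`). The path is divided into finitely many pieces, each of
them in the domain of one control family, driven by a measurable control, and so short that the
linearized equation is solved by a Neumann series (`Piece`, `exists_pieces`). A variation replaces
the velocity by `f(x, v)`, with `v` fixed, on a measurable set of times, or by `0` at all times. Positive
combinations of variations with small coefficients `ε` have velocities of length at most one, because
`F` is convex, and of smaller length if the zero velocity takes part (`Piece.inChart_variation_le`).
The use of convex combinations makes the endpoint of the perturbed path strictly differentiable in `ε`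
(`exists_flow`, `exists_path_variation`), with a derivative which is paired with a covector by solving
the adjoint equation backwards (`adjoint_duality`). If the derivatives of the endpoint for all
variations lay in no closed half-space, finitely many of them would have a vanishing combination with
positive coefficients (`exists_functional_or_positive_combination`), and the implicit function
theorem would give small `ε` with positive coordinates that do not move the endpoint
(`exists_positive_solution`): a shorter path with the same endpoints. So there is an adjoint solution
which pairs nonpositively with all variations (`exists_adjoint_nonpos`). As the set of times of a
variation is arbitrary, the control maximizes this covector at almost all times (`ae_maximum`).

Different pieces live in different coordinate systems, and the definition of an integral curve
refers to all of them; `hamiltonianField_push` and `isIntegralCurve_of_chart` show that it suffices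
to look at one.

Conservation of `F_*` (`dualNorm_const`). Along an integral curve of `𝓔`, or of any multiple of it, the
maximized Hamiltonian is absolutely continuous, and at almost every time it is touched from below by
the Hamiltonian of the control of that time, whose derivative vanishes. Hence `F_*` is a positive
constant, and passing between `𝓔` and `F_* 𝓔` amounts to multiplying the covector by a constant and time
by a constant (`isIntegralCurve_comp_mul`, `minimizing_iff_integralCurve`). Conservation also shows
that the covector of the maximum principle vanishes nowhere.

The Finsler case. At each point `F` is a Minkowski norm. Its fundamental inequality
(`IsMinkowski.legendreMap_lt`) yields the triangle inequality, the bijectivity of the Legendre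
transform, and the uniqueness of the unit vector at which a covector is maximal. Radial projection of
the Euclidean sphere is a control family. For any control family, differentiation of
`F(x, f(x, u)) = 1` in `x` expresses the covector part of `𝓔` by the horizontal derivative of `F²`, so
that at the Legendre transform of `η` the field `𝓔` is the single vector `F(η)⁻¹ (η, ½ ∂F²/∂x)`
(`IsFinsler.extendedField_eq`). Lowering the index of the geodesic spray shows that its push-forward
is `(η, ½ ∂F²/∂x)` (`IsFinsler.fderiv_legendre_geodesicSpray`), and `F(η)` is the dual norm of the
Legendre transform of `η`.
-/

noncomputable section

namespace PontryaginFinsler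

open Filter Topology

/-! ### Absolutely continuous functions and partitions of intervals -/

section AbsolutelyContinuous

open AbsolutelyContinuousOnInterval

variable {X Y : Type*} [PseudoMetricSpace X] [PseudoMetricSpace Y]

/-- A monotone Lipschitz change of parameter sends disjoint families of intervals to disjoint
families of intervals of comparable total length. -/
theorem ac_comp_monotone {f : ℝ → X} {g : ℝ → ℝ} {a b A B : ℝ} {K : NNReal}
    (hf : AbsolutelyContinuousOnInterval f A B) (hg : Monotone g) (hK : LipschitzWith K g)
    (hmaps : MapsTo g (uIcc a b) (uIcc A B)) :
    AbsolutelyContinuousOnInterval (fun t => f (g t)) a b := by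
  rw [absolutelyContinuousOnInterval_iff] at hf ⊢
  intro ε hε
  obtain ⟨δ, hδ, H⟩ := hf ε hε
  refine ⟨δ / (K + 1), by positivity, fun E hE hlen => ?_⟩
  have := H (E.1, fun i => (g (E.2 i).1, g (E.2 i).2)) ?_ ?_
  · simpa using this
  · refine ⟨fun i hi => ⟨hmaps (hE.1 i hi).1, hmaps (hE.1 i hi).2⟩, fun i hi j hj hij => ?_⟩
    have hd : Disjoint (uIoc (E.2 i).1 (E.2 i).2) (uIoc (E.2 j).1 (E.2 j).2) := hE.2 hi hj hij
    simp only [Function.onFun]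
    rw [uIoc, uIoc, Ioc_disjoint_Ioc] at hd ⊢
    rw [← hg.map_min, ← hg.map_max, ← hg.map_min, ← hg.map_max, ← hg.map_min, ← hg.map_max]
    exact hg hd
  · calc ∑ i ∈ Finset.range E.1, dist (g (E.2 i).1) (g (E.2 i).2)
        ≤ ∑ i ∈ Finset.range E.1, (K : ℝ) * dist (E.2 i).1 (E.2 i).2 :=
          Finset.sum_le_sum fun i _ => hK.dist_le_mul _ _
      _ = K * ∑ i ∈ Finset.range E.1, dist (E.2 i).1 (E.2 i).2 := by rw [Finset.mul_sum]
      _ ≤ K * (δ / (K + 1)) := by gcongr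
      _ < (K + 1) * (δ / (K + 1)) := by gcongr; linarith
      _ = δ := by field_simp

theorem ac_comp_lipschitz {f : ℝ → X} {g : X → Y} {s : Set X} {a b : ℝ} {K : NNReal}
    (hf : AbsolutelyContinuousOnInterval f a b) (hg : LipschitzOnWith K g s)
    (hmaps : MapsTo f (uIcc a b) s) :
    AbsolutelyContinuousOnInterval (fun t => g (f t)) a b := by
  rw [absolutelyContinuousOnInterval_iff] at hf ⊢
  intro ε hε
  obtain ⟨δ, hδ, H⟩ := hf (ε / (K + 1)) (by positivity)
  refine ⟨δ, hδ, fun E hE hlen => ?_⟩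
  calc ∑ i ∈ Finset.range E.1, dist (g (f (E.2 i).1)) (g (f (E.2 i).2))
      ≤ ∑ i ∈ Finset.range E.1, (K : ℝ) * dist (f (E.2 i).1) (f (E.2 i).2) :=
        Finset.sum_le_sum fun i hi =>
          hg.dist_le_mul _ (hmaps (hE.1 i hi).1) _ (hmaps (hE.1 i hi).2)
    _ = K * ∑ i ∈ Finset.range E.1, dist (f (E.2 i).1) (f (E.2 i).2) := by rw [Finset.mul_sum]
    _ ≤ K * (ε / (K + 1)) := by gcongr; exact (H E hE hlen).le
    _ < (K + 1) * (ε / (K + 1)) := by gcongr; linarith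
    _ = ε := by field_simp

theorem ac_congr {f g : ℝ → X} {a b : ℝ} (hf : AbsolutelyContinuousOnInterval f a b)
    (h : EqOn f g (uIcc a b)) : AbsolutelyContinuousOnInterval g a b := by
  rw [absolutelyContinuousOnInterval_iff] at hf ⊢
  intro ε hε
  obtain ⟨δ, hδ, H⟩ := hf ε hε
  refine ⟨δ, hδ, fun E hE hlen => ?_⟩
  rw [Finset.sum_congr rfl fun i hi => by
    rw [← h (hE.1 i hi).1, ← h (hE.1 i hi).2]]
  exact H E hE hlen

theorem ac_self {E : Type*} [NormedAddCommGroup E] (f : ℝ → E) (a : ℝ) :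
    AbsolutelyContinuousOnInterval f a a :=
  ac_congr (f := fun _ => f a)
    ((LipschitzWith.const _).lipschitzOnWith (s := uIcc a a)).absolutelyContinuousOnInterval
    fun τ hτ => by rw [uIcc_self] at hτ; rw [hτ]

theorem ac_prodMk {E G : Type*} [NormedAddCommGroup E] [NormedAddCommGroup G]
    {f : ℝ → E} {g : ℝ → G} {a b : ℝ} (hf : AbsolutelyContinuousOnInterval f a b)
    (hg : AbsolutelyContinuousOnInterval g a b) :
    AbsolutelyContinuousOnInterval (fun t => (f t, g t)) a b := by
  have h := Tendsto.add hf hg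
  rw [add_zero] at h
  refine squeeze_zero (fun E => Finset.sum_nonneg fun i _ => dist_nonneg) (fun E => ?_) h
  rw [← Finset.sum_add_distrib]
  refine Finset.sum_le_sum fun i _ => ?_
  rw [Prod.dist_eq]
  exact max_le_add_of_nonneg dist_nonneg dist_nonneg

/-- Absolute continuity on two adjacent intervals gives absolute continuity on their union:
`f = f (min · c) + f (max · c) - f c`. -/
theorem ac_glue {E : Type*} [NormedAddCommGroup E] {f : ℝ → E} {a b c : ℝ}
    (hac : a ≤ c) (hcb : c ≤ b) (h1 : AbsolutelyContinuousOnInterval f a c)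
    (h2 : AbsolutelyContinuousOnInterval f c b) : AbsolutelyContinuousOnInterval f a b := by
  have m1 : Monotone fun t : ℝ => min t c := fun s t h => min_le_min_right c h
  have m2 : Monotone fun t : ℝ => max t c := fun s t h => max_le_max_right c h
  have k1 := ac_comp_monotone (a := a) (b := b) h1 m1 ((LipschitzWith.id (α := ℝ)).min_const c) (by
    intro t ht
    rw [uIcc_of_le (hac.trans hcb)] at ht
    rw [uIcc_of_le hac]
    exact ⟨le_min ht.1 hac, min_le_right _ _⟩)
  have k2 := ac_comp_monotone (a := a) (b := b) h2 m2 ((LipschitzWith.id (α := ℝ)).max_const c) (by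
    intro t ht
    rw [uIcc_of_le (hac.trans hcb)] at ht
    rw [uIcc_of_le hcb]
    exact ⟨le_max_right _ _, max_le ht.2 hcb⟩)
  have k3 : AbsolutelyContinuousOnInterval (fun _ : ℝ => f c) a b :=
    (LipschitzWith.const (f c)).lipschitzOnWith.absolutelyContinuousOnInterval
  refine ac_congr ((k1.add k2).sub k3) fun t _ => ?_
  simp only [Pi.add_apply, Pi.sub_apply]
  rcases le_total t c with h | h
  · rw [min_eq_left h, max_eq_right h]; abel
  · rw [min_eq_right h, max_eq_left h]; abel

theorem ac_comp_contDiffOn {E G : Type*} [NormedAddCommGroup E] [NormedSpace ℝ E]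
    [NormedAddCommGroup G] [NormedSpace ℝ G] {f : ℝ → E} {g : E → G} {U : Set E} {a b : ℝ}
    (hf : AbsolutelyContinuousOnInterval f a b) (hU : IsOpen U) (hg : ContDiffOn ℝ 1 g U)
    (hmaps : MapsTo f (uIcc a b) U) : AbsolutelyContinuousOnInterval (fun t => g (f t)) a b := by
  have hK : IsCompact (f '' uIcc a b) := isCompact_uIcc.image_of_continuousOn hf.continuousOn
  have : LocallyLipschitzOn (f '' uIcc a b) g := by
    rintro _ ⟨t, ht, rfl⟩
    obtain ⟨K, V, hV, h⟩ :=
      (hg.contDiffAt (hU.mem_nhds (hmaps ht))).exists_lipschitzOnWith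
    exact ⟨K, V, mem_nhdsWithin_of_mem_nhds hV, h⟩
  obtain ⟨K, h⟩ := this.exists_lipschitzOnWith_of_compact hK
  exact ac_comp_lipschitz hf h (mapsTo_image _ _)

theorem ac_clm_apply {E G : Type*} [NormedAddCommGroup E] [NormedSpace ℝ E]
    [NormedAddCommGroup G] [NormedSpace ℝ G] {f : ℝ → E →L[ℝ] G} {g : ℝ → E} {a b : ℝ}
    (hf : AbsolutelyContinuousOnInterval f a b) (hg : AbsolutelyContinuousOnInterval g a b) :
    AbsolutelyContinuousOnInterval (fun t => f t (g t)) a b := by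
  have h1 : ContDiff ℝ 1 (fun p : (E →L[ℝ] G) × E => p.1 p.2) :=
    contDiff_fst.clm_apply contDiff_snd
  have h2 := ac_prodMk hf hg
  have h3 := ac_comp_contDiffOn h2 isOpen_univ h1.contDiffOn (mapsTo_univ _ _)
  exact h3

end AbsolutelyContinuous

/-- If every point of `[a, b]` has a neighbourhood whose subintervals all satisfy `P`, then `[a, b]`
has a finite partition into intervals satisfying `P`. -/
theorem exists_partition {a b : ℝ} (hab : a ≤ b) {P : ℝ → ℝ → Prop}
    (hP : ∀ τ ∈ Icc a b, ∃ δ > 0, ∀ s t, a ≤ s → s ≤ t → t ≤ b → |s - τ| < δ → |t - τ| < δ → P s t) :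
    ∃ (t : ℕ → ℝ) (N : ℕ), Monotone t ∧ t 0 = a ∧ t N = b ∧ (∀ i, t i ∈ Icc a b) ∧
      ∀ i, P (t i) (t (i + 1)) := by
  choose! δ hδ H using hP
  obtain ⟨t, h0, hm, ⟨N, hN⟩, hc⟩ := exists_monotone_Icc_subset_open_cover_Icc hab
    (c := fun τ : Icc a b => Metric.ball τ (δ τ)) (fun _ => Metric.isOpen_ball)
    (fun τ _ => mem_iUnion.2 ⟨τ, Metric.mem_ball_self (hδ τ τ.2)⟩)
  refine ⟨fun i => t i, N, fun i j h => hm h, h0, hN N le_rfl, fun i => (t i).2, fun i => ?_⟩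
  obtain ⟨τ, hτ⟩ := hc i
  have hle : t i ≤ t (i + 1) := hm i.le_succ
  exact H τ τ.2 _ _ (t i).2.1 hle (t (i + 1)).2.2 (hτ (left_mem_Icc.2 hle))
    (hτ (right_mem_Icc.2 hle))

/-- A property of intervals which holds locally and passes to the union of two adjacent intervals
holds globally. -/
theorem interval_induction {a b : ℝ} (hab : a ≤ b) {P : ℝ → ℝ → Prop}
    (hP : ∀ τ ∈ Icc a b, ∃ δ > 0, ∀ s t, a ≤ s → s ≤ t → t ≤ b → |s - τ| < δ → |t - τ| < δ → P s t)
    (hglue : ∀ r s t, a ≤ r → r ≤ s → s ≤ t → t ≤ b → P r s → P s t → P r t) : P a b := by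
  obtain ⟨t, N, hm, h0, hN, hI, h⟩ := exists_partition hab hP
  have : ∀ i, P (t 0) (t (i + 1)) := by
    intro i
    induction i with
    | zero => exact h 0
    | succ i ih =>
      exact hglue _ _ _ (hI 0).1 (hm (Nat.zero_le _)) (hm (Nat.le_succ _)) (hI _).2 ih (h (i + 1))
  rcases N with _ | N
  · obtain ⟨δ, hδ, H⟩ := hP a (left_mem_Icc.2 hab)
    have : a = b := by rw [← h0, hN]
    subst this
    exact H a a le_rfl le_rfl le_rfl (by simpa) (by simpa)
  · rw [← h0, ← hN]
    exact this N

/-! ### Differential equations with measurable time dependence -/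

section Volterra

variable {E G : Type*} [NormedAddCommGroup E] [NormedSpace ℝ E]
  [NormedAddCommGroup G] [NormedSpace ℝ G]

open scoped Classical in
/-- The primitive of `w` on `[s, t]` which vanishes at `r`, as a continuous function; it is zero by
convention if `w` is not integrable on `[s, t]` or `r ∉ [s, t]`. -/
def primitive (s t r : ℝ) (w : ℝ → E) : C(Icc s t, E) :=
  if h : r ∈ Icc s t ∧ IntegrableOn w (Icc s t) then
    ⟨fun τ => ∫ σ in r..τ, w σ, by
      have hst : s ≤ t := h.1.1.trans h.1.2
      have := intervalIntegral.continuousOn_primitive_interval' (a := r)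
        ((intervalIntegrable_iff_integrableOn_Icc_of_le hst).2 h.2) (by rw [uIcc_of_le hst]; exact h.1)
      rw [uIcc_of_le hst] at this
      exact continuousOn_iff_continuous_domRestrict.1 this⟩
  else 0

theorem primitive_apply {s t r : ℝ} {w : ℝ → E} (hr : r ∈ Icc s t) (hw : IntegrableOn w (Icc s t))
    (τ : Icc s t) : primitive s t r w τ = ∫ σ in r..τ, w σ := by
  rw [primitive, dif_pos ⟨hr, hw⟩]
  rfl

theorem intervalIntegrable_of_Icc {s t r τ : ℝ} {w : ℝ → E} (hw : IntegrableOn w (Icc s t))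
    (hr : r ∈ Icc s t) (hτ : τ ∈ Icc s t) : IntervalIntegrable w volume r τ := by
  rw [intervalIntegrable_iff]
  exact hw.mono_set ((uIoc_subset_uIcc).trans (uIcc_subset_Icc hr hτ))

theorem norm_intervalIntegral_le {s t r τ B : ℝ} {w : ℝ → E} (hB : 0 ≤ B)
    (hr : r ∈ Icc s t) (hτ : τ ∈ Icc s t)
    (hwB : ∀ σ ∈ Icc s t, ‖w σ‖ ≤ B) : ‖∫ σ in r..τ, w σ‖ ≤ B * (t - s) := by
  refine (intervalIntegral.norm_integral_le_of_norm_le_const fun σ hσ => hwB σ ?_).trans ?_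
  · exact uIcc_subset_Icc hr hτ (uIoc_subset_uIcc hσ)
  · refine mul_le_mul_of_nonneg_left ?_ hB
    rw [abs_le]
    constructor <;> linarith [hr.1, hr.2, hτ.1, hτ.2]

variable {s t : ℝ} (hst : s ≤ t)

include hst in
theorem norm_primitive_le {r : ℝ} {w : ℝ → E} {B : ℝ} (hB : 0 ≤ B)
    (hr : r ∈ Icc s t) (hw : IntegrableOn w (Icc s t)) (hwB : ∀ σ ∈ Icc s t, ‖w σ‖ ≤ B) :
    ‖primitive s t r w‖ ≤ B * (t - s) := by
  rw [ContinuousMap.norm_le _ (mul_nonneg hB (sub_nonneg.2 hst))]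
  intro τ
  rw [primitive_apply hr hw]
  exact norm_intervalIntegral_le hB hr τ.2 hwB

theorem primitive_sub {r : ℝ} {v w : ℝ → E} (hr : r ∈ Icc s t) (hv : IntegrableOn v (Icc s t))
    (hw : IntegrableOn w (Icc s t)) :
    primitive s t r v - primitive s t r w = primitive s t r (fun σ => v σ - w σ) := by
  ext τ
  have hvw : IntegrableOn (fun σ => v σ - w σ) (Icc s t) := hv.sub hw
  rw [ContinuousMap.sub_apply, primitive_apply hr hv, primitive_apply hr hw,
    primitive_apply hr hvw, intervalIntegral.integral_sub
    (intervalIntegrable_of_Icc hv hr τ.2) (intervalIntegrable_of_Icc hw hr τ.2)]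

/-- A measurable bounded linear field along `[s, t]`. -/
structure IsBoundedField (A : ℝ → E →L[ℝ] G) (s t C : ℝ) : Prop where
  meas : AEStronglyMeasurable A (volume.restrict (Icc s t))
  bound : ∀ σ ∈ Icc s t, ‖A σ‖ ≤ C

theorem aestronglyMeasurable_clm_apply {A : ℝ → E →L[ℝ] G} {y : ℝ → E}
    (hA : AEStronglyMeasurable A (volume.restrict (Icc s t))) (hy : ContinuousOn y (Icc s t)) :
    AEStronglyMeasurable (fun σ => A σ (y σ)) (volume.restrict (Icc s t)) :=
  isBoundedBilinearMap_apply.continuous.comp_aestronglyMeasurable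
    (hA.prodMk (hy.aestronglyMeasurable_of_isCompact isCompact_Icc measurableSet_Icc))

theorem integrableOn_of_bound {w : ℝ → E} {B : ℝ}
    (hw : AEStronglyMeasurable w (volume.restrict (Icc s t)))
    (hB : ∀ σ ∈ Icc s t, ‖w σ‖ ≤ B) : IntegrableOn w (Icc s t) :=
  Integrable.of_bound hw B
    ((ae_restrict_iff' measurableSet_Icc).2 (ae_of_all _ hB))

theorem IsBoundedField.integrableOn {A : ℝ → E →L[ℝ] G} {C : ℝ} (hA : IsBoundedField A s t C)
    {y : ℝ → E} (hy : ContinuousOn y (Icc s t)) :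
    IntegrableOn (fun σ => A σ (y σ)) (Icc s t) := by
  obtain ⟨B, hB⟩ := isCompact_Icc.exists_bound_of_continuousOn hy
  refine integrableOn_of_bound (B := C * B) (aestronglyMeasurable_clm_apply hA.meas hy)
    fun σ hσ => ?_
  exact ((A σ).le_opNorm _).trans (mul_le_mul (hA.bound σ hσ) (hB σ hσ) (norm_nonneg _)
    ((norm_nonneg _).trans (hA.bound σ hσ)))

theorem continuousOn_iccExtend (y : C(Icc s t, E)) (S : Set ℝ) :
    ContinuousOn (IccExtend hst y) S :=
  (y.continuous.Icc_extend' (h := hst)).continuousOn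

theorem norm_iccExtend_le (y : C(Icc s t, E)) (σ : ℝ) : ‖IccExtend hst y σ‖ ≤ ‖y‖ :=
  y.norm_coe_le_norm _

/-- The Volterra operator `y ↦ ∫_r A y` on `C([s, t])`. -/
def volterra {A : ℝ → E →L[ℝ] G} {C : ℝ} (hA : IsBoundedField A s t C) {r : ℝ}
    (hr : r ∈ Icc s t) : C(Icc s t, E) →L[ℝ] C(Icc s t, G) :=
  LinearMap.mkContinuous
    { toFun := fun y => primitive s t r fun σ => A σ (IccExtend hst y σ)
      map_add' := fun y z => by
        ext τ
        rw [ContinuousMap.add_apply,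
          primitive_apply hr (hA.integrableOn (continuousOn_iccExtend hst _ _)),
          primitive_apply hr (hA.integrableOn (continuousOn_iccExtend hst _ _)),
          primitive_apply hr (hA.integrableOn (continuousOn_iccExtend hst _ _)),
          ← intervalIntegral.integral_add
            (intervalIntegrable_of_Icc (hA.integrableOn (continuousOn_iccExtend hst _ _)) hr τ.2)
            (intervalIntegrable_of_Icc (hA.integrableOn (continuousOn_iccExtend hst _ _)) hr τ.2)]
        simp [IccExtend]
      map_smul' := fun c y => by
        ext τ
        rw [ContinuousMap.smul_apply,
          primitive_apply hr (hA.integrableOn (continuousOn_iccExtend hst _ _)),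
          primitive_apply hr (hA.integrableOn (continuousOn_iccExtend hst _ _))]
        simp [IccExtend] }
    (C * (t - s)) fun y => by
      have hC : 0 ≤ C := (norm_nonneg _).trans (hA.bound r hr)
      refine (norm_primitive_le hst (mul_nonneg hC (norm_nonneg y)) hr
        (hA.integrableOn (continuousOn_iccExtend hst _ _)) fun σ hσ => ?_).trans
        (le_of_eq (by ring))
      exact ((A σ).le_opNorm _).trans (mul_le_mul (hA.bound σ hσ) (norm_iccExtend_le hst y σ)
        (norm_nonneg _) hC)

theorem volterra_eq {A : ℝ → E →L[ℝ] G} {C : ℝ} (hA : IsBoundedField A s t C) {r : ℝ}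
    (hr : r ∈ Icc s t) (y : C(Icc s t, E)) :
    volterra hst hA hr y = primitive s t r fun σ => A σ (IccExtend hst y σ) := rfl

theorem volterra_apply {A : ℝ → E →L[ℝ] G} {C : ℝ} (hA : IsBoundedField A s t C) {r : ℝ}
    (hr : r ∈ Icc s t) (y : C(Icc s t, E)) (τ : Icc s t) :
    volterra hst hA hr y τ = ∫ σ in r..τ, A σ (IccExtend hst y σ) := by
  rw [volterra_eq, primitive_apply hr (hA.integrableOn (continuousOn_iccExtend hst _ _))]

theorem norm_volterra_le {A : ℝ → E →L[ℝ] G} {C : ℝ} (hA : IsBoundedField A s t C) {r : ℝ}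
    (hr : r ∈ Icc s t) : ‖volterra hst hA hr‖ ≤ C * (t - s) :=
  LinearMap.mkContinuous_norm_le _
    (mul_nonneg ((norm_nonneg _).trans (hA.bound r hr)) (sub_nonneg.2 hst)) _

/-- By a Neumann series, the Volterra operator being of norm less than one. -/
theorem isInvertible_id_sub_volterra [CompleteSpace E] {A : ℝ → E →L[ℝ] E} {C : ℝ}
    (hA : IsBoundedField A s t C) {r : ℝ} (hr : r ∈ Icc s t) (hC : C * (t - s) < 1) :
    (ContinuousLinearMap.id ℝ C(Icc s t, E) - volterra hst hA hr).IsInvertible := by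
  have h := (norm_volterra_le hst hA hr).trans_lt hC
  have hu : IsUnit (1 - volterra hst hA hr) := by
    exact (Units.oneSub (volterra hst hA hr) h).isUnit
  obtain ⟨u, hu⟩ := hu
  refine ⟨ContinuousLinearEquiv.ofUnit u, ?_⟩
  ext1 y
  exact DFunLike.congr_fun hu y

/-- A linear differential equation with bounded measurable coefficients has a solution with
prescribed value at `r`, on an interval on which the coefficients have integral less than `1`. -/
theorem exists_linear_solution [CompleteSpace E] {A : ℝ → E →L[ℝ] E} {C : ℝ}
    (hA : IsBoundedField A s t C) {r : ℝ} (hr : r ∈ Icc s t) (hC : C * (t - s) < 1) (p : E) :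
    ∃ y : ℝ → E, ContinuousOn y (Icc s t) ∧
      ∀ τ ∈ Icc s t, y τ = p + ∫ σ in r..τ, A σ (y σ) := by
  have hst : s ≤ t := hr.1.trans hr.2
  obtain ⟨e, he⟩ := isInvertible_id_sub_volterra hst hA hr hC
  set y := e.symm (ContinuousMap.const _ p)
  have hy : y - volterra hst hA hr y = ContinuousMap.const _ p := by
    have : e y = ContinuousMap.const _ p := e.apply_symm_apply _
    rw [← this, ← ContinuousLinearEquiv.coe_coe, he]
    rfl
  refine ⟨IccExtend hst y, continuousOn_iccExtend hst y _, fun τ hτ => ?_⟩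
  have := DFunLike.congr_fun hy ⟨τ, hτ⟩
  rw [ContinuousMap.sub_apply, volterra_apply, ContinuousMap.const_apply, sub_eq_iff_eq_add] at this
  rwa [IccExtend_of_mem hst y hτ]

end Volterra

section Flow

variable {E : Type*} [NormedAddCommGroup E] [NormedSpace ℝ E]

/-- A time-dependent vector field `g`, measurable in time, which is strictly differentiable with
derivative `g' σ` at the point `x σ` of a given curve, uniformly in `σ ∈ [s, t]`. Boundedness is
required on the curve only, and measurability along continuous curves near it; this is what the
integral equation of the field uses. -/
structure IsC1Along (g : ℝ → E → E) (g' : ℝ → E →L[ℝ] E) (x : ℝ → E) (s t C : ℝ) : Prop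
    extends IsBoundedField g' s t C where
  strict : ∀ η > 0, ∃ δ > 0, ∀ σ ∈ Icc s t, ∀ ξ ∈ Metric.ball (x σ) δ, ∀ ζ ∈ Metric.ball (x σ) δ,
    ‖g σ ξ - g σ ζ - g' σ (ξ - ζ)‖ ≤ η * ‖ξ - ζ‖
  bound_base : ∃ B, ∀ σ ∈ Icc s t, ‖g σ (x σ)‖ ≤ B
  meas_along : ∃ δ > 0, ∀ y : ℝ → E, ContinuousOn y (Icc s t) →
    (∀ σ ∈ Icc s t, y σ ∈ Metric.ball (x σ) δ) →
      AEStronglyMeasurable (fun σ => g σ (y σ)) (volume.restrict (Icc s t))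

variable {s t : ℝ} {x : ℝ → E} {g : ℝ → E → E} {g' : ℝ → E →L[ℝ] E} {C : ℝ}

theorem IsC1Along.exists_integrableOn (hg : IsC1Along g g' x s t C) :
    ∃ δ > 0, ∀ y : ℝ → E, ContinuousOn y (Icc s t) →
      (∀ σ ∈ Icc s t, y σ ∈ Metric.ball (x σ) δ) →
        ∃ B, (∀ σ ∈ Icc s t, ‖g σ (y σ)‖ ≤ B) ∧ IntegrableOn (fun σ => g σ (y σ)) (Icc s t) := by
  obtain ⟨δ₁, hδ₁, H₁⟩ := hg.strict 1 one_pos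
  obtain ⟨δ₂, hδ₂, H₂⟩ := hg.meas_along
  obtain ⟨B, hB⟩ := hg.bound_base
  refine ⟨min δ₁ δ₂, lt_min hδ₁ hδ₂, fun y hy hyx => ⟨B + (C + 1) * δ₁, ?_⟩⟩
  have key : ∀ σ ∈ Icc s t, ‖g σ (y σ)‖ ≤ B + (C + 1) * δ₁ := by
    intro σ hσ
    have h1 : y σ ∈ Metric.ball (x σ) δ₁ := Metric.ball_subset_ball (min_le_left _ _) (hyx σ hσ)
    have h2 := H₁ σ hσ _ h1 _ (Metric.mem_ball_self hδ₁)
    have h3 : ‖y σ - x σ‖ < δ₁ := by rwa [← dist_eq_norm]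
    have hC : 0 ≤ C := (norm_nonneg _).trans (hg.bound σ hσ)
    have h4 : ‖g' σ (y σ - x σ)‖ ≤ C * ‖y σ - x σ‖ :=
      ((g' σ).le_opNorm _).trans (by gcongr; exact hg.bound σ hσ)
    have h5 : g σ (y σ) = (g σ (y σ) - g σ (x σ) - g' σ (y σ - x σ)) + g' σ (y σ - x σ)
        + g σ (x σ) := by abel
    rw [h5]
    calc _ ≤ ‖g σ (y σ) - g σ (x σ) - g' σ (y σ - x σ)‖ + ‖g' σ (y σ - x σ)‖ + ‖g σ (x σ)‖ :=
          norm_add₃_le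
      _ ≤ 1 * ‖y σ - x σ‖ + C * ‖y σ - x σ‖ + B := by gcongr; exact hB σ hσ
      _ ≤ 1 * δ₁ + C * δ₁ + B := by gcongr
      _ = B + (C + 1) * δ₁ := by ring
  exact ⟨key, integrableOn_of_bound
    (H₂ y hy fun σ hσ => Metric.ball_subset_ball (min_le_right _ _) (hyx σ hσ)) key⟩

theorem iccExtend_mem_ball (hst : s ≤ t) {x : C(Icc s t, E)} {y : C(Icc s t, E)} {δ : ℝ}
    (hy : y ∈ Metric.ball x δ) (σ : ℝ) :
    IccExtend hst y σ ∈ Metric.ball (IccExtend hst x σ) δ :=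
  (ContinuousMap.dist_apply_le_dist _).trans_lt hy

/-- The Nemytskii operator `y ↦ ∫_s g(σ, y(σ)) dσ` is strictly differentiable on `C([s, t])`. -/
theorem IsC1Along.hasStrictFDerivAt (hst : s ≤ t) {x : C(Icc s t, E)}
    (hg : IsC1Along g g' (IccExtend hst x) s t C) :
    HasStrictFDerivAt
      (fun y : C(Icc s t, E) => primitive s t s fun σ => g σ (IccExtend hst y σ))
      (volterra hst hg.toIsBoundedField (left_mem_Icc.2 hst)) x := by
  have hs := left_mem_Icc.2 hst
  obtain ⟨δ₀, hδ₀, H₀⟩ := hg.exists_integrableOn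
  rw [hasStrictFDerivAt_iff_isLittleO, Asymptotics.isLittleO_iff]
  intro c hc
  have ht : 0 < t - s + 1 := by linarith
  obtain ⟨δ, hδ, H⟩ := hg.strict (c / (t - s + 1)) (by positivity)
  have hnhds : Metric.ball x (min δ δ₀) ×ˢ Metric.ball x (min δ δ₀) ∈ 𝓝 (x, x) :=
    prod_mem_nhds (Metric.ball_mem_nhds _ (lt_min hδ hδ₀)) (Metric.ball_mem_nhds _ (lt_min hδ hδ₀))
  filter_upwards [hnhds] with p hp
  have i1 : ∀ y ∈ Metric.ball x (min δ δ₀), IntegrableOn (fun σ => g σ (IccExtend hst y σ))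
      (Icc s t) := fun y hy => by
    obtain ⟨_, _, h⟩ := H₀ _ (continuousOn_iccExtend hst y _) fun σ _ =>
      Metric.ball_subset_ball (min_le_right _ _) (iccExtend_mem_ball hst hy σ)
    exact h
  have i2 : IntegrableOn (fun σ => g σ (IccExtend hst p.1 σ) - g σ (IccExtend hst p.2 σ))
      (Icc s t) := (i1 _ hp.1).sub (i1 _ hp.2)
  have i3 := hg.integrableOn (continuousOn_iccExtend hst (p.1 - p.2) (Icc s t))
  rw [primitive_sub hs (i1 _ hp.1) (i1 _ hp.2), volterra_eq,
    primitive_sub hs i2 i3]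
  have hb := norm_primitive_le hst (B := c / (t - s + 1) * ‖p.1 - p.2‖) (by positivity) hs
    (i2.sub i3) ?_
  · refine hb.trans ?_
    have : c / (t - s + 1) * ‖p.1 - p.2‖ * (t - s) =
      c * ‖p.1 - p.2‖ * ((t - s) / (t - s + 1)) := by ring
    rw [this]
    refine mul_le_of_le_one_right (by positivity) ?_
    rw [div_le_one ht]; linarith
  · intro σ hσ
    have h1 := H σ hσ _ (Metric.ball_subset_ball (min_le_left _ _) (iccExtend_mem_ball hst hp.1 σ))
      _ (Metric.ball_subset_ball (min_le_left _ _) (iccExtend_mem_ball hst hp.2 σ))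
    refine h1.trans ?_
    gcongr
    exact norm_iccExtend_le hst (p.1 - p.2) σ

variable {ι : Type*} [Fintype ι]

/-- Smooth dependence on parameters and initial value for the differential equation
`y' = g(σ, y) + ∑ⱼ εⱼ kⱼ(σ, y)` near a solution `x` for `ε = 0`, on a short interval. The integral
equation is solved by the implicit function theorem in `C([s, t])`: its partial derivative in `y` is
the identity minus a Volterra operator of norm less than one. For `q = (ε, p)`, the curve `Y q` is the
solution with initial value `p`, the curve `D q` solves the linearized equation, and `T` is the
derivative of the final value of `Y`. -/
theorem exists_flow [CompleteSpace E] (hst : s ≤ t) (hx : ContinuousOn x (Icc s t))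
    (hg : IsC1Along g g' x s t C) (hC : C * (t - s) < 1)
    (hxg : ∀ τ ∈ Icc s t, x τ = x s + ∫ σ in s..τ, g σ (x σ))
    {k : ι → ℝ → E → E} {k' : ι → ℝ → E →L[ℝ] E} {K : ι → ℝ}
    (hk : ∀ j, IsC1Along (k j) (k' j) x s t (K j)) :
    ∃ (Y : (ι → ℝ) × E → ℝ → E) (D : (ι → ℝ) × E → ℝ → E) (T : (ι → ℝ) × E →L[ℝ] E),
      HasStrictFDerivAt (fun q => Y q t) T (0, x s) ∧
      (∀ q, T q = D q t) ∧
      (∀ τ ∈ Icc s t, Y (0, x s) τ = x τ) ∧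
      (∀ q, ContinuousOn (Y q) (Icc s t)) ∧
      (∀ δ > 0, ∀ᶠ q in 𝓝 (0, x s), ∀ τ ∈ Icc s t, Y q τ ∈ Metric.ball (x τ) δ) ∧
      (∀ᶠ q in 𝓝 (0, x s), ∃ B, (∀ σ ∈ Icc s t,
          ‖g σ (Y q σ) + ∑ j, q.1 j • k j σ (Y q σ)‖ ≤ B) ∧
        IntegrableOn (fun σ => g σ (Y q σ) + ∑ j, q.1 j • k j σ (Y q σ)) (Icc s t) ∧
        ∀ τ ∈ Icc s t, Y q τ = q.2 + ∫ σ in s..τ, (g σ (Y q σ) + ∑ j, q.1 j • k j σ (Y q σ))) ∧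
      (∀ q, ContinuousOn (D q) (Icc s t) ∧
        IntegrableOn (fun σ => g' σ (D q σ) + ∑ j, q.1 j • k j σ (x σ)) (Icc s t) ∧
        ∀ τ ∈ Icc s t, D q τ = q.2 + ∫ σ in s..τ, (g' σ (D q σ) + ∑ j, q.1 j • k j σ (x σ))) := by
  classical
  have hs := left_mem_Icc.2 hst
  have ht := right_mem_Icc.2 hst
  -- replace the curve by an element of `C([s, t])`
  set X : C(Icc s t, E) := ⟨fun τ => x τ, continuousOn_iff_continuous_domRestrict.1 hx⟩ with hX
  have hXx : ∀ σ ∈ Icc s t, IccExtend hst X σ = x σ := fun σ hσ => by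
    rw [IccExtend_of_mem hst X hσ]; rfl
  have transfer : ∀ {h : ℝ → E → E} {h' : ℝ → E →L[ℝ] E} {c : ℝ}, IsC1Along h h' x s t c →
      IsC1Along h h' (IccExtend hst X) s t c := fun {h h' c} hh =>
    { meas := hh.meas
      bound := hh.bound
      strict := fun η hη => by
        obtain ⟨δ, hδ, H⟩ := hh.strict η hη
        refine ⟨δ, hδ, fun σ hσ => ?_⟩
        rw [hXx σ hσ]
        exact H σ hσ
      bound_base := by
        obtain ⟨B, hB⟩ := hh.bound_base
        exact ⟨B, fun σ hσ => by rw [hXx σ hσ]; exact hB σ hσ⟩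
      meas_along := by
        obtain ⟨δ, hδ, H⟩ := hh.meas_along
        exact ⟨δ, hδ, fun y hy hyx => H y hy fun σ hσ => by rw [← hXx σ hσ]; exact hyx σ hσ⟩ }
  have hg₁ := transfer hg
  have hk₁ := fun j => transfer (hk j)
  have dg := hg₁.hasStrictFDerivAt hst
  have dk := fun j => (hk₁ j).hasStrictFDerivAt hst
  have base : ∀ {h : ℝ → E → E} {h' : ℝ → E →L[ℝ] E} {c : ℝ}, IsC1Along h h' x s t c →
      IntegrableOn (fun σ => h σ (x σ)) (Icc s t) := fun {h h' c} hh => by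
    obtain ⟨δ, hδ, H⟩ := hh.exists_integrableOn
    obtain ⟨_, _, h⟩ := H x hx fun σ _ => Metric.mem_ball_self hδ
    exact h
  set Ng : C(Icc s t, E) → C(Icc s t, E) :=
    fun y => primitive s t s fun σ => g σ (IccExtend hst y σ) with hNg
  set Nk : ι → C(Icc s t, E) → C(Icc s t, E) :=
    fun j y => primitive s t s fun σ => k j σ (IccExtend hst y σ) with hNk
  set V := volterra hst hg₁.toIsBoundedField hs
  let cst : E →L[ℝ] C(Icc s t, E) := ContinuousLinearMap.const ℝ (Icc s t)
  have hcst : ∀ p τ, cst p τ = p := fun p τ => rfl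
  let Φ : ((ι → ℝ) × E) × C(Icc s t, E) → C(Icc s t, E) :=
    fun p => p.2 - cst p.1.2 - Ng p.2 - ∑ j, p.1.1 j • Nk j p.2
  let u₀ : ((ι → ℝ) × E) × C(Icc s t, E) := ((0, x s), X)
  have hΦ₀ : Φ u₀ = 0 := by
    ext τ
    simp only [Φ, u₀, Pi.zero_apply, zero_smul, Finset.sum_const_zero, sub_zero,
      ContinuousMap.sub_apply, hcst, ContinuousMap.zero_apply]
    obtain ⟨δ, hδ, H⟩ := hg₁.exists_integrableOn
    obtain ⟨_, _, hi⟩ := H _ (continuousOn_iccExtend hst X _) fun σ _ => Metric.mem_ball_self hδ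
    rw [hNg, primitive_apply hs hi, sub_sub, sub_eq_zero]
    change x τ = _
    rw [hxg τ τ.2]
    congr 1
    refine intervalIntegral.integral_congr fun σ hσ => ?_
    rw [hXx σ (uIcc_subset_Icc hs τ.2 hσ)]
  -- the derivative of the equation
  let P₁ : ((ι → ℝ) × E) × C(Icc s t, E) →L[ℝ] (ι → ℝ) × E := ContinuousLinearMap.fst ℝ _ _
  let P₂ : ((ι → ℝ) × E) × C(Icc s t, E) →L[ℝ] C(Icc s t, E) := ContinuousLinearMap.snd ℝ _ _
  let pr : ι → ((ι → ℝ) × E) × C(Icc s t, E) →L[ℝ] ℝ := fun j =>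
    (ContinuousLinearMap.proj j) ∘L (ContinuousLinearMap.fst ℝ (ι → ℝ) E) ∘L P₁
  let Φ' : ((ι → ℝ) × E) × C(Icc s t, E) →L[ℝ] C(Icc s t, E) :=
    P₂ - cst ∘L (ContinuousLinearMap.snd ℝ (ι → ℝ) E) ∘L P₁ - V ∘L P₂ -
      ∑ j, (pr j).smulRight (Nk j X)
  have hΦ : HasStrictFDerivAt Φ Φ' u₀ := by
    refine ((P₂.hasStrictFDerivAt.sub (ContinuousLinearMap.hasStrictFDerivAt
      (cst ∘L (ContinuousLinearMap.snd ℝ (ι → ℝ) E) ∘L P₁))).sub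
      (HasStrictFDerivAt.comp u₀ (g := Ng) dg P₂.hasStrictFDerivAt)).sub ?_
    refine HasStrictFDerivAt.fun_sum fun j _ => ?_
    have := (pr j).hasStrictFDerivAt (x := u₀) |>.smul
      (HasStrictFDerivAt.comp u₀ (g := Nk j) (dk j) P₂.hasStrictFDerivAt)
    refine this.congr_fderiv ?_
    refine ContinuousLinearMap.ext fun v => ?_
    simp [pr, u₀, P₁, P₂]
  have hΦinr : Φ' ∘L .inr ℝ ((ι → ℝ) × E) C(Icc s t, E) =
      ContinuousLinearMap.id ℝ C(Icc s t, E) - V := by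
    ext1 v
    simp [Φ', pr, P₁, P₂]
  have hinv : (Φ' ∘L .inr ℝ ((ι → ℝ) × E) C(Icc s t, E)).IsInvertible := by
    rw [hΦinr]
    exact isInvertible_id_sub_volterra hst _ hs hC
  let ψ := hΦ.implicitFunctionOfProdDomain hinv
  have hψ := hΦ.hasStrictFDerivAt_implicitFunctionOfProdDomain hinv
  set ψ' := -(Φ' ∘L .inr ℝ ((ι → ℝ) × E) C(Icc s t, E)).inverse ∘L
    (Φ' ∘L .inl ℝ ((ι → ℝ) × E) C(Icc s t, E)) with hψ'
  have hψ₀ : ψ (0, x s) = X :=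
    ((hΦ.eventually_apply_eq_iff_implicitFunctionOfProdDomain hinv).self_of_nhds).1 rfl
  have hψeq := hΦ.eventually_apply_implicitFunctionOfProdDomain hinv
  have hDeq : ∀ q, ψ' q - V (ψ' q) = cst q.2 + ∑ j, q.1 j • Nk j X := by
    intro q
    obtain ⟨e, he⟩ := hinv
    have h1 : ψ' q = -(e.symm (Φ' (q, 0))) := by
      rw [hψ', ← he]
      simp
    have h2 : (ContinuousLinearMap.id ℝ C(Icc s t, E) - V) (ψ' q) = -Φ' (q, 0) := by
      rw [← hΦinr, ← he, h1]
      simp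
    have h3 : ψ' q - V (ψ' q) = -Φ' (q, 0) := h2
    rw [h3]
    simp [Φ', pr, P₁, P₂]
    abel
  -- evaluation of the curves at the end of the interval
  let ev : C(Icc s t, E) →L[ℝ] E := ContinuousMap.evalCLM ℝ (⟨t, ht⟩ : Icc s t)
  have hclose : ∀ δ > 0, ∀ᶠ q in 𝓝 ((0 : ι → ℝ), x s), ψ q ∈ Metric.ball X δ := by
    intro δ hδ
    have := hψ.continuousAt.tendsto
    exact this (by
      rw [show hΦ.implicitFunctionOfProdDomain hinv u₀.1 = X from hψ₀]
      exact Metric.ball_mem_nhds X hδ)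
  refine ⟨fun q => IccExtend hst (ψ q), fun q => IccExtend hst (ψ' q), ev ∘L ψ', ?_, ?_, ?_, ?_,
    ?_, ?_, ?_⟩
  · have := HasStrictFDerivAt.comp ((0 : ι → ℝ), x s) (g := ev) ev.hasStrictFDerivAt hψ
    refine this.congr_of_eventuallyEq (Eventually.of_forall fun q => ?_)
    simp only [Function.comp]
    rw [IccExtend_of_mem hst (ψ q) ht]
    rfl
  · intro q
    change _ = IccExtend hst (ψ' q) t
    rw [IccExtend_of_mem hst (ψ' q) ht]
    rfl
  · intro τ hτ
    simp only
    rw [hψ₀, hXx τ hτ]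
  · exact fun q => continuousOn_iccExtend hst (ψ q) _
  · intro δ hδ
    filter_upwards [hclose δ hδ] with q hq τ hτ
    rw [← hXx τ hτ]
    exact iccExtend_mem_ball hst hq τ
  · obtain ⟨δ, hδ, H⟩ := hg₁.exists_integrableOn
    choose δk hδk Hk using fun j => (hk₁ j).exists_integrableOn
    filter_upwards [hclose δ hδ, eventually_all.2 fun j => hclose (δk j) (hδk j), hψeq]
      with q hq hqk hqψ
    obtain ⟨B, hB, hgi⟩ := H _ (continuousOn_iccExtend hst (ψ q) _) fun σ _ =>
      iccExtend_mem_ball hst hq σ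
    choose Bk hBk hki using fun j => Hk j _ (continuousOn_iccExtend hst (ψ q) _) fun σ _ =>
      iccExtend_mem_ball hst (hqk j) σ
    have hsum : IntegrableOn (fun σ => ∑ j, q.1 j • k j σ (IccExtend hst (ψ q) σ)) (Icc s t) :=
      integrable_finsetSum _ fun j _ => (hki j).smul (q.1 j)
    refine ⟨B + ∑ j, |q.1 j| * Bk j, fun σ hσ => ?_, hgi.add hsum, fun τ hτ => ?_⟩
    · refine (norm_add_le _ _).trans (add_le_add (hB σ hσ) ?_)
      refine (norm_sum_le _ _).trans (Finset.sum_le_sum fun j _ => ?_)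
      rw [norm_smul]
      exact mul_le_mul_of_nonneg_left (hBk j σ hσ) (norm_nonneg _)
    · have h1 : ψ q - cst q.2 - Ng (ψ q) - ∑ j, q.1 j • Nk j (ψ q) = 0 := hqψ.trans hΦ₀
      have h2 := DFunLike.congr_fun h1 ⟨τ, hτ⟩
      simp only [ContinuousMap.sub_apply, hcst, ContinuousMap.zero_apply, ContinuousMap.sum_apply,
        ContinuousMap.smul_apply, hNg, hNk] at h2
      rw [primitive_apply hs hgi, Finset.sum_congr rfl fun j _ => by
        rw [primitive_apply hs (hki j)]] at h2
      rw [IccExtend_of_mem hst (ψ q) hτ]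
      rw [intervalIntegral.integral_add (intervalIntegrable_of_Icc hgi hs hτ)
        (intervalIntegrable_of_Icc hsum hs hτ), intervalIntegral.integral_finsetSum fun j _ =>
        (intervalIntegrable_of_Icc ((hki j).fun_smul (q.1 j)) hs hτ)]
      simp only [intervalIntegral.integral_smul]
      rw [sub_sub, sub_sub, sub_eq_zero] at h2
      rw [h2]
  · intro q
    have hki := fun j => base (hk j)
    have hgi := hg₁.integrableOn (continuousOn_iccExtend hst (ψ' q) (Icc s t))
    have hsum : IntegrableOn (fun σ => ∑ j, q.1 j • k j σ (x σ)) (Icc s t) :=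
      integrable_finsetSum _ fun j _ => (hki j).smul (q.1 j)
    refine ⟨continuousOn_iccExtend hst (ψ' q) _, hgi.add hsum, fun τ hτ => ?_⟩
    have hkX : ∀ j, IntegrableOn (fun σ => k j σ (IccExtend hst X σ)) (Icc s t) := fun j =>
      (hki j).congr_fun (fun σ hσ => by simp only; rw [hXx σ hσ]) measurableSet_Icc
    have h2 := DFunLike.congr_fun (hDeq q) ⟨τ, hτ⟩
    simp only [ContinuousMap.sub_apply, hcst, ContinuousMap.add_apply, ContinuousMap.sum_apply,
      ContinuousMap.smul_apply, hNk, V] at h2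
    rw [volterra_apply, Finset.sum_congr rfl fun j _ => by
        rw [primitive_apply hs (hkX j)], sub_eq_iff_eq_add] at h2
    simp only
    rw [IccExtend_of_mem hst (ψ' q) hτ]
    rw [intervalIntegral.integral_add (intervalIntegrable_of_Icc hgi hs hτ)
        (intervalIntegrable_of_Icc hsum hs hτ), intervalIntegral.integral_finsetSum fun j _ =>
        (intervalIntegrable_of_Icc ((hki j).fun_smul (q.1 j)) hs hτ)]
    simp only [intervalIntegral.integral_smul]
    rw [h2, add_assoc, add_comm (Finset.sum _ _)]
    congr 2
    refine Finset.sum_congr rfl fun j _ => ?_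
    congr 1
    refine intervalIntegral.integral_congr fun σ hσ => ?_
    rw [hXx σ (uIcc_subset_Icc hs hτ hσ)]

end Flow

/-! ### The adjoint equation -/

section Duality

variable {E : Type*} [NormedAddCommGroup E] [NormedSpace ℝ E] {s t : ℝ}

theorem lipschitzOnWith_of_eq_integral {y w : ℝ → E} {p : E} {r B : ℝ} (hr : r ∈ Icc s t)
    (hw : IntegrableOn w (Icc s t)) (hB : ∀ σ ∈ Icc s t, ‖w σ‖ ≤ B)
    (hy : ∀ τ ∈ Icc s t, y τ = p + ∫ σ in r..τ, w σ) :
    LipschitzOnWith B.toNNReal y (Icc s t) := by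
  have hB0 : 0 ≤ B := (norm_nonneg _).trans (hB r hr)
  refine LipschitzOnWith.of_dist_le_mul fun a ha b hb => ?_
  rw [Real.coe_toNNReal _ hB0, hy a ha, hy b hb, dist_add_left, dist_eq_norm,
    intervalIntegral.integral_interval_sub_left (intervalIntegrable_of_Icc hw hr ha)
      (intervalIntegrable_of_Icc hw hr hb), Real.dist_eq]
  exact intervalIntegral.norm_integral_le_of_norm_le_const fun σ hσ =>
    hB σ (uIcc_subset_Icc hb ha (uIoc_subset_uIcc hσ))

theorem ac_of_eq_integral {y w : ℝ → E} {p : E} {r B : ℝ} (hr : r ∈ Icc s t)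
    (hw : IntegrableOn w (Icc s t)) (hB : ∀ σ ∈ Icc s t, ‖w σ‖ ≤ B)
    (hy : ∀ τ ∈ Icc s t, y τ = p + ∫ σ in r..τ, w σ) : AbsolutelyContinuousOnInterval y s t := by
  have := lipschitzOnWith_of_eq_integral hr hw hB hy
  rw [← uIcc_of_le (hr.1.trans hr.2)] at this
  exact this.absolutelyContinuousOnInterval

theorem ae_mem_Ioo (s t : ℝ) : ∀ᵐ τ : ℝ, τ ∈ Icc s t → τ ∈ Ioo s t := by
  have h₁ : ∀ᵐ x : ℝ, x ≠ s := by simp [ae_iff, measure_singleton]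
  have h₂ : ∀ᵐ x : ℝ, x ≠ t := by simp [ae_iff, measure_singleton]
  filter_upwards [h₁, h₂] with τ h1 h2 h
  exact ⟨lt_of_le_of_ne h.1 h1.symm, lt_of_le_of_ne h.2 h2⟩

theorem ae_hasDerivAt_of_eq_integral [CompleteSpace E] {y w : ℝ → E} {p : E} {r : ℝ}
    (hr : r ∈ Icc s t) (hw : IntegrableOn w (Icc s t))
    (hy : ∀ τ ∈ Icc s t, y τ = p + ∫ σ in r..τ, w σ) :
    ∀ᵐ τ, τ ∈ Icc s t → HasDerivAt y (w τ) τ := by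
  have hst : s ≤ t := hr.1.trans hr.2
  have := ((intervalIntegrable_iff_integrableOn_Icc_of_le hst).2 hw).ae_hasDerivAt_integral
  rw [uIcc_of_le hst] at this
  filter_upwards [this, ae_mem_Ioo s t] with τ h1 h2 hτ
  refine ((h1 hτ r hr).const_add p).congr_of_eventuallyEq ?_
  filter_upwards [Icc_mem_nhds (h2 hτ).1 (h2 hτ).2] with σ hσ using hy σ hσ

/-- An absolutely continuous curve is the integral of its derivative, if the latter is bounded. -/
theorem eq_integral_of_ac [CompleteSpace E] {y w : ℝ → E} {B : ℝ} (hst : s ≤ t)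
    (hy : AbsolutelyContinuousOnInterval y s t) (hw : IntegrableOn w (Icc s t))
    (hB : ∀ σ ∈ Icc s t, ‖w σ‖ ≤ B) (hd : ∀ᵐ τ, τ ∈ Icc s t → HasDerivAt y (w τ) τ) :
    ∀ τ ∈ Icc s t, y τ = y s + ∫ σ in s..τ, w σ := by
  have hs := left_mem_Icc.2 hst
  have h1 := ac_of_eq_integral (y := fun τ => y s + ∫ σ in s..τ, w σ) hs hw hB fun _ _ => rfl
  have h2 := ae_hasDerivAt_of_eq_integral (y := fun τ => y s + ∫ σ in s..τ, w σ) hs hw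
    fun _ _ => rfl
  obtain ⟨c, hc⟩ := (hy.sub h1).const_of_ae_hasDerivAt_zero (by
    rw [uIcc_of_le hst]
    filter_upwards [hd, h2] with τ k1 k2 hτ
    simpa using (k1 hτ).sub (k2 hτ))
  rw [uIcc_of_le hst] at hc
  intro τ hτ
  have e1 := hc s hs
  have e2 := hc τ hτ
  simp only [Pi.sub_apply, intervalIntegral.integral_same, add_zero, sub_self] at e1 e2
  rw [← e1] at e2
  exact sub_eq_zero.1 e2

theorem IsBoundedField.exists_integrableOn_neg_comp {A : ℝ → E →L[ℝ] E} {C : ℝ}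
    (hA : IsBoundedField A s t C) {α : ℝ → E →L[ℝ] ℝ} (hα : ContinuousOn α (Icc s t)) :
    ∃ B, (∀ σ ∈ Icc s t, ‖-(α σ ∘L A σ)‖ ≤ B) ∧
      IntegrableOn (fun σ => -(α σ ∘L A σ)) (Icc s t) := by
  obtain ⟨Bα, hBα⟩ := isCompact_Icc.exists_bound_of_continuousOn hα
  have b1 : ∀ σ ∈ Icc s t, ‖-(α σ ∘L A σ)‖ ≤ Bα * C := fun σ hσ => by
    rw [norm_neg]
    exact (ContinuousLinearMap.opNorm_comp_le _ _).trans
      (mul_le_mul (hBα σ hσ) (hA.bound σ hσ) (norm_nonneg _) ((norm_nonneg _).trans (hBα σ hσ)))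
  have m1 : AEStronglyMeasurable (fun σ => α σ ∘L A σ) (volume.restrict (Icc s t)) :=
    (isBoundedBilinearMap_comp (𝕜 := ℝ) (E := E) (F := E)
      (G := ℝ)).continuous.comp_aestronglyMeasurable
      ((hα.aestronglyMeasurable_of_isCompact isCompact_Icc measurableSet_Icc).prodMk hA.meas)
  exact ⟨_, b1, integrableOn_of_bound m1.neg b1⟩

theorem exists_integrableOn_covector_apply {α : ℝ → E →L[ℝ] ℝ} (hα : ContinuousOn α (Icc s t))
    {w : ℝ → E} {B : ℝ} (hw : IntegrableOn w (Icc s t)) (hB : ∀ σ ∈ Icc s t, ‖w σ‖ ≤ B) :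
    ∃ B', (∀ σ ∈ Icc s t, ‖α σ (w σ)‖ ≤ B') ∧ IntegrableOn (fun σ => α σ (w σ)) (Icc s t) := by
  obtain ⟨Bα, hBα⟩ := isCompact_Icc.exists_bound_of_continuousOn hα
  have b3 : ∀ σ ∈ Icc s t, ‖α σ (w σ)‖ ≤ Bα * B := fun σ hσ =>
    ((α σ).le_opNorm _).trans (mul_le_mul (hBα σ hσ) (hB σ hσ) (norm_nonneg _)
      ((norm_nonneg _).trans (hBα σ hσ)))
  have m3 : AEStronglyMeasurable (fun σ => α σ (w σ)) (volume.restrict (Icc s t)) :=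
    isBoundedBilinearMap_apply.continuous.comp_aestronglyMeasurable
      ((hα.aestronglyMeasurable_of_isCompact isCompact_Icc measurableSet_Icc).prodMk
        hw.aestronglyMeasurable)
  exact ⟨_, b3, integrableOn_of_bound m3 b3⟩

/-- The pairing of a solution of the adjoint equation `α' = -α A` with a solution of the linear
equation `D' = A D + w` varies by `∫ α w`. -/
theorem adjoint_duality [CompleteSpace E] {A : ℝ → E →L[ℝ] E} {C : ℝ} (hst : s ≤ t)
    (hA : IsBoundedField A s t C) {α : ℝ → E →L[ℝ] ℝ} (hα : ContinuousOn α (Icc s t))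
    (hαeq : ∀ τ ∈ Icc s t, α τ = α t + ∫ σ in t..τ, -(α σ ∘L A σ))
    {D w : ℝ → E} {h : E} {B : ℝ} (hD : ContinuousOn D (Icc s t))
    (hw : IntegrableOn w (Icc s t)) (hB : ∀ σ ∈ Icc s t, ‖w σ‖ ≤ B)
    (hDeq : ∀ τ ∈ Icc s t, D τ = h + ∫ σ in s..τ, (A σ (D σ) + w σ)) :
    α t (D t) = α s h + ∫ σ in s..t, α σ (w σ) := by
  have hs := left_mem_Icc.2 hst
  have ht := right_mem_Icc.2 hst
  have hC : 0 ≤ C := (norm_nonneg _).trans (hA.bound s hs)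
  obtain ⟨BD, hBD⟩ := isCompact_Icc.exists_bound_of_continuousOn hD
  -- integrability and bounds of the three right-hand sides
  obtain ⟨_, b1, i1⟩ := hA.exists_integrableOn_neg_comp hα
  have b2 : ∀ σ ∈ Icc s t, ‖A σ (D σ) + w σ‖ ≤ C * BD + B := fun σ hσ =>
    (norm_add_le _ _).trans (add_le_add (((A σ).le_opNorm _).trans
      (mul_le_mul (hA.bound σ hσ) (hBD σ hσ) (norm_nonneg _) hC)) (hB σ hσ))
  have i2 : IntegrableOn (fun σ => A σ (D σ) + w σ) (Icc s t) := (hA.integrableOn hD).add hw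
  obtain ⟨_, b3, i3⟩ := exists_integrableOn_covector_apply hα hw hB
  -- the derivative of `α (D) - ∫ α w` vanishes
  have e3 : ∀ τ ∈ Icc s t, (∫ σ in s..τ, α σ (w σ)) = 0 + ∫ σ in s..τ, α σ (w σ) :=
    fun τ _ => (zero_add _).symm
  have ac := (ac_clm_apply (ac_of_eq_integral ht i1 b1 hαeq) (ac_of_eq_integral hs i2 b2 hDeq)).sub
    (ac_of_eq_integral hs i3 b3 e3)
  obtain ⟨c, hc⟩ := ac.const_of_ae_hasDerivAt_zero (by
    rw [uIcc_of_le hst]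
    filter_upwards [ae_hasDerivAt_of_eq_integral ht i1 hαeq,
      ae_hasDerivAt_of_eq_integral hs i2 hDeq, ae_hasDerivAt_of_eq_integral hs i3 e3]
      with τ k1 k2 k3 hτ
    have := ((k1 hτ).clm_apply (k2 hτ)).sub (k3 hτ)
    refine this.congr_deriv ?_
    simp)
  rw [uIcc_of_le hst] at hc
  have e1 := hc s hs
  have e2 := hc t ht
  simp only [Pi.sub_apply, intervalIntegral.integral_same, sub_zero] at e1 e2
  have e0 : D s = h := by simpa using hDeq s hs
  rw [e0] at e1
  rw [e1]
  linarith

/-- The adjoint equation `α' = -α A` has a solution with prescribed final value. -/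
theorem exists_adjoint_solution {A : ℝ → E →L[ℝ] E} {C : ℝ} (hst : s ≤ t)
    (hA : IsBoundedField A s t C) (hC : C * (t - s) < 1) (p : E →L[ℝ] ℝ) :
    ∃ α : ℝ → E →L[ℝ] ℝ, ContinuousOn α (Icc s t) ∧ α t = p ∧
      ∀ τ ∈ Icc s t, α τ = α t + ∫ σ in t..τ, -(α σ ∘L A σ) := by
  let L : (E →L[ℝ] E) →L[ℝ] (E →L[ℝ] ℝ) →L[ℝ] (E →L[ℝ] ℝ) :=
    -(ContinuousLinearMap.compL ℝ E E ℝ).flip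
  have hL : ∀ a α, L a α = -(α ∘L a) := fun a α => rfl
  have hB : IsBoundedField (fun σ => L (A σ)) s t C :=
    { meas := L.continuous.comp_aestronglyMeasurable hA.meas
      bound := fun σ hσ => by
        refine ContinuousLinearMap.opNorm_le_bound _
          ((norm_nonneg _).trans (hA.bound σ hσ)) fun α => ?_
        rw [hL, norm_neg, mul_comm]
        exact (ContinuousLinearMap.opNorm_comp_le _ _).trans
          (mul_le_mul_of_nonneg_left (hA.bound σ hσ) (norm_nonneg _)) }
  obtain ⟨α, h1, h2⟩ := exists_linear_solution hB (right_mem_Icc.2 hst) hC p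
  have ht : α t = p := by simpa using h2 t (right_mem_Icc.2 hst)
  exact ⟨α, h1, ht, fun τ hτ => by rw [ht]; exact h2 τ hτ⟩

end Duality

/-! ### Convex cones and positive solutions of equations -/

section Cone

open scoped Pointwise

variable {E : Type*} [NormedAddCommGroup E] [NormedSpace ℝ E] [FiniteDimensional ℝ E]

/-- A convex cone of a finite-dimensional space which is not the whole space lies in a half-space. -/
theorem exists_functional_nonpos_of_cone (K : Set E) (hconv : Convex ℝ K) (h0 : (0 : E) ∈ K)
    (hsmul : ∀ c : ℝ, 0 < c → ∀ z ∈ K, c • z ∈ K) (hK : K ≠ univ) :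
    ∃ p : E →L[ℝ] ℝ, p ≠ 0 ∧ ∀ z ∈ K, p z ≤ 0 := by
  obtain ⟨z₀, hz₀⟩ := (ne_univ_iff_exists_notMem K).1 hK
  by_cases hint : (interior K).Nonempty
  · obtain ⟨p, hp⟩ := geometric_hahn_banach_open_point hconv.interior isOpen_interior
      (fun h => hz₀ (interior_subset h))
    have hneg : ∀ z ∈ interior K, p z ≤ 0 := by
      intro z hz
      by_contra! hpos
      have hc : 0 < (|p z₀| + 1) / p z := by positivity
      have hmem : ((|p z₀| + 1) / p z) • z ∈ interior K := by
        have : ((|p z₀| + 1) / p z) • interior K ⊆ K := by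
          rintro _ ⟨w, hw, rfl⟩
          exact hsmul _ hc _ (interior_subset hw)
        exact interior_maximal this (isOpen_interior.smul₀ hc.ne') (smul_mem_smul_set hz)
      have := hp _ hmem
      rw [map_smul, smul_eq_mul, div_mul_cancel₀ _ hpos.ne'] at this
      linarith [le_abs_self (p z₀)]
    refine ⟨p, ?_, fun z hz => ?_⟩
    · rintro rfl
      obtain ⟨z, hz⟩ := hint
      simpa using hp z hz
    · have hcl : z ∈ closure (interior K) := by
        rw [hconv.closure_interior_eq_closure_of_nonempty_interior hint]
        exact subset_closure hz
      have hclosed : IsClosed {z | p z ≤ 0} := isClosed_le p.continuous continuous_const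
      exact closure_minimal (fun z hz => hneg z hz) hclosed hcl
  -- a convex set with empty interior spans a proper subspace
  · have hspan : Submodule.span ℝ K ≠ ⊤ := by
      intro htop
      apply hint
      rw [hconv.interior_nonempty_iff_affineSpan_eq_top]
      rw [← AffineSubspace.direction_eq_top_iff_of_nonempty ⟨0, subset_affineSpan ℝ K h0⟩]
      rw [direction_affineSpan, vectorSpan_eq_span_vsub_set_right ℝ h0]
      simpa using htop
    obtain ⟨f, hf0, hf⟩ := Submodule.exists_le_ker_of_lt_top _ (lt_top_iff_ne_top.2 hspan)
    refine ⟨LinearMap.toContinuousLinearMap f, ?_, fun z hz => ?_⟩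
    · intro h
      apply hf0
      ext z
      exact DFunLike.congr_fun h z
    · have : f z = 0 := hf (Submodule.subset_span hz)
      exact this.le

/-- Either the vectors `y j` lie in a closed half-space, or finitely many of them span the space
and have a vanishing linear combination with positive coefficients. -/
theorem exists_functional_or_positive_combination {J : Type*} (y : J → E) (j₀ : J) :
    (∃ p : E →L[ℝ] ℝ, p ≠ 0 ∧ ∀ j, p (y j) ≤ 0) ∨
    ∃ S : Finset J, j₀ ∈ S ∧ (∃ c : J → ℝ, (∀ j, 0 < c j) ∧ ∑ j ∈ S, c j • y j = 0) ∧
      ∀ w, ∃ d : J → ℝ, ∑ j ∈ S, d j • y j = w := by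
  classical
  -- the convex cone spanned by the vectors
  set K : Set E := {w | ∃ (S : Finset J) (c : J → ℝ), (∀ j, 0 ≤ c j) ∧ (∀ j ∉ S, c j = 0) ∧
    ∑ j ∈ S, c j • y j = w} with hK
  have hadd : ∀ z ∈ K, ∀ w ∈ K, z + w ∈ K := by
    rintro _ ⟨S, c, hc, hcS, rfl⟩ _ ⟨T, d, hd, hdT, rfl⟩
    refine ⟨S ∪ T, fun j => c j + d j, fun j => add_nonneg (hc j) (hd j), fun j hj => ?_, ?_⟩
    · rw [Finset.notMem_union] at hj
      simp only [hcS j hj.1, hdT j hj.2, add_zero]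
    · simp only [add_smul, Finset.sum_add_distrib]
      congr 1
      · exact (Finset.sum_subset Finset.subset_union_left fun j _ hj => by
          rw [hcS j hj, zero_smul]).symm
      · exact (Finset.sum_subset Finset.subset_union_right fun j _ hj => by
          rw [hdT j hj, zero_smul]).symm
  have hsmul : ∀ a : ℝ, 0 ≤ a → ∀ z ∈ K, a • z ∈ K := by
    rintro a ha _ ⟨S, c, hc, hcS, rfl⟩
    refine ⟨S, fun j => a * c j, fun j => mul_nonneg ha (hc j), fun j hj => ?_, ?_⟩
    · simp only [hcS j hj, mul_zero]
    · rw [Finset.smul_sum]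
      exact Finset.sum_congr rfl fun j _ => by rw [smul_smul]
  by_cases huniv : K = univ
  · right
    -- the vectors of a basis and their opposites are nonnegative combinations of finitely many
    -- `y j`, hence so is every vector
    have hmem : ∀ w : E, ∃ (S : Finset J) (c : J → ℝ), (∀ j, 0 ≤ c j) ∧ (∀ j ∉ S, c j = 0) ∧
        ∑ j ∈ S, c j • y j = w := fun w => by
      have : w ∈ K := by rw [huniv]; trivial
      exact this
    choose T c hc hcT hcs using hmem
    let b := Module.finBasis ℝ E
    set S : Finset J := insert j₀ ((Finset.univ.biUnion fun i => T (b i)) ∪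
      Finset.univ.biUnion fun i => T (-b i)) with hS
    have hext : ∀ w, T w ⊆ S → ∑ j ∈ S, c w j • y j = w := fun w hw => by
      rw [← Finset.sum_subset hw fun j _ hj => by rw [hcT w j hj, zero_smul]]
      exact hcs w
    have h1 : ∀ i, ∑ j ∈ S, c (b i) j • y j = b i := fun i => hext _ fun j hj => by
      rw [hS]
      refine Finset.mem_insert_of_mem (Finset.mem_union_left _ ?_)
      exact Finset.mem_biUnion.2 ⟨i, Finset.mem_univ _, hj⟩
    have h2 : ∀ i, ∑ j ∈ S, c (-b i) j • y j = -b i := fun i => hext _ fun j hj => by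
      rw [hS]
      refine Finset.mem_insert_of_mem (Finset.mem_union_right _ ?_)
      exact Finset.mem_biUnion.2 ⟨i, Finset.mem_univ _, hj⟩
    have h3 : ∀ w, ∃ d : J → ℝ, (∀ j, 0 ≤ d j) ∧ ∑ j ∈ S, d j • y j = w := by
      intro w
      refine ⟨fun j => ∑ i, (max (b.repr w i) 0 * c (b i) j + max (-b.repr w i) 0 * c (-b i) j),
        fun j => Finset.sum_nonneg fun i _ => add_nonneg
          (mul_nonneg (le_max_right _ _) (hc _ _)) (mul_nonneg (le_max_right _ _) (hc _ _)), ?_⟩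
      simp only [Finset.sum_smul]
      rw [Finset.sum_comm]
      conv_rhs => rw [← b.sum_repr w]
      refine Finset.sum_congr rfl fun i _ => ?_
      simp only [add_smul, mul_smul, Finset.sum_add_distrib]
      rw [← Finset.smul_sum, ← Finset.smul_sum, h1, h2, smul_neg, ← sub_eq_add_neg, ← sub_smul]
      congr 1
      rcases le_total (b.repr w i) 0 with h | h
      · rw [max_eq_right h, max_eq_left (neg_nonneg.2 h)]; ring
      · rw [max_eq_left h, max_eq_right (neg_nonpos.2 h)]; ring
    refine ⟨S, Finset.mem_insert_self _ _, ?_, fun w => ?_⟩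
    -- to make all coefficients positive, represent the opposite of the sum of the `y j`
    · obtain ⟨d, hd, hds⟩ := h3 (-∑ j ∈ S, y j)
      refine ⟨fun j => 1 + d j, fun j => by linarith [hd j], ?_⟩
      simp only [add_smul, one_smul, Finset.sum_add_distrib]
      rw [hds, add_neg_cancel]
    · obtain ⟨d, _, hd⟩ := h3 w
      exact ⟨d, hd⟩
  · left
    obtain ⟨p, hp0, hp⟩ := exists_functional_nonpos_of_cone K
      (fun z hz w hw a b ha hb _ => hadd _ (hsmul a ha z hz) _ (hsmul b hb w hw))
      ⟨∅, 0, fun _ => le_rfl, fun _ _ => rfl, by simp⟩ (fun c hc z hz => hsmul c hc.le z hz) huniv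
    refine ⟨p, hp0, fun j => hp _ ⟨{j}, Pi.single j 1, fun i => ?_, fun i hi => ?_, by simp⟩⟩
    · by_cases h : i = j
      · subst h; simp
      · simp [Pi.single_eq_of_ne h]
    · rw [Finset.mem_singleton] at hi
      simp [Pi.single_eq_of_ne hi]

/-- If the derivative at `0` of `G` is onto and vanishes on a vector with positive coordinates, then
the level set of `G` through `0` contains points with positive coordinates arbitrarily near `0`. -/
theorem exists_positive_solution {ι : Type*} [Fintype ι] {G : (ι → ℝ) → E}
    {L : (ι → ℝ) →L[ℝ] E} (hG : HasStrictFDerivAt G L 0) (hL : L.range = ⊤) {c : ι → ℝ}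
    (hc : ∀ j, 0 < c j) (hLc : L c = 0) {U : Set (ι → ℝ)} (hU : U ∈ 𝓝 0) :
    ∃ ε ∈ U, (∀ j, 0 < ε j) ∧ G ε = G 0 := by
  -- the implicit function gives a curve `ψ` in the level set with `ψ' 0 = c`
  let k : L.ker := ⟨c, hLc⟩
  let ψ : ℝ → (ι → ℝ) := fun r => hG.implicitFunction G L hL (G 0) (r • k)
  have hlin : HasDerivAt (fun r : ℝ => r • k) k 0 := by
    simpa using (hasDerivAt_id (0 : ℝ)).smul_const k
  have hψ : HasDerivAt ψ c 0 := by
    have h1 : HasStrictFDerivAt (hG.implicitFunction G L hL (G 0)) L.ker.subtypeL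
      ((fun r : ℝ => r • k) 0) := by
      simp only [zero_smul]
      exact hG.to_implicitFunction hL
    exact h1.hasFDerivAt.comp_hasDerivAt 0 hlin
  have hψ0 : ψ 0 = 0 := by
    simp only [ψ, zero_smul]
    exact hG.implicitFunction_apply_image hL
  have hcont : Tendsto ψ (𝓝[>] 0) (𝓝 0) := by
    have := hψ.continuousAt.tendsto
    rw [hψ0] at this
    exact this.mono_left nhdsWithin_le_nhds
  have hpos : ∀ᶠ r in 𝓝[>] (0 : ℝ), ∀ j, 0 < ψ r j := by
    rw [eventually_all]
    intro j
    have hj : HasDerivAt (fun r => ψ r j) (c j) 0 := (hasDerivAt_pi.1 hψ) j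
    have h1 := (hasDerivAt_iff_tendsto_slope.1 hj).mono_left
      (nhdsWithin_mono 0 (fun r (hr : 0 < r) => hr.ne' : Ioi (0 : ℝ) ⊆ {0}ᶜ))
    filter_upwards [h1.eventually (lt_mem_nhds (hc j)), self_mem_nhdsWithin] with r hr hr0
    rw [slope_def_field, sub_zero, hψ0] at hr
    have hr0' : (0 : ℝ) < r := hr0
    have := mul_pos hr hr0'
    rwa [div_mul_cancel₀ _ hr0'.ne', Pi.zero_apply, sub_zero] at this
  have hval : ∀ᶠ r in 𝓝[>] (0 : ℝ), G (ψ r) = G 0 := by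
    have h1 := hG.map_implicitFunction_eq hL
    have h2 : Tendsto (fun r : ℝ => (G 0, r • k)) (𝓝[>] 0) (𝓝 (G 0, 0)) := by
      have : Continuous fun r : ℝ => (G 0, r • k) := by fun_prop
      have := this.tendsto 0
      simp only [zero_smul] at this
      exact this.mono_left nhdsWithin_le_nhds
    exact h2.eventually h1
  obtain ⟨r, h1, h2, h3⟩ := ((hcont.eventually hU).and (hpos.and hval)).exists
  exact ⟨ψ r, h1, h2, h3⟩

end Cone

/-! ### Coordinate systems, transition maps and the natural coordinates of covectors -/

section Coordinates

variable {n : ℕ} {M : Type*} [TopologicalSpace M] [ChartedSpace (Coord n) M]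
  [IsManifold (𝓡 n) ∞ M]

theorem IsCoordSystem.mdifferentiable {φ : OpenPartialHomeomorph M (Coord n)}
    (hφ : IsCoordSystem φ) : φ.MDifferentiable (𝓡 n) 𝓘(ℝ, Coord n) :=
  ⟨(contMDiffOn_of_mem_maximalAtlas hφ).mdifferentiableOn (by simp),
    (contMDiffOn_symm_of_mem_maximalAtlas hφ).mdifferentiableOn (by simp)⟩

theorem isCoordSystem_chartAt (x : M) : IsCoordSystem (chartAt (Coord n) x) :=
  IsManifold.chart_mem_maximalAtlas x

/-- The domain, in the coordinates `φ`, of the change of coordinates from `φ` to `ψ`. -/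
def overlap (φ ψ : OpenPartialHomeomorph M (Coord n)) : Set (Coord n) :=
  {ξ | ξ ∈ φ.target ∧ φ.symm ξ ∈ ψ.source}

theorem isOpen_overlap (φ ψ : OpenPartialHomeomorph M (Coord n)) : IsOpen (overlap φ ψ) :=
  φ.symm.isOpen_inter_preimage ψ.open_source

/-- The change of coordinates from `φ` to `ψ`. -/
def transition (φ ψ : OpenPartialHomeomorph M (Coord n)) (ξ : Coord n) : Coord n := ψ (φ.symm ξ)

theorem mem_overlap {φ ψ : OpenPartialHomeomorph M (Coord n)} {x : M} (hφ : x ∈ φ.source)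
    (hψ : x ∈ ψ.source) : φ x ∈ overlap φ ψ :=
  ⟨φ.map_source hφ, by rwa [φ.left_inv hφ]⟩

theorem transition_apply {φ : OpenPartialHomeomorph M (Coord n)}
    (ψ : OpenPartialHomeomorph M (Coord n)) {x : M} (hφ : x ∈ φ.source) :
    transition φ ψ (φ x) = ψ x := by
  rw [transition, φ.left_inv hφ]

theorem transition_mem_overlap {φ ψ : OpenPartialHomeomorph M (Coord n)} {ξ : Coord n}
    (hξ : ξ ∈ overlap φ ψ) : transition φ ψ ξ ∈ overlap ψ φ :=
  ⟨ψ.map_source hξ.2, by rw [transition, ψ.left_inv hξ.2]; exact φ.map_target hξ.1⟩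

theorem transition_transition {φ ψ : OpenPartialHomeomorph M (Coord n)} {ξ : Coord n}
    (hξ : ξ ∈ overlap φ ψ) : transition ψ φ (transition φ ψ ξ) = ξ := by
  rw [transition, transition, ψ.left_inv hξ.2, φ.right_inv hξ.1]

theorem symm_transition {φ ψ : OpenPartialHomeomorph M (Coord n)} {ξ : Coord n}
    (hξ : ξ ∈ overlap φ ψ) : ψ.symm (transition φ ψ ξ) = φ.symm ξ :=
  ψ.left_inv hξ.2

theorem contDiffOn_transition {φ ψ : OpenPartialHomeomorph M (Coord n)} (hφ : IsCoordSystem φ)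
    (hψ : IsCoordSystem ψ) : ContDiffOn ℝ ∞ (transition φ ψ) (overlap φ ψ) := by
  rw [← contMDiffOn_iff_contDiffOn]
  exact (contMDiffOn_of_mem_maximalAtlas hψ).comp
    ((contMDiffOn_symm_of_mem_maximalAtlas hφ).mono fun ξ hξ => hξ.1) fun ξ hξ => hξ.2

theorem contDiffAt_transition {φ ψ : OpenPartialHomeomorph M (Coord n)} (hφ : IsCoordSystem φ)
    (hψ : IsCoordSystem ψ) {ξ : Coord n} (hξ : ξ ∈ overlap φ ψ) :
    ContDiffAt ℝ ∞ (transition φ ψ) ξ :=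
  (contDiffOn_transition hφ hψ).contDiffAt ((isOpen_overlap φ ψ).mem_nhds hξ)

theorem differentiableAt_transition {φ ψ : OpenPartialHomeomorph M (Coord n)}
    (hφ : IsCoordSystem φ) (hψ : IsCoordSystem ψ) {ξ : Coord n} (hξ : ξ ∈ overlap φ ψ) :
    DifferentiableAt ℝ (transition φ ψ) ξ :=
  (contDiffAt_transition hφ hψ hξ).differentiableAt (by simp)

theorem contDiffOn_fderiv_transition {φ ψ : OpenPartialHomeomorph M (Coord n)}
    (hφ : IsCoordSystem φ) (hψ : IsCoordSystem ψ) :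
    ContDiffOn ℝ ∞ (fderiv ℝ (transition φ ψ)) (overlap φ ψ) :=
  (contDiffOn_transition hφ hψ).fderiv_of_isOpen (isOpen_overlap φ ψ) (by simp)

theorem fderiv_transition_comp {φ ψ : OpenPartialHomeomorph M (Coord n)} (hφ : IsCoordSystem φ)
    (hψ : IsCoordSystem ψ) {ξ : Coord n} (hξ : ξ ∈ overlap φ ψ) :
    fderiv ℝ (transition ψ φ) (transition φ ψ ξ) ∘L fderiv ℝ (transition φ ψ) ξ =
      ContinuousLinearMap.id ℝ (Coord n) := by
  rw [← fderiv_comp ξ (differentiableAt_transition hψ hφ (transition_mem_overlap hξ))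
    (differentiableAt_transition hφ hψ hξ)]
  have : transition ψ φ ∘ transition φ ψ =ᶠ[𝓝 ξ] id := by
    filter_upwards [(isOpen_overlap φ ψ).mem_nhds hξ] with ζ hζ using transition_transition hζ
  rw [this.fderiv_eq, fderiv_id]

/-- The chain rule for a change of coordinates, in terms of differentials on the manifold. -/
theorem mfderiv_symm_transition {φ ψ : OpenPartialHomeomorph M (Coord n)} (hφ : IsCoordSystem φ)
    (hψ : IsCoordSystem ψ) {ξ : Coord n} (hξ : ξ ∈ overlap φ ψ) (η : Coord n) :
    mfderiv 𝓘(ℝ, Coord n) (𝓡 n) ψ.symm (transition φ ψ ξ) (fderiv ℝ (transition φ ψ) ξ η) =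
      mfderiv 𝓘(ℝ, Coord n) (𝓡 n) φ.symm ξ η := by
  have h1 : mfderiv 𝓘(ℝ, Coord n) (𝓡 n) (ψ.symm ∘ transition φ ψ) ξ =
      (mfderiv 𝓘(ℝ, Coord n) (𝓡 n) ψ.symm (transition φ ψ ξ)).comp
        (mfderiv 𝓘(ℝ, Coord n) 𝓘(ℝ, Coord n) (transition φ ψ) ξ) :=
    mfderiv_comp ξ (hψ.mdifferentiable.mdifferentiableAt_symm (transition_mem_overlap hξ).1)
      (differentiableAt_transition hφ hψ hξ).mdifferentiableAt
  have h2 : ψ.symm ∘ transition φ ψ =ᶠ[𝓝 ξ] φ.symm := by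
    filter_upwards [(isOpen_overlap φ ψ).mem_nhds hξ] with ζ hζ using symm_transition hζ
  rw [h2.mfderiv_eq, mfderiv_eq_fderiv] at h1
  rw [h1]
  rfl

theorem inChart_transition (F : TangentBundle (𝓡 n) M → ℝ)
    {φ ψ : OpenPartialHomeomorph M (Coord n)} (hφ : IsCoordSystem φ)
    (hψ : IsCoordSystem ψ) {ξ : Coord n} (hξ : ξ ∈ overlap φ ψ) (η : Coord n) :
    inChart F ψ (transition φ ψ ξ) (fderiv ℝ (transition φ ψ) ξ η) = inChart F φ ξ η := by
  have key : ∀ (x y : M) (v : TangentSpace (𝓡 n) x) (w : TangentSpace (𝓡 n) y), x = y →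
      (v : Coord n) = w → F ⟨x, v⟩ = F ⟨y, w⟩ := by
    rintro x _ v _ rfl rfl
    rfl
  exact key _ _ _ _ (symm_transition hξ) (mfderiv_symm_transition hφ hψ hξ η)

theorem covectorCoord_snd {φ : OpenPartialHomeomorph M (Coord n)} (hφ : IsCoordSystem φ) {x : M}
    (hx : x ∈ φ.source) (α : CotangentSpace n x) (η : Coord n) :
    (covectorCoord φ x α).2 η =
      α (mfderiv 𝓘(ℝ, Coord n) (𝓡 n) φ.symm (φ x) η : Coord n) := by
  have h : (mfderiv (𝓡 n) 𝓘(ℝ, Coord n) φ x).inverse =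
      ((hφ.mdifferentiable.mfderiv hx).symm :
        TangentSpace 𝓘(ℝ, Coord n) (φ x) →L[ℝ] TangentSpace (𝓡 n) x) :=
    ContinuousLinearMap.inverse_equiv (hφ.mdifferentiable.mfderiv hx)
  change α ((mfderiv (𝓡 n) 𝓘(ℝ, Coord n) φ x).inverse η) = _
  rw [h]
  rfl

/-- The covector at `x` with component `a` in the coordinates `φ`. -/
def ofCoord (φ : OpenPartialHomeomorph M (Coord n)) (x : M) (a : Coord n →L[ℝ] ℝ) :
    CotangentSpace n x :=
  a ∘L (mfderiv (𝓡 n) 𝓘(ℝ, Coord n) φ x)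

theorem covectorCoord_ofCoord {φ : OpenPartialHomeomorph M (Coord n)} (hφ : IsCoordSystem φ) {x : M}
    (hx : x ∈ φ.source) (a : Coord n →L[ℝ] ℝ) :
    covectorCoord φ x (ofCoord φ x a) = (φ x, a) := by
  refine Prod.ext rfl (ContinuousLinearMap.ext fun η => ?_)
  rw [covectorCoord_snd hφ hx]
  exact congrArg a ((hφ.mdifferentiable.mfderiv hx).right_inv η)

/-- The change of natural coordinates of covectors from `φ` to `ψ`. -/
def cotTransition (φ ψ : OpenPartialHomeomorph M (Coord n)) (p : CotCoord n) : CotCoord n :=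
  (transition φ ψ p.1, p.2 ∘L fderiv ℝ (transition ψ φ) (transition φ ψ p.1))

theorem cotTransition_covectorCoord {φ ψ : OpenPartialHomeomorph M (Coord n)}
    (hφ : IsCoordSystem φ) (hψ : IsCoordSystem ψ) {x : M} (hxφ : x ∈ φ.source)
    (hxψ : x ∈ ψ.source) (α : CotangentSpace n x) :
    cotTransition φ ψ (covectorCoord φ x α) = covectorCoord ψ x α := by
  have h1 : transition φ ψ (φ x) = ψ x := transition_apply ψ hxφ
  have h2 : transition ψ φ (ψ x) = φ x := transition_apply φ hxψ
  refine Prod.ext h1 (ContinuousLinearMap.ext fun η => ?_)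
  change (covectorCoord φ x α).2 (fderiv ℝ (transition ψ φ) (transition φ ψ (φ x)) η) = _
  rw [h1, covectorCoord_snd hφ hxφ, covectorCoord_snd hψ hxψ]
  refine congrArg α ?_
  have := mfderiv_symm_transition hψ hφ (mem_overlap hxψ hxφ) η
  rwa [h2] at this

theorem contDiffOn_cotTransition {φ ψ : OpenPartialHomeomorph M (Coord n)}
    (hφ : IsCoordSystem φ) (hψ : IsCoordSystem ψ) :
    ContDiffOn ℝ ∞ (cotTransition φ ψ) (Prod.fst ⁻¹' overlap φ ψ) := by
  have h1 : ContDiffOn ℝ ∞ (fun p : CotCoord n => transition φ ψ p.1) (Prod.fst ⁻¹' overlap φ ψ) :=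
    (contDiffOn_transition hφ hψ).comp contDiff_fst.contDiffOn fun p hp => hp
  refine h1.prodMk (contDiff_snd.contDiffOn.clm_comp ?_)
  exact (contDiffOn_fderiv_transition hψ hφ).comp h1 fun p hp => transition_mem_overlap hp

/-- The derivative of the change of natural coordinates of covectors. -/
theorem hasFDerivAt_cotTransition {φ ψ : OpenPartialHomeomorph M (Coord n)}
    (hφ : IsCoordSystem φ) (hψ : IsCoordSystem ψ) {p : CotCoord n} (hp : p.1 ∈ overlap φ ψ) :
    ∃ L : CotCoord n →L[ℝ] CotCoord n, HasFDerivAt (cotTransition φ ψ) L p ∧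
      ∀ V : CotCoord n, L V = (fderiv ℝ (transition φ ψ) p.1 V.1,
        V.2 ∘L fderiv ℝ (transition ψ φ) (transition φ ψ p.1) +
          p.2 ∘L fderiv ℝ (fderiv ℝ (transition ψ φ)) (transition φ ψ p.1)
            (fderiv ℝ (transition φ ψ) p.1 V.1)) := by
  have h1 : HasFDerivAt (fun q : CotCoord n => transition φ ψ q.1)
      (fderiv ℝ (transition φ ψ) p.1 ∘L ContinuousLinearMap.fst ℝ _ _) p :=
    (differentiableAt_transition hφ hψ hp).hasFDerivAt.comp p hasFDerivAt_fst
  have h2 : HasFDerivAt (fderiv ℝ (transition ψ φ))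
      (fderiv ℝ (fderiv ℝ (transition ψ φ)) (transition φ ψ p.1)) (transition φ ψ p.1) :=
    (((contDiffOn_fderiv_transition hψ hφ).contDiffAt ((isOpen_overlap ψ φ).mem_nhds
      (transition_mem_overlap hp))).differentiableAt (by simp)).hasFDerivAt
  have h3 := (hasFDerivAt_snd (𝕜 := ℝ) (p := p)).clm_comp (h2.comp p h1)
  refine ⟨_, h1.prodMk h3, fun V => ?_⟩
  refine Prod.ext rfl ?_
  ext η
  simp [add_comm]

theorem mfderiv_symm_bijective {φ : OpenPartialHomeomorph M (Coord n)} (hφ : IsCoordSystem φ)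
    {ξ : Coord n} (hξ : ξ ∈ φ.target) :
    Function.Bijective (mfderiv 𝓘(ℝ, Coord n) (𝓡 n) φ.symm ξ) :=
  hφ.mdifferentiable.symm.mfderiv_bijective hξ

theorem dualF_eq (F : TangentBundle (𝓡 n) M → ℝ) {φ : OpenPartialHomeomorph M (Coord n)}
    (hφ : IsCoordSystem φ) {x : M} (hx : x ∈ φ.source) (α : CotangentSpace n x) :
    dualF F x α = dualNorm (inChart F φ (φ x)) (covectorCoord φ x α).2 := by
  have key : ∀ (y : M) (v : TangentSpace (𝓡 n) y), y = x → F ⟨y, v⟩ = F ⟨x, (v : Coord n)⟩ := by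
    rintro _ v rfl
    rfl
  have hsurj := (mfderiv_symm_bijective hφ (φ.map_source hx)).surjective
  rw [dualF, dualNorm, dualNorm]
  congr 1
  ext r
  constructor
  · rintro ⟨y, hy, rfl⟩
    obtain ⟨η, rfl⟩ := hsurj (y : Coord n)
    refine ⟨η, ?_, covectorCoord_snd hφ hx α η⟩
    have := key _ (mfderiv 𝓘(ℝ, Coord n) (𝓡 n) φ.symm (φ x) η) (φ.left_inv hx)
    exact this.le.trans hy
  · rintro ⟨η, hη, rfl⟩
    refine ⟨(mfderiv 𝓘(ℝ, Coord n) (𝓡 n) φ.symm (φ x) η : Coord n), ?_,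
      (covectorCoord_snd hφ hx α η).symm⟩
    have := key _ (mfderiv 𝓘(ℝ, Coord n) (𝓡 n) φ.symm (φ x) η) (φ.left_inv hx)
    exact this.symm.le.trans hη

theorem IsAsymmetricNorm.comp {V W : Type*} [AddCommGroup V] [Module ℝ V] [TopologicalSpace V]
    [AddCommGroup W] [Module ℝ W] [TopologicalSpace W] {N : W → ℝ} (hN : IsAsymmetricNorm N)
    (L : V →L[ℝ] W) (hL : Function.Injective L) : IsAsymmetricNorm fun y => N (L y) where
  nonneg y := hN.nonneg _
  eq_zero_iff y := (hN.eq_zero_iff _).trans (map_eq_zero_iff L hL)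
  smul_pos c y hc := by rw [map_smul, hN.smul_pos c _ hc]
  add_le y z := by rw [map_add]; exact hN.add_le _ _

theorem isAsymmetricNorm_inChart {F : TangentBundle (𝓡 n) M → ℝ} (hF : IsC0Finsler F)
    {φ : OpenPartialHomeomorph M (Coord n)} (hφ : IsCoordSystem φ) {ξ : Coord n}
    (hξ : ξ ∈ φ.target) : IsAsymmetricNorm (inChart F φ ξ) := by
  exact (hF.asymmetricNorm (φ.symm ξ)).comp (mfderiv 𝓘(ℝ, Coord n) (𝓡 n) φ.symm ξ)
    (mfderiv_symm_bijective hφ hξ).injective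

theorem velocity_eq (F : TangentBundle (𝓡 n) M → ℝ) {φ : OpenPartialHomeomorph M (Coord n)}
    (hφ : IsCoordSystem φ) {x : ℝ → M} {t : ℝ} (hx : x t ∈ φ.source) (hc : ContinuousAt x t)
    {v : Coord n} (hv : HasDerivAt (fun s => φ (x s)) v t) :
    F (velocity n x t) = inChart F φ (φ (x t)) v := by
  have h1 : mfderiv 𝓘(ℝ, ℝ) (𝓡 n) (φ.symm ∘ fun s => φ (x s)) t =
      (mfderiv 𝓘(ℝ, Coord n) (𝓡 n) φ.symm (φ (x t))).comp
        (mfderiv 𝓘(ℝ, ℝ) 𝓘(ℝ, Coord n) (fun s => φ (x s)) t) :=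
    mfderiv_comp t (hφ.mdifferentiable.mdifferentiableAt_symm (φ.map_source hx))
      hv.differentiableAt.mdifferentiableAt
  have h2 : (φ.symm ∘ fun s => φ (x s)) =ᶠ[𝓝 t] x := by
    filter_upwards [hc.preimage_mem_nhds (φ.open_source.mem_nhds hx)] with s hs
      using φ.left_inv hs
  rw [h2.mfderiv_eq, mfderiv_eq_fderiv] at h1
  have key : ∀ (y z : M) (v : TangentSpace (𝓡 n) y) (w : TangentSpace (𝓡 n) z), y = z →
      (v : Coord n) = w → F ⟨y, v⟩ = F ⟨z, w⟩ := by
    rintro y _ v _ rfl rfl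
    rfl
  refine key _ _ _ _ (φ.left_inv hx).symm ?_
  rw [h1]
  have h3 : fderiv ℝ (fun s => φ (x s)) t 1 = v := by
    rw [fderiv_eq_smul_deriv, hv.deriv, one_smul]
  exact congrArg (mfderiv 𝓘(ℝ, Coord n) (𝓡 n) φ.symm (φ (x t)) : Coord n → Coord n) h3

theorem differentiableAt_of_velocity {F : TangentBundle (𝓡 n) M → ℝ} (hF : IsC0Finsler F)
    {φ : OpenPartialHomeomorph M (Coord n)}
    (hφ : IsCoordSystem φ) {x : ℝ → M} {t : ℝ} (hx : x t ∈ φ.source)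
    (hv : F (velocity n x t) ≠ 0) : DifferentiableAt ℝ (fun s => φ (x s)) t := by
  have h1 : MDifferentiableAt 𝓘(ℝ, ℝ) (𝓡 n) x t := by
    by_contra h
    apply hv
    have : velocity n x t = ⟨x t, (0 : TangentSpace (𝓡 n) (x t))⟩ := by
      rw [velocity, mfderiv_zero_of_not_mdifferentiableAt h]
      rfl
    rw [this]
    exact ((hF.asymmetricNorm (x t)).eq_zero_iff 0).2 rfl
  have h2 := (hφ.mdifferentiable.mdifferentiableAt hx).comp t h1
  exact mdifferentiableAt_iff_differentiableAt.1 h2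

end Coordinates

/-! ### Control families and the extended geodesic field under changes of coordinates -/

section Transform

variable {n : ℕ} {M : Type*} [TopologicalSpace M] [ChartedSpace (Coord n) M]
  [IsManifold (𝓡 n) ∞ M] {F : TangentBundle (𝓡 n) M → ℝ}
  {φ ψ : OpenPartialHomeomorph M (Coord n)} {Ω : Set (Coord n)}
  {f : Metric.sphere (0 : Coord n) 1 → Coord n → Coord n}

/-- The domain, in the coordinates `ψ`, of a family of vector fields given on `Ω` in the
coordinates `φ`. -/
def pushDomain (φ ψ : OpenPartialHomeomorph M (Coord n)) (Ω : Set (Coord n)) : Set (Coord n) :=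
  overlap ψ φ ∩ transition ψ φ ⁻¹' Ω

/-- The expression in the coordinates `ψ` of a vector field given in the coordinates `φ`. -/
def pushField (φ ψ : OpenPartialHomeomorph M (Coord n)) (X : Coord n → Coord n) (ζ : Coord n) :
    Coord n :=
  fderiv ℝ (transition φ ψ) (transition ψ φ ζ) (X (transition ψ φ ζ))

theorem isOpen_pushDomain (hφ : IsCoordSystem φ) (hψ : IsCoordSystem ψ) (hΩ : IsOpen Ω) :
    IsOpen (pushDomain φ ψ Ω) :=
  (contDiffOn_transition hψ hφ).continuousOn.isOpen_inter_preimage (isOpen_overlap ψ φ) hΩ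

theorem hasFDerivAt_pushField (hφ : IsCoordSystem φ) (hψ : IsCoordSystem ψ) {X : Coord n → Coord n}
    {ζ : Coord n} (hζ : ζ ∈ overlap ψ φ) (hX : DifferentiableAt ℝ X (transition ψ φ ζ)) :
    HasFDerivAt (pushField φ ψ X)
      (fderiv ℝ (transition φ ψ) (transition ψ φ ζ) ∘L
          (fderiv ℝ X (transition ψ φ ζ) ∘L fderiv ℝ (transition ψ φ) ζ) +
        (fderiv ℝ (fderiv ℝ (transition φ ψ)) (transition ψ φ ζ) ∘L
          fderiv ℝ (transition ψ φ) ζ).flip (X (transition ψ φ ζ))) ζ := by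
  have h1 : HasFDerivAt (transition ψ φ) (fderiv ℝ (transition ψ φ) ζ) ζ :=
    (differentiableAt_transition hψ hφ hζ).hasFDerivAt
  have h2 : HasFDerivAt (fderiv ℝ (transition φ ψ))
      (fderiv ℝ (fderiv ℝ (transition φ ψ)) (transition ψ φ ζ)) (transition ψ φ ζ) :=
    (((contDiffOn_fderiv_transition hφ hψ).contDiffAt ((isOpen_overlap φ ψ).mem_nhds
      (transition_mem_overlap hζ))).differentiableAt (by simp)).hasFDerivAt
  exact (h2.comp ζ h1).clm_apply (hX.hasFDerivAt.comp ζ h1)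

omit [IsManifold (𝓡 n) ∞ M] in
theorem IsControlFamily.differentiableAt (hf : IsControlFamily F φ Ω f)
    (u : Metric.sphere (0 : Coord n) 1) {ξ : Coord n} (hξ : ξ ∈ Ω) :
    DifferentiableAt ℝ (f u) ξ :=
  ((hf.contDiffOn u).contDiffAt (hf.isOpen.mem_nhds hξ)).differentiableAt (by simp)

/-- A control family is transported by a change of coordinates to a control family. -/
theorem IsControlFamily.push (hf : IsControlFamily F φ Ω f) (hφ : IsCoordSystem φ)
    (hψ : IsCoordSystem ψ) :
    IsControlFamily F ψ (pushDomain φ ψ Ω) fun u => pushField φ ψ (f u) where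
  isOpen := isOpen_pushDomain hφ hψ hf.isOpen
  subset_target := fun ζ hζ => hζ.1.1
  contDiffOn u := by
    have h1 : ContDiffOn ℝ 1 (transition ψ φ) (pushDomain φ ψ Ω) :=
      ((contDiffOn_transition hψ hφ).of_le (by simp)).mono inter_subset_left
    have h2 : ContDiffOn ℝ 1 (fderiv ℝ (transition φ ψ)) (overlap φ ψ) :=
      (contDiffOn_fderiv_transition hφ hψ).of_le (by simp)
    exact (h2.comp h1 fun ζ hζ => transition_mem_overlap hζ.1).clm_apply
      ((hf.contDiffOn u).comp h1 fun ζ hζ => hζ.2)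
  homeo ζ hζ := by
    obtain ⟨e, he⟩ := hf.homeo _ hζ.2
    have hξ := transition_mem_overlap hζ.1
    have hback := transition_transition hζ.1
    have c1 := fderiv_transition_comp hφ hψ hξ
    have c2 := fderiv_transition_comp hψ hφ hζ.1
    rw [hback] at c1
    let L : Coord n ≃L[ℝ] Coord n := ContinuousLinearEquiv.equivOfInverse
      (fderiv ℝ (transition φ ψ) (transition ψ φ ζ)) (fderiv ℝ (transition ψ φ) ζ)
      (fun v => DFunLike.congr_fun c1 v) (fun v => DFunLike.congr_fun c2 v)
    have hL : ∀ η, inChart F ψ ζ (L η) = inChart F φ (transition ψ φ ζ) η := fun η => by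
      have := inChart_transition F hφ hψ hξ η
      rwa [hback] at this
    refine ⟨e.trans (L.toHomeomorph.subtype fun η => ?_), fun u => ?_⟩
    · change _ ↔ inChart F ψ ζ (L η) = 1
      rw [hL]
    · change L (e u : Coord n) = _
      rw [he]
      rfl
  continuousOn := by
    have h1 : ContinuousOn (fun p : Coord n × Metric.sphere (0 : Coord n) 1 =>
        transition ψ φ p.1) (pushDomain φ ψ Ω ×ˢ univ) :=
      (contDiffOn_transition hψ hφ).continuousOn.comp continuousOn_fst fun p hp => hp.1.1
    have h2 := (contDiffOn_fderiv_transition hφ hψ).continuousOn.comp h1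
      fun p hp => transition_mem_overlap hp.1.1
    exact h2.clm_apply (hf.continuousOn.comp (h1.prodMk continuousOn_snd)
      fun p hp => ⟨hp.1.2, mem_univ _⟩)
  continuousOn_fderiv := by
    have h1 : ContinuousOn (fun p : Coord n × Metric.sphere (0 : Coord n) 1 =>
        transition ψ φ p.1) (pushDomain φ ψ Ω ×ˢ univ) :=
      (contDiffOn_transition hψ hφ).continuousOn.comp continuousOn_fst fun p hp => hp.1.1
    have h2 := (contDiffOn_fderiv_transition hφ hψ).continuousOn.comp h1
      fun p hp => transition_mem_overlap hp.1.1
    have h3 := (((contDiffOn_fderiv_transition hφ hψ).fderiv_of_isOpen (m := ∞)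
      (isOpen_overlap φ ψ) (by simp)).continuousOn).comp h1
      fun p hp => transition_mem_overlap hp.1.1
    have h4 : ContinuousOn (fun p : Coord n × Metric.sphere (0 : Coord n) 1 =>
        fderiv ℝ (transition ψ φ) p.1) (pushDomain φ ψ Ω ×ˢ univ) :=
      (contDiffOn_fderiv_transition hψ hφ).continuousOn.comp continuousOn_fst fun p hp => hp.1.1
    have h5 := hf.continuousOn.comp (h1.prodMk continuousOn_snd)
      fun p (hp : p ∈ pushDomain φ ψ Ω ×ˢ univ) => ⟨hp.1.2, mem_univ _⟩
    have h6 := hf.continuousOn_fderiv.comp (h1.prodMk continuousOn_snd)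
      fun p (hp : p ∈ pushDomain φ ψ Ω ×ˢ univ) => ⟨hp.1.2, mem_univ _⟩
    have h7 := (h2.clm_comp (h6.clm_comp h4)).add
      (((ContinuousLinearMap.flipₗᵢ ℝ (Coord n) (Coord n) (Coord n)).continuous.comp_continuousOn
        (h3.clm_comp h4)).clm_apply h5)
    refine h7.congr fun p hp => ?_
    exact (hasFDerivAt_pushField hφ hψ hp.1.1 (hf.differentiableAt p.2 hp.1.2)).fderiv

/-- The Hamiltonian field of `(ξ, a) ↦ a (X ξ)` does not depend on the coordinates. -/
theorem hamiltonianField_push (hφ : IsCoordSystem φ) (hψ : IsCoordSystem ψ)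
    {X : Coord n → Coord n} {p : CotCoord n} (hp : p.1 ∈ overlap φ ψ)
    (hX : DifferentiableAt ℝ X p.1) {L : CotCoord n →L[ℝ] CotCoord n}
    (hL : ∀ V : CotCoord n, L V = (fderiv ℝ (transition φ ψ) p.1 V.1,
        V.2 ∘L fderiv ℝ (transition ψ φ) (transition φ ψ p.1) +
          p.2 ∘L fderiv ℝ (fderiv ℝ (transition ψ φ)) (transition φ ψ p.1)
            (fderiv ℝ (transition φ ψ) p.1 V.1))) :
    L (hamiltonianField X p) = hamiltonianField (pushField φ ψ X) (cotTransition φ ψ p) := by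
  have hζ := transition_mem_overlap hp
  have hback := transition_transition hp
  set ζ := transition φ ψ p.1 with hζdef
  have hX' : DifferentiableAt ℝ X (transition ψ φ ζ) := by rwa [hback]
  have hY := (hasFDerivAt_pushField hφ hψ hζ hX').differentiableAt
  -- differentiate `Dκ'(ζ) (Y ζ) = X (κ' ζ)`, where `Y` is the transported field and `κ'` the
  -- change of coordinates from `ψ` to `φ`
  have hK : HasFDerivAt (fderiv ℝ (transition ψ φ))
      (fderiv ℝ (fderiv ℝ (transition ψ φ)) ζ) ζ :=
    (((contDiffOn_fderiv_transition hψ hφ).contDiffAt ((isOpen_overlap ψ φ).mem_nhds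
      hζ)).differentiableAt (by simp)).hasFDerivAt
  have d1 := hK.clm_apply hY.hasFDerivAt
  have d2 := hX'.hasFDerivAt.comp ζ (differentiableAt_transition hψ hφ hζ).hasFDerivAt
  have heq : (fun z => fderiv ℝ (transition ψ φ) z (pushField φ ψ X z)) =ᶠ[𝓝 ζ]
      X ∘ transition ψ φ := by
    filter_upwards [(isOpen_overlap ψ φ).mem_nhds hζ] with z hz
    have := fderiv_transition_comp hφ hψ (transition_mem_overlap hz)
    rw [transition_transition hz] at this
    exact DFunLike.congr_fun this _
  have hsymm : IsSymmSndFDerivAt ℝ (transition ψ φ) ζ :=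
    (contDiffAt_transition hψ hφ hζ).isSymmSndFDerivAt (by simp; exact WithTop.coe_le_coe.2 le_top)
  have hder := (d1.congr_of_eventuallyEq heq.symm).unique d2
  have hYζ : pushField φ ψ X ζ = fderiv ℝ (transition φ ψ) p.1 (X p.1) := by
    rw [pushField, hback]
  rw [hL]
  refine Prod.ext ?_ (ContinuousLinearMap.ext fun h => ?_)
  · exact hYζ.symm
  · have h1 := DFunLike.congr_fun hder h
    simp only [add_apply, ContinuousLinearMap.comp_apply,
      ContinuousLinearMap.flip_apply, hback] at h1
    have h2 := hsymm h (pushField φ ψ X ζ)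
    rw [h2, hYζ] at h1
    have h3 := congrArg p.2 h1
    rw [map_add] at h3
    simp only [hamiltonianField, cotTransition, add_apply,
      ContinuousLinearMap.comp_apply, neg_apply]
    rw [← hζdef]
    linarith

/-- `𝓔` does not depend on the coordinates; `L` is the derivative of the change of coordinates of the
cotangent bundle. -/
theorem extendedField_push (hφ : IsCoordSystem φ) (hψ : IsCoordSystem ψ) {p V : CotCoord n}
    (hp : p.1 ∈ overlap φ ψ) (hV : V ∈ extendedField F φ p) {L : CotCoord n →L[ℝ] CotCoord n}
    (hL : ∀ V : CotCoord n, L V = (fderiv ℝ (transition φ ψ) p.1 V.1,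
        V.2 ∘L fderiv ℝ (transition ψ φ) (transition φ ψ p.1) +
          p.2 ∘L fderiv ℝ (fderiv ℝ (transition ψ φ)) (transition φ ψ p.1)
            (fderiv ℝ (transition φ ψ) p.1 V.1))) :
    L V ∈ extendedField F ψ (cotTransition φ ψ p) := by
  obtain ⟨hp0, Ω, f, hf, hpΩ, u, hu, rfl⟩ := hV
  have hζ := transition_mem_overlap hp
  have hback := transition_transition hp
  have c1 := fderiv_transition_comp hφ hψ hp
  have hval : ∀ v, (cotTransition φ ψ p).2 (pushField φ ψ (f v) (cotTransition φ ψ p).1) =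
      p.2 (f v p.1) := fun v => by
    have := DFunLike.congr_fun c1 (f v p.1)
    simp only [cotTransition, pushField, hback, ContinuousLinearMap.comp_apply]
    exact congrArg p.2 this
  refine ⟨fun h0 => hp0 ?_, pushDomain φ ψ Ω, fun u => pushField φ ψ (f u), hf.push hφ hψ, ?_, u,
    fun v => ?_, hamiltonianField_push hφ hψ hp (hf.differentiableAt u hpΩ) hL⟩
  · ext w
    have := DFunLike.congr_fun h0 (fderiv ℝ (transition φ ψ) p.1 w)
    have h2 := DFunLike.congr_fun c1 w
    simp only [cotTransition, ContinuousLinearMap.comp_apply] at this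
    have h3 : p.2 w = p.2 (fderiv ℝ (transition ψ φ) (transition φ ψ p.1)
      (fderiv ℝ (transition φ ψ) p.1 w)) := congrArg p.2 h2.symm
    rw [h3]
    exact this
  · refine ⟨hζ, ?_⟩
    change transition ψ φ (transition φ ψ p.1) ∈ Ω
    rwa [hback]
  · rw [hval, hval]
    exact hu v

end Transform

section IntegralCurves

variable {n : ℕ} {M : Type*} [TopologicalSpace M] [ChartedSpace (Coord n) M]
  [IsManifold (𝓡 n) ∞ M] {F : TangentBundle (𝓡 n) M → ℝ}

theorem isIntegralCurve_glue {Φ : Correspondence n M} {x : ℝ → M} {α : ∀ t, CotangentSpace n (x t)}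
    {a b c : ℝ} (hac : a ≤ c) (hcb : c ≤ b) (h1 : IsIntegralCurve Φ x α a c)
    (h2 : IsIntegralCurve Φ x α c b) : IsIntegralCurve Φ x α a b := by
  refine ⟨?_, fun φ hφ s t has hst htb hm => ?_⟩
  · rw [← Icc_union_Icc_eq_Icc hac hcb]
    exact h1.1.union_of_isClosed h2.1 isClosed_Icc isClosed_Icc
  rcases le_total t c with htc | htc
  · exact h1.2 φ hφ s t has hst htc hm
  rcases le_total c s with hcs | hcs
  · exact h2.2 φ hφ s t hcs hst htb hm
  obtain ⟨k1, k2⟩ := h1.2 φ hφ s c has hcs le_rfl (hm.mono_left (Icc_subset_Icc_right htc))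
  obtain ⟨l1, l2⟩ := h2.2 φ hφ c t le_rfl htc htb (hm.mono_left (Icc_subset_Icc_left hcs))
  refine ⟨ac_glue hcs htc k1 l1, ?_⟩
  rw [← Icc_union_Icc_eq_Icc hcs htc, ae_restrict_union_iff]
  exact ⟨k2, l2⟩

theorem isACPath_glue {x : ℝ → M} {a b c : ℝ} (hac : a ≤ c) (hcb : c ≤ b)
    (h1 : IsACPath n x a c) (h2 : IsACPath n x c b) : IsACPath n x a b := by
  refine ⟨?_, fun φ hφ s t has hst htb hm => ?_⟩
  · rw [← Icc_union_Icc_eq_Icc hac hcb]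
    exact h1.1.union_of_isClosed h2.1 isClosed_Icc isClosed_Icc
  rcases le_total t c with htc | htc
  · exact h1.2 φ hφ s t has hst htc hm
  rcases le_total c s with hcs | hcs
  · exact h2.2 φ hφ s t hcs hst htb hm
  exact ac_glue hcs htc (h1.2 φ hφ s c has hcs le_rfl (hm.mono_left (Icc_subset_Icc_right htc)))
    (h2.2 φ hφ c t le_rfl htc htb (hm.mono_left (Icc_subset_Icc_left hcs)))

/-- A path which is absolutely continuous in one coordinate system containing it is absolutely
continuous. -/
theorem isACPath_of_chart {φ : OpenPartialHomeomorph M (Coord n)} (hφ : IsCoordSystem φ)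
    {x : ℝ → M} {a b : ℝ} (hab : a ≤ b) (hm : MapsTo x (Icc a b) φ.source)
    (hac : AbsolutelyContinuousOnInterval (fun t => φ (x t)) a b) : IsACPath n x a b := by
  refine ⟨?_, fun ψ hψ s t has hst htb hmψ => ?_⟩
  · have h := hac.continuousOn
    rw [uIcc_of_le hab] at h
    exact (φ.continuousOn_symm.comp h fun t ht => φ.map_source (hm ht)).congr
      fun t ht => (φ.left_inv (hm ht)).symm
  · have hsub : Icc s t ⊆ Icc a b := Icc_subset_Icc has htb
    have h1 := hac.mono (c := s) (d := t) (by rw [uIcc_of_le hst, uIcc_of_le hab]; exact hsub)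
    have h2 := ac_comp_contDiffOn h1 (isOpen_overlap φ ψ)
      ((contDiffOn_transition hφ hψ).of_le (by simp))
      (by rw [uIcc_of_le hst]; exact fun τ hτ => mem_overlap (hm (hsub hτ)) (hmψ hτ))
    refine ac_congr h2 fun τ hτ => ?_
    rw [uIcc_of_le hst] at hτ
    exact transition_apply ψ (hm (hsub hτ))

/-- An integral curve of `𝓔` in one coordinate system containing it is an integral curve of `𝓔`. -/
theorem isIntegralCurve_of_chart {φ : OpenPartialHomeomorph M (Coord n)} (hφ : IsCoordSystem φ)
    {x : ℝ → M} {α : ∀ t, CotangentSpace n (x t)} {a b : ℝ} (hab : a ≤ b)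
    (hc : ContinuousOn x (Icc a b)) (hm : MapsTo x (Icc a b) φ.source)
    (hac : AbsolutelyContinuousOnInterval (fun t => covectorCoord φ (x t) (α t)) a b)
    (hd : ∀ᵐ t ∂volume.restrict (Icc a b), ∃ V ∈ extendedField F φ (covectorCoord φ (x t) (α t)),
      HasDerivAt (fun s => covectorCoord φ (x s) (α s)) V t) :
    IsIntegralCurve (extendedField F) x α a b := by
  refine ⟨hc, fun ψ hψ s t has hst htb hmψ => ?_⟩
  have hsub : Icc s t ⊆ Icc a b := Icc_subset_Icc has htb
  have hov : ∀ τ ∈ Icc s t, φ (x τ) ∈ overlap φ ψ := fun τ hτ =>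
    mem_overlap (hm (hsub hτ)) (hmψ hτ)
  have heq : ∀ τ ∈ Icc s t, cotTransition φ ψ (covectorCoord φ (x τ) (α τ)) =
      covectorCoord ψ (x τ) (α τ) := fun τ hτ =>
    cotTransition_covectorCoord hφ hψ (hm (hsub hτ)) (hmψ hτ) _
  constructor
  · have h1 := hac.mono (c := s) (d := t) (by rw [uIcc_of_le hst, uIcc_of_le hab]; exact hsub)
    have h2 := ac_comp_contDiffOn h1 ((isOpen_overlap φ ψ).preimage continuous_fst)
      ((contDiffOn_cotTransition hφ hψ).of_le (by simp))
      (by rw [uIcc_of_le hst]; exact fun τ hτ => hov τ hτ)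
    refine ac_congr h2 fun τ hτ => ?_
    rw [uIcc_of_le hst] at hτ
    exact heq τ hτ
  · rw [ae_restrict_iff' measurableSet_Icc] at hd ⊢
    filter_upwards [hd, ae_mem_Ioo s t] with τ h1 h2 hτ
    obtain ⟨V, hV, hder⟩ := h1 (hsub hτ)
    obtain ⟨L, hL, hLV⟩ := hasFDerivAt_cotTransition hφ hψ (p := covectorCoord φ (x τ) (α τ))
      (hov τ hτ)
    refine ⟨L V, ?_, ?_⟩
    · rw [← heq τ hτ]
      exact extendedField_push hφ hψ (hov τ hτ) hV hLV
    · refine (hL.comp_hasDerivAt τ hder).congr_of_eventuallyEq ?_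
      filter_upwards [Icc_mem_nhds (h2 hτ).1 (h2 hτ).2] with σ hσ using (heq σ hσ).symm

end IntegralCurves

/-! ### The maximized Hamiltonian and compactness properties of control families -/

section Families

variable {n : ℕ} {M : Type*} [TopologicalSpace M] [ChartedSpace (Coord n) M]
  {F : TangentBundle (𝓡 n) M → ℝ} {φ : OpenPartialHomeomorph M (Coord n)} {Ω : Set (Coord n)}
  {f : Metric.sphere (0 : Coord n) 1 → Coord n → Coord n}

theorem IsControlFamily.unit (hf : IsControlFamily F φ Ω f) {ξ : Coord n} (hξ : ξ ∈ Ω)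
    (u : Metric.sphere (0 : Coord n) 1) : inChart F φ ξ (f u ξ) = 1 := by
  obtain ⟨e, he⟩ := hf.homeo ξ hξ
  rw [← he]
  exact (e u).2

theorem IsControlFamily.exists_eq (hf : IsControlFamily F φ Ω f) {ξ η : Coord n} (hξ : ξ ∈ Ω)
    (hη : inChart F φ ξ η = 1) : ∃ u, f u ξ = η := by
  obtain ⟨e, he⟩ := hf.homeo ξ hξ
  exact ⟨e.symm ⟨η, hη⟩, by rw [← he, e.apply_symm_apply]⟩

theorem IsControlFamily.injective (hf : IsControlFamily F φ Ω f) {ξ : Coord n} (hξ : ξ ∈ Ω) :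
    Function.Injective fun u => f u ξ := by
  obtain ⟨e, he⟩ := hf.homeo ξ hξ
  intro u v huv
  simp only [← he] at huv
  exact e.injective (Subtype.ext huv)

theorem IsControlFamily.continuous_control (hf : IsControlFamily F φ Ω f) {ξ : Coord n}
    (hξ : ξ ∈ Ω) : Continuous fun u => f u ξ :=
  hf.continuousOn.comp_continuous (f := fun u => (ξ, u)) (by fun_prop)
    fun u => ⟨hξ, mem_univ u⟩

theorem IsControlFamily.exists_maximizer [Nonempty (Metric.sphere (0 : Coord n) 1)]
    (hf : IsControlFamily F φ Ω f) {ξ : Coord n} (hξ : ξ ∈ Ω) (a : Coord n →L[ℝ] ℝ) :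
    ∃ u, ∀ v, a (f v ξ) ≤ a (f u ξ) := by
  obtain ⟨u, _, hu⟩ := isCompact_univ.exists_isMaxOn univ_nonempty
    (a.continuous.comp (hf.continuous_control hξ)).continuousOn
  exact ⟨u, fun v => hu (mem_univ v)⟩

/-- A covector attains its dual norm at every control which maximizes it. -/
theorem IsControlFamily.isGreatest (hf : IsControlFamily F φ Ω f) {ξ : Coord n} (hξ : ξ ∈ Ω)
    (hN : IsAsymmetricNorm (inChart F φ ξ)) {a : Coord n →L[ℝ] ℝ}
    {u : Metric.sphere (0 : Coord n) 1} (hu : ∀ v, a (f v ξ) ≤ a (f u ξ)) :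
    IsGreatest ((fun y => a y) '' {y | inChart F φ ξ y ≤ 1}) (a (f u ξ)) := by
  refine ⟨⟨f u ξ, (hf.unit hξ u).le, rfl⟩, ?_⟩
  have key : ∀ y, y ≠ 0 → a y ≤ inChart F φ ξ y * a (f u ξ) := by
    intro y hy
    have hpos : 0 < inChart F φ ξ y :=
      lt_of_le_of_ne (hN.nonneg y) fun h => hy ((hN.eq_zero_iff y).1 h.symm)
    obtain ⟨v, hv⟩ := hf.exists_eq hξ (η := (inChart F φ ξ y)⁻¹ • y) (by
      rw [hN.smul_pos _ _ (inv_pos.2 hpos), inv_mul_cancel₀ hpos.ne'])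
    have h1 := hu v
    rw [hv, map_smul, smul_eq_mul] at h1
    calc a y = inChart F φ ξ y * ((inChart F φ ξ y)⁻¹ * a y) := by field_simp
      _ ≤ inChart F φ ξ y * a (f u ξ) := by gcongr
  have hnonneg : 0 ≤ a (f u ξ) := by
    have hne : f u ξ ≠ 0 := fun h => by
      have := hf.unit hξ u
      rw [h, (hN.eq_zero_iff 0).2 rfl] at this
      exact zero_ne_one this
    -- otherwise `a` would be positive at `-f u ξ`, hence at a unit vector
    by_contra! hneg
    have h1 := key (-f u ξ) (neg_ne_zero.2 hne)
    rw [map_neg] at h1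
    nlinarith [hN.nonneg (-f u ξ)]
  rintro _ ⟨y, hy, rfl⟩
  rcases eq_or_ne y 0 with rfl | hy0
  · simpa using hnonneg
  · exact (key y hy0).trans (mul_le_of_le_one_left hnonneg hy)

theorem IsControlFamily.dualNorm_eq (hf : IsControlFamily F φ Ω f) {ξ : Coord n} (hξ : ξ ∈ Ω)
    (hN : IsAsymmetricNorm (inChart F φ ξ)) {a : Coord n →L[ℝ] ℝ}
    {u : Metric.sphere (0 : Coord n) 1} (hu : ∀ v, a (f v ξ) ≤ a (f u ξ)) :
    dualNorm (inChart F φ ξ) a = a (f u ξ) :=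
  (hf.isGreatest hξ hN hu).csSup_eq

theorem IsControlFamily.le_dualNorm (hf : IsControlFamily F φ Ω f) {ξ : Coord n} (hξ : ξ ∈ Ω)
    (hN : IsAsymmetricNorm (inChart F φ ξ)) (a : Coord n →L[ℝ] ℝ)
    (v : Metric.sphere (0 : Coord n) 1) : a (f v ξ) ≤ dualNorm (inChart F φ ξ) a := by
  have : Nonempty (Metric.sphere (0 : Coord n) 1) := ⟨v⟩
  obtain ⟨u, hu⟩ := hf.exists_maximizer hξ a
  rw [hf.dualNorm_eq hξ hN hu]
  exact hu v

theorem IsControlFamily.dualNorm_pos [Nonempty (Metric.sphere (0 : Coord n) 1)]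
    (hf : IsControlFamily F φ Ω f) {ξ : Coord n} (hξ : ξ ∈ Ω)
    (hN : IsAsymmetricNorm (inChart F φ ξ)) {a : Coord n →L[ℝ] ℝ} (ha : a ≠ 0) :
    0 < dualNorm (inChart F φ ξ) a := by
  obtain ⟨y, hy⟩ : ∃ y, a y ≠ 0 := by
    by_contra! h
    exact ha (ContinuousLinearMap.ext h)
  obtain ⟨z, hz⟩ : ∃ z, 0 < a z := by
    rcases hy.lt_or_gt with h | h
    · exact ⟨-y, by rw [map_neg]; linarith⟩
    · exact ⟨y, h⟩
  have hz0 : z ≠ 0 := by rintro rfl; simp at hz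
  have hpos : 0 < inChart F φ ξ z :=
    lt_of_le_of_ne (hN.nonneg z) fun h => hz0 ((hN.eq_zero_iff z).1 h.symm)
  obtain ⟨v, hv⟩ := hf.exists_eq hξ (η := (inChart F φ ξ z)⁻¹ • z) (by
      rw [hN.smul_pos _ _ (inv_pos.2 hpos), inv_mul_cancel₀ hpos.ne'])
  refine lt_of_lt_of_le ?_ (hf.le_dualNorm hξ hN a v)
  rw [hv, map_smul, smul_eq_mul]
  positivity

theorem dualNorm_zero {N : Coord n → ℝ} (hN : IsAsymmetricNorm N) : dualNorm N 0 = 0 := by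
  have : ((fun y : Coord n => (0 : Coord n →L[ℝ] ℝ) y) '' {y | N y ≤ 1}) = {0} := by
    ext r
    constructor
    · rintro ⟨y, _, rfl⟩; simp
    · rintro rfl
      exact ⟨0, by simp [(hN.eq_zero_iff 0).2 rfl], rfl⟩
  rw [dualNorm, this, csSup_singleton]

theorem dualNorm_smul {V : Type*} [AddCommGroup V] [Module ℝ V] [TopologicalSpace V] (N : V → ℝ)
    (a : V →L[ℝ] ℝ) {c : ℝ} (hc : 0 < c) : dualNorm N (c • a) = c * dualNorm N a := by
  rw [dualNorm, dualNorm, ← smul_eq_mul, ← Real.sSup_smul_of_nonneg hc.le]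
  congr 1
  ext r
  simp [mem_smul_set]

/-- A control family is bounded together with its derivatives near each point, uniformly in the control. -/
theorem IsControlFamily.eventually_bound (hf : IsControlFamily F φ Ω f) {ξ : Coord n}
    (hξ : ξ ∈ Ω) :
    ∃ B, 0 ≤ B ∧ ∀ᶠ ζ in 𝓝 ξ, ζ ∈ Ω ∧ ∀ u, ‖f u ζ‖ ≤ B ∧ ‖fderiv ℝ (f u) ζ‖ ≤ B := by
  obtain ⟨r, hr, hsub⟩ := Metric.nhds_basis_closedBall.mem_iff.1 (hf.isOpen.mem_nhds hξ)
  have hK : IsCompact (Metric.closedBall ξ r ×ˢ (univ : Set (Metric.sphere (0 : Coord n) 1))) :=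
    (isCompact_closedBall ξ r).prod isCompact_univ
  have hmono : Metric.closedBall ξ r ×ˢ (univ : Set (Metric.sphere (0 : Coord n) 1)) ⊆ Ω ×ˢ univ :=
    prod_mono hsub le_rfl
  obtain ⟨B₁, h₁⟩ := hK.exists_bound_of_continuousOn (hf.continuousOn.mono hmono)
  obtain ⟨B₂, h₂⟩ := hK.exists_bound_of_continuousOn (hf.continuousOn_fderiv.mono hmono)
  refine ⟨max 0 (max B₁ B₂), le_max_left _ _, ?_⟩
  filter_upwards [Metric.closedBall_mem_nhds ξ hr] with ζ hζ
  exact ⟨hsub hζ, fun u => ⟨(h₁ (ζ, u) ⟨hζ, mem_univ u⟩).trans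
    ((le_max_left _ _).trans (le_max_right _ _)), (h₂ (ζ, u) ⟨hζ, mem_univ u⟩).trans
    ((le_max_right _ _).trans (le_max_right _ _))⟩⟩

/-- The maximized Hamiltonian `(ξ, a) ↦ F_*(ξ, a)` is locally Lipschitz. -/
theorem IsControlFamily.dualNorm_lipschitz [Nonempty (Metric.sphere (0 : Coord n) 1)]
    (hf : IsControlFamily F φ Ω f) (hN : ∀ ξ ∈ Ω, IsAsymmetricNorm (inChart F φ ξ))
    {p : CotCoord n} (hp : p.1 ∈ Ω) :
    ∃ K : NNReal, ∃ U ∈ 𝓝 p, LipschitzOnWith K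
      (fun q : CotCoord n => dualNorm (inChart F φ q.1) q.2) U := by
  obtain ⟨B, hB0, hB⟩ := hf.eventually_bound hp
  obtain ⟨r, hr, hball⟩ := Metric.eventually_nhds_iff_ball.1 hB
  set A : ℝ := ‖p.2‖ + 1
  have hK0 : 0 ≤ B + A * B := by positivity
  refine ⟨(B + A * B).toNNReal, Metric.ball p (min r 1),
    Metric.ball_mem_nhds _ (lt_min hr one_pos), ?_⟩
  have hmem : ∀ q ∈ Metric.ball p (min r 1), q.1 ∈ Metric.ball p.1 r ∧ ‖q.2‖ ≤ A := by
    intro q hq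
    have h1 : dist q.1 p.1 ≤ dist q p := le_max_left _ _
    have h2 : dist q.2 p.2 ≤ dist q p := le_max_right _ _
    have h3 : dist q p < min r 1 := hq
    refine ⟨h1.trans_lt (h3.trans_le (min_le_left _ _)), ?_⟩
    have h4 : ‖q.2 - p.2‖ ≤ 1 := by
      rw [← dist_eq_norm]; exact h2.trans (h3.le.trans (min_le_right _ _))
    have := norm_add_le (q.2 - p.2) p.2
    rw [sub_add_cancel] at this
    linarith
  -- it suffices to compare one value with another one
  have key : ∀ q ∈ Metric.ball p (min r 1), ∀ q' ∈ Metric.ball p (min r 1),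
      dualNorm (inChart F φ q.1) q.2 ≤
        dualNorm (inChart F φ q'.1) q'.2 + (B + A * B) * dist q q' := by
    intro q hq q' hq'
    obtain ⟨hq1, hq2⟩ := hmem q hq
    obtain ⟨hq1', hq2'⟩ := hmem q' hq'
    obtain ⟨u, hu⟩ := hf.exists_maximizer (hball _ hq1).1 q.2
    rw [hf.dualNorm_eq (hball _ hq1).1 (hN _ (hball _ hq1).1) hu]
    have h1 := hf.le_dualNorm (hball _ hq1').1 (hN _ (hball _ hq1').1) q'.2 u
    have h2 : ‖f u q.1 - f u q'.1‖ ≤ B * ‖q.1 - q'.1‖ :=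
      (convex_ball p.1 r).norm_image_sub_le_of_norm_fderiv_le
        (fun ζ hζ => hf.differentiableAt u (hball ζ hζ).1) (fun ζ hζ => ((hball ζ hζ).2 u).2)
        hq1' hq1
    have h3 : q.2 (f u q.1) - q'.2 (f u q'.1) =
        (q.2 - q'.2) (f u q.1) + q'.2 (f u q.1 - f u q'.1) := by
      simp
    have h4 : (q.2 - q'.2) (f u q.1) ≤ ‖q.2 - q'.2‖ * B :=
      (le_abs_self _).trans (((q.2 - q'.2).le_opNorm _).trans
        (by gcongr; exact ((hball _ hq1).2 u).1))
    have h5 : q'.2 (f u q.1 - f u q'.1) ≤ A * (B * ‖q.1 - q'.1‖) :=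
      (le_abs_self _).trans ((q'.2.le_opNorm _).trans (by gcongr))
    have h6 : ‖q.1 - q'.1‖ ≤ dist q q' := by rw [← dist_eq_norm]; exact le_max_left _ _
    have h7 : ‖q.2 - q'.2‖ ≤ dist q q' := by rw [← dist_eq_norm]; exact le_max_right _ _
    have h8 : ‖q.2 - q'.2‖ * B ≤ dist q q' * B := by gcongr
    have h9 : A * (B * ‖q.1 - q'.1‖) ≤ A * (B * dist q q') := by gcongr
    linarith
  refine LipschitzOnWith.of_dist_le_mul fun q hq q' hq' => ?_
  rw [Real.coe_toNNReal _ hK0, Real.dist_eq, abs_le]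
  have k1 := key q hq q' hq'
  have k2 := key q' hq' q hq
  rw [dist_comm q' q] at k2
  constructor <;> linarith

/-- A control family is strictly differentiable, uniformly on compact sets. -/
theorem IsControlFamily.uniform_strict (hf : IsControlFamily F φ Ω f) {K : Set (Coord n)}
    (hK : IsCompact K) (hKΩ : K ⊆ Ω) {η : ℝ} (hη : 0 < η) :
    ∃ δ > 0, ∀ ξ ∈ K, Metric.ball ξ δ ⊆ Ω ∧ ∀ u, ∀ ζ ∈ Metric.ball ξ δ, ∀ z ∈ Metric.ball ξ δ,
      ‖f u ζ - f u z - fderiv ℝ (f u) ξ (ζ - z)‖ ≤ η * ‖ζ - z‖ := by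
  obtain ⟨r, hr, hsub⟩ := hK.exists_cthickening_subset_open hf.isOpen hKΩ
  have hKr : IsCompact (Metric.cthickening r K ×ˢ (univ : Set (Metric.sphere (0 : Coord n) 1))) :=
    hK.cthickening.prod isCompact_univ
  have huc := hKr.uniformContinuousOn_of_continuous
    (hf.continuousOn_fderiv.mono (prod_mono hsub le_rfl))
  obtain ⟨δ, hδ, H⟩ := Metric.uniformContinuousOn_iff.1 huc η hη
  refine ⟨min δ r, lt_min hδ hr, fun ξ hξ => ?_⟩
  have hin : Metric.ball ξ (min δ r) ⊆ Metric.cthickening r K := fun ζ hζ =>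
    Metric.mem_cthickening_of_dist_le ζ ξ r K hξ
      ((Metric.mem_ball.1 hζ).le.trans (min_le_right _ _))
  refine ⟨hin.trans hsub, fun u ζ hζ z hz => ?_⟩
  refine (convex_ball ξ (min δ r)).norm_image_sub_le_of_norm_fderiv_le'
    (fun y hy => hf.differentiableAt u (hsub (hin hy))) (fun y hy => ?_) hz hζ
  have hξK : ξ ∈ Metric.cthickening r K := Metric.self_subset_cthickening K hξ
  have := H (y, u) ⟨hin hy, mem_univ u⟩ (ξ, u) ⟨hξK, mem_univ u⟩ (by
    rw [Prod.dist_eq, dist_self, max_eq_left dist_nonneg]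
    exact (Metric.mem_ball.1 hy).trans_le (min_le_left _ _))
  rw [dist_eq_norm] at this
  exact this.le

/-- A Carathéodory type measurability statement: a continuous function of position and control is measurable
along a continuous curve with a measurable control. -/
theorem aestronglyMeasurable_comp_control {G : Type*} [NormedAddCommGroup G]
    [SecondCountableTopology G]
    {h : Coord n × Metric.sphere (0 : Coord n) 1 → G} (hΩ : IsOpen Ω)
    (hh : ContinuousOn h (Ω ×ˢ univ)) {s t : ℝ} {y : ℝ → Coord n}
    {u : ℝ → Metric.sphere (0 : Coord n) 1} (hy : ContinuousOn y (Icc s t))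
    (hyΩ : ∀ σ ∈ Icc s t, y σ ∈ Ω) (hu : Measurable u) :
    AEStronglyMeasurable (fun σ => h (y σ, u σ)) (volume.restrict (Icc s t)) := by
  classical
  borelize G
  have hm : Measurable ((Ω ×ˢ (univ : Set (Metric.sphere (0 : Coord n) 1))).piecewise h fun _ => 0) :=
    hh.measurable_piecewise continuousOn_const (hΩ.prod isOpen_univ).measurableSet
  have hyu : AEMeasurable (fun σ => (y σ, u σ)) (volume.restrict (Icc s t)) :=
    (hy.aestronglyMeasurable_of_isCompact isCompact_Icc measurableSet_Icc).aemeasurable.prodMk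
      hu.aemeasurable
  refine (hm.comp_aemeasurable hyu).aestronglyMeasurable.congr ?_
  rw [EventuallyEq, ae_restrict_iff' measurableSet_Icc]
  refine ae_of_all _ fun σ hσ => ?_
  simp only [Function.comp]
  rw [piecewise_eq_of_mem]
  exact ⟨hyΩ σ hσ, mem_univ _⟩

/-- The field selected by a measurable control is of class `C¹` along a continuous curve. -/
theorem IsControlFamily.isC1Along (hf : IsControlFamily F φ Ω f) {s t C : ℝ} {x : ℝ → Coord n}
    {u : ℝ → Metric.sphere (0 : Coord n) 1} (hx : ContinuousOn x (Icc s t))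
    (hxΩ : ∀ σ ∈ Icc s t, x σ ∈ Ω) (hu : Measurable u)
    (hC : ∀ σ ∈ Icc s t, ∀ v, ‖fderiv ℝ (f v) (x σ)‖ ≤ C) :
    IsC1Along (fun σ => f (u σ)) (fun σ => fderiv ℝ (f (u σ)) (x σ)) x s t C := by
  have hK : IsCompact (x '' Icc s t) := isCompact_Icc.image_of_continuousOn hx
  have hKΩ : x '' Icc s t ⊆ Ω := by rintro _ ⟨σ, hσ, rfl⟩; exact hxΩ σ hσ
  refine { meas := ?_, bound := fun σ hσ => hC σ hσ _, strict := fun η hη => ?_,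
           bound_base := ?_, meas_along := ?_ }
  · exact aestronglyMeasurable_comp_control hf.isOpen hf.continuousOn_fderiv hx hxΩ hu
  · obtain ⟨δ, hδ, H⟩ := hf.uniform_strict hK hKΩ hη
    exact ⟨δ, hδ, fun σ hσ ζ hζ z hz =>
      (H _ (mem_image_of_mem x hσ)).2 (u σ) ζ hζ z hz⟩
  · obtain ⟨B, hB⟩ := (hK.prod isCompact_univ).exists_bound_of_continuousOn
      (hf.continuousOn.mono (prod_mono hKΩ le_rfl))
    exact ⟨B, fun σ hσ => hB (x σ, u σ) ⟨mem_image_of_mem x hσ, mem_univ _⟩⟩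
  · obtain ⟨δ, hδ, H⟩ := hf.uniform_strict hK hKΩ one_pos
    exact ⟨δ, hδ, fun y hy hyx => aestronglyMeasurable_comp_control hf.isOpen hf.continuousOn hy
      (fun σ hσ => (H _ (mem_image_of_mem x hσ)).1 (hyx σ hσ)) hu⟩

/-- The velocity of a curve of speed one is given by a measurable control. The control is unique, so
no selection theorem is needed: by compactness of the sphere, the condition that it lies in a closed set
is a closed condition on the position and the velocity. -/
theorem IsControlFamily.exists_measurable_control [Nonempty (Metric.sphere (0 : Coord n) 1)]
    (hf : IsControlFamily F φ Ω f) {s t : ℝ} (hst : s ≤ t) {x : ℝ → Coord n}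
    (hx : ContinuousOn x (Icc s t)) (hxΩ : ∀ σ ∈ Icc s t, x σ ∈ Ω)
    (hd : ∀ᵐ τ, τ ∈ Icc s t → ∃ v, HasDerivAt x v τ ∧ inChart F φ (x τ) v = 1) :
    ∃ u : ℝ → Metric.sphere (0 : Coord n) 1, Measurable u ∧
      ∀ᵐ τ, τ ∈ Icc s t → HasDerivAt x (f (u τ) (x τ)) τ := by
  classical
  -- the extension `X` of `x` is continuous on the line, so that `deriv X` is measurable
  set X : ℝ → Coord n := IccExtend hst (Set.domRestrict (Icc s t) x) with hX
  have hXc : Continuous X := (continuousOn_iff_continuous_domRestrict.1 hx).Icc_extend'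
  have hXx : ∀ σ ∈ Icc s t, X σ = x σ := fun σ hσ => by
    rw [hX, IccExtend_of_mem hst _ hσ]; rfl
  have hXΩ : ∀ σ, X σ ∈ x '' Icc s t := fun σ =>
    ⟨projIcc s t hst σ, (projIcc s t hst σ).2, rfl⟩
  have hK : IsCompact (x '' Icc s t) := isCompact_Icc.image_of_continuousOn hx
  have hKΩ : x '' Icc s t ⊆ Ω := by rintro _ ⟨σ, hσ, rfl⟩; exact hxΩ σ hσ
  let v₀ : Metric.sphere (0 : Coord n) 1 := Classical.arbitrary _
  let u : ℝ → Metric.sphere (0 : Coord n) 1 := fun τ =>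
    if h : ∃ v, f v (X τ) = deriv X τ then h.choose else v₀
  have hu : ∀ τ v, f v (X τ) = deriv X τ → u τ = v := fun τ v hv => by
    have h : ∃ v, f v (X τ) = deriv X τ := ⟨v, hv⟩
    simp only [u, dif_pos h]
    exact hf.injective (hKΩ (hXΩ τ)) (h.choose_spec.trans hv.symm)
  have hu' : ∀ τ, (¬ ∃ v, f v (X τ) = deriv X τ) → u τ = v₀ := fun τ h => by
    simp only [u, dif_neg h]
  -- the graph of the family over a compact set is compact
  have hgraph : ∀ A : Set (Metric.sphere (0 : Coord n) 1), IsClosed A →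
      MeasurableSet {τ | ∃ v ∈ A, f v (X τ) = deriv X τ} := by
    intro A hA
    have hc : IsCompact ((fun p : Coord n × Metric.sphere (0 : Coord n) 1 => (p.1, f p.2 p.1)) ''
        ((x '' Icc s t) ×ˢ A)) :=
      (hK.prod hA.isCompact).image_of_continuousOn
        (continuousOn_fst.prodMk (hf.continuousOn.mono (prod_mono hKΩ (subset_univ A))))
    have hm : Measurable fun τ => (X τ, deriv X τ) := hXc.measurable.prodMk (measurable_deriv X)
    have hset : {τ | ∃ v ∈ A, f v (X τ) = deriv X τ} = (fun τ => (X τ, deriv X τ)) ⁻¹'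
        ((fun p : Coord n × Metric.sphere (0 : Coord n) 1 => (p.1, f p.2 p.1)) ''
          ((x '' Icc s t) ×ˢ A)) := by
      ext τ
      constructor
      · rintro ⟨v, hv, h⟩
        exact ⟨(X τ, v), ⟨hXΩ τ, hv⟩, Prod.ext rfl h⟩
      · rintro ⟨⟨ξ, v⟩, ⟨_, hv⟩, h⟩
        rw [Prod.ext_iff] at h
        obtain ⟨h1, h2⟩ := h
        simp only at h1 h2
        subst h1
        exact ⟨v, hv, h2⟩
    rw [hset]
    exact hm hc.measurableSet
  refine ⟨u, ?_, ?_⟩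
  · refine measurable_of_isClosed fun A hA => ?_
    have h1 := hgraph A hA
    have h2 := hgraph univ isClosed_univ
    simp only [mem_univ, true_and] at h2
    have hset : u ⁻¹' A = {τ | ∃ v ∈ A, f v (X τ) = deriv X τ} ∪
        ({τ | ∃ v, f v (X τ) = deriv X τ}ᶜ ∩ {_τ | v₀ ∈ A}) := by
      ext τ
      constructor
      · intro hτ
        by_cases h : ∃ v, f v (X τ) = deriv X τ
        · obtain ⟨v, hv⟩ := h
          have := hu τ v hv
          exact Or.inl ⟨v, this ▸ hτ, hv⟩
        · refine Or.inr ⟨h, ?_⟩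
          have := hu' τ h
          rw [mem_preimage, this] at hτ
          exact hτ
      · rintro (⟨v, hv, h⟩ | ⟨h, h0⟩)
        · rw [mem_preimage, hu τ v h]; exact hv
        · rw [mem_preimage, hu' τ h]; exact h0
    rw [hset]
    exact h1.union (h2.compl.inter (MeasurableSet.const _))
  · filter_upwards [hd, ae_mem_Ioo s t] with τ h1 h2 hτ
    obtain ⟨v, hv, hv1⟩ := h1 hτ
    have hev : x =ᶠ[𝓝 τ] X := by
      filter_upwards [Icc_mem_nhds (h2 hτ).1 (h2 hτ).2] with σ hσ using (hXx σ hσ).symm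
    have hXd : HasDerivAt X v τ := hv.congr_of_eventuallyEq hev.symm
    obtain ⟨w, hw⟩ := hf.exists_eq (hxΩ τ hτ) hv1
    have : u τ = w := hu τ w (by rw [hXd.deriv, hXx τ hτ, hw])
    rw [this, hw]
    exact hv

end Families

/-! ### Integral curves: conservation of the dual norm, speed and changes of parameter -/

section Curves

variable {n : ℕ} {M : Type*} [TopologicalSpace M] [ChartedSpace (Coord n) M]
  [IsManifold (𝓡 n) ∞ M] {F : TangentBundle (𝓡 n) M → ℝ}

theorem IsPontryaginType.isAsymmetricNorm (hF : IsPontryaginType F)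
    {φ : OpenPartialHomeomorph M (Coord n)} (hφ : IsCoordSystem φ) {Ω : Set (Coord n)}
    {f : Metric.sphere (0 : Coord n) 1 → Coord n → Coord n} (hf : IsControlFamily F φ Ω f) :
    ∀ ξ ∈ Ω, IsAsymmetricNorm (inChart F φ ξ) := fun _ hξ =>
  isAsymmetricNorm_inChart hF.toIsC0Finsler hφ (hf.subset_target hξ)

/-- A path stays, near each time, in the domain of a control family. -/
theorem IsPontryaginType.exists_family_near (hF : IsPontryaginType F) {x : ℝ → M} {a b : ℝ}
    (hx : ContinuousOn x (Icc a b)) {τ : ℝ} (hτ : τ ∈ Icc a b) :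
    ∃ φ : OpenPartialHomeomorph M (Coord n), IsCoordSystem φ ∧ ∃ Ω f, IsControlFamily F φ Ω f ∧
      φ (x τ) ∈ Ω ∧ ∀ W ∈ 𝓝 (φ (x τ)), ∃ δ > 0, ∀ σ ∈ Icc a b, |σ - τ| < δ →
        x σ ∈ φ.source ∧ φ (x σ) ∈ Ω ∧ φ (x σ) ∈ W := by
  obtain ⟨φ, hφ, hs, Ω, f, hΩ, hf⟩ := hF.exists_family (x τ)
  refine ⟨φ, hφ, Ω, f, hf, hΩ, fun W hW => ?_⟩
  have h1 : φ.source ∈ 𝓝 (x τ) := φ.open_source.mem_nhds hs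
  have h2 := (φ.continuousAt hs).preimage_mem_nhds (inter_mem (hf.isOpen.mem_nhds hΩ) hW)
  have h3 := (hx τ hτ) (inter_mem h1 h2)
  obtain ⟨δ, hδ, H⟩ := Metric.mem_nhdsWithin_iff.1 h3
  refine ⟨δ, hδ, fun σ hσ hd => ?_⟩
  have := H ⟨(by rwa [Metric.mem_ball, Real.dist_eq] : σ ∈ Metric.ball τ δ), hσ⟩
  exact ⟨this.1, this.2.1, this.2.2⟩

theorem mapsTo_of_near {a b τ δ s t : ℝ} (has : a ≤ s) (htb : t ≤ b) (hs : |s - τ| < δ)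
    (ht : |t - τ| < δ) {P : ℝ → Prop} (h : ∀ σ ∈ Icc a b, |σ - τ| < δ → P σ) :
    ∀ σ ∈ Icc s t, P σ := fun σ hσ => by
  refine h σ ⟨has.trans hσ.1, hσ.2.trans htb⟩ ?_
  rw [abs_lt] at hs ht ⊢
  constructor <;> linarith [hσ.1, hσ.2]

theorem hasDerivAt_fst_of {p : ℝ → CotCoord n} {V : CotCoord n} {t : ℝ} (h : HasDerivAt p V t) :
    HasDerivAt (fun s => (p s).1) V.1 t :=
  (hasFDerivAt_fst (p := p t)).comp_hasDerivAt t h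

theorem hasDerivAt_snd_of {p : ℝ → CotCoord n} {V : CotCoord n} {t : ℝ} (h : HasDerivAt p V t) :
    HasDerivAt (fun s => (p s).2) V.2 t :=
  (hasFDerivAt_snd (p := p t)).comp_hasDerivAt t h

theorem neBot_ae_Icc {a b : ℝ} (hab : a < b) : NeBot (ae (volume.restrict (Icc a b))) := by
  refine ae_neBot.2 fun h0 => ?_
  have := congrArg (fun μ : Measure ℝ => μ univ) h0
  simp only [Measure.restrict_apply_univ, Real.volume_Icc, Measure.coe_zero, Pi.zero_apply,
    ENNReal.ofReal_eq_zero] at this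
  linarith

/-- An integral curve on a nontrivial interval has a velocity in the correspondence at some time. -/
theorem IsIntegralCurve.exists_mem {Φ : Correspondence n M} {x : ℝ → M}
    {α : ∀ t, CotangentSpace n (x t)} {a b : ℝ} (hab : a < b) (h : IsIntegralCurve Φ x α a b) :
    ∃ t ∈ Icc a b, ∃ φ, IsCoordSystem φ ∧ x t ∈ φ.source ∧
      ∃ V, V ∈ Φ φ (covectorCoord φ (x t) (α t)) := by
  have ha : a ∈ Icc a b := left_mem_Icc.2 hab.le
  set φ := chartAt (Coord n) (x a)
  have h1 : φ.source ∈ 𝓝 (x a) := φ.open_source.mem_nhds (mem_chart_source _ _)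
  obtain ⟨δ, hδ, H⟩ := Metric.mem_nhdsWithin_iff.1 ((h.1 a ha) h1)
  set d := min b (a + δ / 2)
  have had : a < d := lt_min hab (by linarith)
  have hdb : d ≤ b := min_le_left _ _
  have hm : MapsTo x (Icc a d) φ.source := fun t ht => by
    refine H ⟨?_, ht.1, ht.2.trans hdb⟩
    rw [Metric.mem_ball, Real.dist_eq, abs_lt]
    have := ht.2.trans (min_le_right b (a + δ / 2))
    constructor <;> linarith [ht.1]
  have hae := (h.2 φ (isCoordSystem_chartAt _) a d le_rfl had.le hdb hm).2
  have hne := neBot_ae_Icc had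
  obtain ⟨t, ⟨V, hV, _⟩, ht⟩ := (hae.and (ae_restrict_mem measurableSet_Icc)).exists
  exact ⟨t, ⟨ht.1, ht.2.trans hdb⟩, φ, isCoordSystem_chartAt _, hm ht, V, hV⟩

/-- A correspondence whose values are real multiples of values of the extended geodesic field. -/
def IsMultiple (F : TangentBundle (𝓡 n) M → ℝ) (Φ : Correspondence n M) : Prop :=
  ∀ φ p V, V ∈ Φ φ p → ∃ r : ℝ, ∃ V₀ ∈ extendedField F φ p, V = r • V₀

omit [IsManifold (𝓡 n) ∞ M] in
theorem isMultiple_extendedField : IsMultiple F (extendedField F) :=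
  fun _ _ V hV => ⟨1, V, hV, (one_smul ℝ V).symm⟩

omit [IsManifold (𝓡 n) ∞ M] in
theorem isMultiple_scaledField : IsMultiple F (scaledField F) := by
  rintro φ p _ ⟨V, hV, rfl⟩
  exact ⟨_, V, hV, rfl⟩

/-- The maximized Hamiltonian is constant along a curve whose velocities are multiples of the
Hamiltonian fields of maximizing controls.  The function `h(s) = max_v α(s)(f_v(x(s)))` is
absolutely continuous; it is touched from below at almost every time `t` by
`s ↦ α(s)(f_u(x(s)))`, where `u` is the control at time `t`, and the derivative of this function
vanishes at `t` by the Hamiltonian equations. -/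
theorem dualNorm_const (hF : IsPontryaginType F) {φ : OpenPartialHomeomorph M (Coord n)}
    (hφ : IsCoordSystem φ) {Ω : Set (Coord n)}
    {f : Metric.sphere (0 : Coord n) 1 → Coord n → Coord n} (hf : IsControlFamily F φ Ω f)
    [Nonempty (Metric.sphere (0 : Coord n) 1)] {p : ℝ → CotCoord n} {s t : ℝ} (hst : s ≤ t)
    (hac : AbsolutelyContinuousOnInterval p s t) (hpΩ : ∀ σ ∈ Icc s t, (p σ).1 ∈ Ω)
    (hder : ∀ᵐ σ, σ ∈ Icc s t → ∃ Ω' f' u, IsControlFamily F φ Ω' f' ∧ (p σ).1 ∈ Ω' ∧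
      (∀ v, (p σ).2 (f' v (p σ).1) ≤ (p σ).2 (f' u (p σ).1)) ∧
      ∃ r : ℝ, HasDerivAt p (r • hamiltonianField (f' u) (p σ)) σ) :
    ∀ σ ∈ Icc s t, dualNorm (inChart F φ (p σ).1) (p σ).2 =
      dualNorm (inChart F φ (p s).1) (p s).2 := by
  have hN := hF.isAsymmetricNorm hφ hf
  set g : CotCoord n → ℝ := fun q => dualNorm (inChart F φ q.1) q.2
  have hloc : LocallyLipschitzOn (p '' uIcc s t) g := by
    rintro _ ⟨σ, hσ, rfl⟩
    rw [uIcc_of_le hst] at hσ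
    obtain ⟨K, U, hU, hK⟩ := hf.dualNorm_lipschitz hN (hpΩ σ hσ)
    exact ⟨K, U, mem_nhdsWithin_of_mem_nhds hU, hK⟩
  obtain ⟨K, hK⟩ := hloc.exists_lipschitzOnWith_of_compact
    (isCompact_uIcc.image_of_continuousOn hac.continuousOn)
  have hgac : AbsolutelyContinuousOnInterval (fun σ => g (p σ)) s t :=
    ac_comp_lipschitz hac hK (mapsTo_image _ _)
  obtain ⟨c, hc⟩ := hgac.const_of_ae_hasDerivAt_zero (by
    filter_upwards [hgac.ae_differentiableAt, hder] with σ k1 k2 hσ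
    have hdiff := (k1 hσ).hasDerivAt
    rw [uIcc_of_le hst] at hσ
    obtain ⟨Ω', f', u, hf', hpΩ', hu, r, hVd⟩ := k2 hσ
    have hN' := hF.isAsymmetricNorm hφ hf'
    have hk : HasDerivAt (fun y => (p y).2 (f' u (p y).1)) 0 σ := by
      have e1 := hasDerivAt_fst_of hVd
      have e2 := hasDerivAt_snd_of hVd
      have e3 := (hf'.differentiableAt u hpΩ').hasFDerivAt.comp_hasDerivAt σ e1
      refine (e2.clm_apply e3).congr_deriv ?_
      simp [hamiltonianField]
    have hmin : IsLocalMin (fun y => g (p y) - (p y).2 (f' u (p y).1)) σ := by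
      have hcont : ContinuousAt (fun y => (p y).1) σ := (hasDerivAt_fst_of hVd).continuousAt
      filter_upwards [hcont.preimage_mem_nhds (hf'.isOpen.mem_nhds hpΩ')] with y hy
      have e1 : g (p σ) = (p σ).2 (f' u (p σ).1) := hf'.dualNorm_eq hpΩ' (hN' _ hpΩ') hu
      rw [e1, sub_self, sub_nonneg]
      exact hf'.le_dualNorm hy (hN' _ hy) _ u
    have := hmin.hasDerivAt_eq_zero (hdiff.sub hk)
    rw [sub_zero] at this
    rwa [this] at hdiff)
  rw [uIcc_of_le hst] at hc
  intro σ hσ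
  exact (hc σ hσ).trans (hc s (left_mem_Icc.2 hst)).symm

/-- The dual norm `F_*` is constant along the integral curves of `𝓔` and of its multiples. -/
theorem dualF_const (hF : IsPontryaginType F) {Φ : Correspondence n M} (hΦ : IsMultiple F Φ)
    {x : ℝ → M} {α : ∀ t, CotangentSpace n (x t)} {a b : ℝ} (hab : a < b)
    (h : IsIntegralCurve Φ x α a b) : ∀ t ∈ Icc a b, dualF F (x t) (α t) = dualF F (x a) (α a) := by
  have hne : Nonempty (Metric.sphere (0 : Coord n) 1) := by
    obtain ⟨t, _, φ, _, _, V, hV⟩ := h.exists_mem hab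
    obtain ⟨r, V₀, ⟨_, _, _, _, _, u, _⟩, _⟩ := hΦ _ _ _ hV
    exact ⟨u⟩
  refine interval_induction hab.le
    (P := fun s t => ∀ τ ∈ Icc s t, dualF F (x τ) (α τ) = dualF F (x s) (α s)) ?_ ?_
  · intro τ₀ hτ₀
    obtain ⟨φ, hφ, Ω, f, hf, hΩ, H⟩ := hF.exists_family_near h.1 hτ₀
    obtain ⟨δ, hδ, Hδ⟩ := H univ univ_mem
    refine ⟨δ, hδ, fun s t has hst htb hs ht => ?_⟩
    have hin := mapsTo_of_near has htb hs ht Hδ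
    have hsrc : MapsTo x (Icc s t) φ.source := fun σ hσ => (hin σ hσ).1
    obtain ⟨hac, hder⟩ := h.2 φ hφ s t has hst htb hsrc
    rw [ae_restrict_iff' measurableSet_Icc] at hder
    have key := dualNorm_const hF hφ hf hst hac (fun σ hσ => (hin σ hσ).2.1) (by
      filter_upwards [hder] with σ k2 hσ
      obtain ⟨V, hV, hVd⟩ := k2 hσ
      obtain ⟨r, V₀, ⟨hp0, Ω', f', hf', hpΩ', u, hu, rfl⟩, rfl⟩ := hΦ _ _ _ hV
      exact ⟨Ω', f', u, hf', hpΩ', hu, r, hVd⟩)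
    intro σ hσ
    rw [dualF_eq F hφ (hsrc hσ), dualF_eq F hφ (hsrc (left_mem_Icc.2 hst))]
    exact key σ hσ
  · intro r s t _ hrs hst _ h1 h2 τ hτ
    rcases le_total τ s with hle | hle
    · exact h1 τ ⟨hτ.1, hle⟩
    · rw [h2 τ ⟨hle, hτ.2⟩, h1 s (right_mem_Icc.2 hrs)]

/-- The constant is positive because the values of `𝓔` are attached to nonzero covectors only. -/
theorem dualF_pos_const (hF : IsPontryaginType F) {Φ : Correspondence n M} (hΦ : IsMultiple F Φ)
    {x : ℝ → M} {α : ∀ t, CotangentSpace n (x t)} {a b : ℝ} (hab : a < b)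
    (h : IsIntegralCurve Φ x α a b) :
    ∃ m : ℝ, 0 < m ∧ ∀ t ∈ Icc a b, dualF F (x t) (α t) = m := by
  have hc := dualF_const hF hΦ hab h
  refine ⟨dualF F (x a) (α a), ?_, hc⟩
  obtain ⟨t, ht, φ, hφ, hx, V, hV⟩ := h.exists_mem hab
  obtain ⟨r, V₀, ⟨hp0, Ω, f, hf, hpΩ, u, hu, _⟩, _⟩ := hΦ _ _ _ hV
  have : Nonempty (Metric.sphere (0 : Coord n) 1) := ⟨u⟩
  rw [← hc t ht, dualF_eq F hφ hx]
  exact hf.dualNorm_pos hpΩ (hF.isAsymmetricNorm hφ hf _ hpΩ) hp0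

/-- Along a curve whose velocities are `c` times unit vectors, the speed is `c`. -/
theorem hasSpeed_of_integralCurve (hF : IsPontryaginType F) {Φ : Correspondence n M} {x : ℝ → M}
    {α : ∀ t, CotangentSpace n (x t)} {a b c : ℝ} (hab : a ≤ b) (hc : 0 < c)
    (h : IsIntegralCurve Φ x α a b)
    (hΦ : ∀ t ∈ Icc a b, ∀ φ, IsCoordSystem φ → x t ∈ φ.source →
      ∀ V ∈ Φ φ (covectorCoord φ (x t) (α t)),
        ∃ V₀ ∈ extendedField F φ (covectorCoord φ (x t) (α t)), V = c • V₀) :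
    HasSpeed F x a b c := by
  refine interval_induction hab (P := fun s t => HasSpeed F x s t c) ?_ ?_
  · intro τ₀ hτ₀
    obtain ⟨φ, hφ, Ω, f, hf, hΩ, H⟩ := hF.exists_family_near h.1 hτ₀
    obtain ⟨δ, hδ, Hδ⟩ := H univ univ_mem
    refine ⟨δ, hδ, fun s t has hst htb hs ht => ?_⟩
    have hin := mapsTo_of_near has htb hs ht Hδ
    have hsrc : MapsTo x (Icc s t) φ.source := fun σ hσ => (hin σ hσ).1
    obtain ⟨hac, hder⟩ := h.2 φ hφ s t has hst htb hsrc
    rw [HasSpeed, ae_restrict_iff' measurableSet_Icc]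
    rw [ae_restrict_iff' measurableSet_Icc] at hder
    filter_upwards [hder, ae_mem_Ioo s t] with σ k2 k3 hσ
    obtain ⟨V, hV, hVd⟩ := k2 hσ
    have hσab : σ ∈ Icc a b := ⟨has.trans hσ.1, hσ.2.trans htb⟩
    obtain ⟨V₀, ⟨hp0, Ω', f', hf', hpΩ', u, hu, rfl⟩, rfl⟩ := hΦ σ hσab φ hφ (hsrc hσ) V hV
    have hcont : ContinuousAt x σ := h.1.continuousAt (Icc_mem_nhds
      (lt_of_le_of_lt has (k3 hσ).1) (lt_of_lt_of_le (k3 hσ).2 htb))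
    rw [velocity_eq F hφ (hsrc hσ) hcont (hasDerivAt_fst_of hVd)]
    have h1 : inChart F φ (φ (x σ)) (c • f' u (φ (x σ))) =
        c * inChart F φ (φ (x σ)) (f' u (φ (x σ))) :=
      (hF.isAsymmetricNorm hφ hf' _ hpΩ').smul_pos c (f' u (φ (x σ))) hc
    have h2 : inChart F φ (φ (x σ)) (f' u (φ (x σ))) = 1 := hf'.unit hpΩ' u
    rw [h2, mul_one] at h1
    exact h1
  · intro r s t _ hrs hst _ h1 h2
    rw [HasSpeed, ← Icc_union_Icc_eq_Icc hrs hst, ae_restrict_union_iff]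
    exact ⟨h1, h2⟩

theorem ae_comp_mul {r s t : ℝ} (hr : 0 < r) {P : ℝ → Prop}
    (h : ∀ᵐ τ, τ ∈ Icc (r * s) (r * t) → P τ) : ∀ᵐ τ, τ ∈ Icc s t → P (r * τ) := by
  have h1 : ∀ᵐ τ ∂(Measure.map (fun τ => r * τ) volume), τ ∈ Icc (r * s) (r * t) → P τ := by
    rw [Real.map_volume_mul_left hr.ne']
    exact Measure.ae_smul_measure h _
  filter_upwards [ae_of_ae_map (by fun_prop) h1] with τ h2 hτ
  exact h2 ⟨by gcongr; exact hτ.1, by gcongr; exact hτ.2⟩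

theorem ac_comp_mul {X : Type*} [NormedAddCommGroup X] {p : ℝ → X} {r s t : ℝ} (hr : 0 < r)
    (hst : s ≤ t) (hp : AbsolutelyContinuousOnInterval p (r * s) (r * t)) :
    AbsolutelyContinuousOnInterval (fun τ => p (r * τ)) s t := by
  refine ac_comp_monotone (K := r.toNNReal) hp (fun x y h => by gcongr) ?_ fun τ hτ => ?_
  · refine LipschitzWith.of_dist_le_mul fun x y => ?_
    rw [Real.coe_toNNReal _ hr.le, Real.dist_eq, Real.dist_eq, ← mul_sub, abs_mul,
      abs_of_pos hr]
  · rw [uIcc_of_le hst] at hτ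
    rw [uIcc_of_le (by gcongr)]
    exact ⟨by gcongr; exact hτ.1, by gcongr; exact hτ.2⟩

omit [IsManifold (𝓡 n) ∞ M] in
theorem continuousOn_comp_mul {x : ℝ → M} {r a b a' b' : ℝ} (hr : 0 < r) (ha : r * a' = a)
    (hb : r * b' = b) (h : ContinuousOn x (Icc a b)) :
    ContinuousOn (fun t => x (r * t)) (Icc a' b') :=
  h.comp (by fun_prop) fun t ht => by
    rw [← ha, ← hb]
    exact ⟨by gcongr; exact ht.1, by gcongr; exact ht.2⟩

omit [IsManifold (𝓡 n) ∞ M] in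
theorem mapsTo_comp_mul {x : ℝ → M} {r s t : ℝ} (hr : 0 < r) {U : Set M}
    (h : MapsTo (fun τ => x (r * τ)) (Icc s t) U) : MapsTo x (Icc (r * s) (r * t)) U := by
  intro σ hσ
  have : σ = r * (σ / r) := by field_simp
  rw [this]
  exact h ⟨by rw [le_div_iff₀ hr, mul_comm]; exact hσ.1, by
    rw [div_le_iff₀ hr, mul_comm]; exact hσ.2⟩

omit [IsManifold (𝓡 n) ∞ M] in
/-- Linear change of parameter in integral curves. -/
theorem isIntegralCurve_comp_mul {Φ Ψ : Correspondence n M} {x : ℝ → M}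
    {α : ∀ t, CotangentSpace n (x t)} {a b r a' b' : ℝ} (hr : 0 < r) (ha : r * a' = a)
    (hb : r * b' = b) (h : IsIntegralCurve Φ x α a b)
    (hΦ : ∀ t ∈ Icc a b, ∀ φ, IsCoordSystem φ → x t ∈ φ.source →
      ∀ V ∈ Φ φ (covectorCoord φ (x t) (α t)), r • V ∈ Ψ φ (covectorCoord φ (x t) (α t))) :
    IsIntegralCurve Ψ (fun t => x (r * t)) (fun t => α (r * t)) a' b' := by
  refine ⟨continuousOn_comp_mul hr ha hb h.1, fun φ hφ s t has hst htb hm => ?_⟩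
  have has' : a ≤ r * s := by rw [← ha]; gcongr
  have htb' : r * t ≤ b := by rw [← hb]; gcongr
  have hm' := mapsTo_comp_mul hr hm
  obtain ⟨h1, h2⟩ := h.2 φ hφ (r * s) (r * t) has' (by gcongr) htb' hm'
  refine ⟨ac_comp_mul (p := fun σ => covectorCoord φ (x σ) (α σ)) hr hst h1, ?_⟩
  rw [ae_restrict_iff' measurableSet_Icc] at h2 ⊢
  filter_upwards [ae_comp_mul hr h2] with τ k hτ
  obtain ⟨V, hV, hd⟩ := k hτ
  have hτ' : r * τ ∈ Icc a b :=
    ⟨has'.trans (by gcongr; exact hτ.1), le_trans (by gcongr; exact hτ.2) htb'⟩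
  refine ⟨r • V, hΦ _ hτ' φ hφ (hm hτ) V hV, ?_⟩
  have hlin : HasDerivAt (fun τ : ℝ => r * τ) r τ := by
    simpa using (hasDerivAt_id τ).const_mul r
  exact HasDerivAt.scomp (g₁ := fun σ => covectorCoord φ (x σ) (α σ)) τ hd hlin

theorem isACPath_comp_mul {x : ℝ → M} {a b r a' b' : ℝ} (hr : 0 < r) (ha : r * a' = a)
    (hb : r * b' = b) (h : IsACPath n x a b) : IsACPath n (fun t => x (r * t)) a' b' := by
  refine ⟨continuousOn_comp_mul hr ha hb h.1, fun φ hφ s t has hst htb hm => ?_⟩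
  exact ac_comp_mul (p := fun τ => φ (x τ)) hr hst (h.2 φ hφ (r * s) (r * t)
    (by rw [← ha]; gcongr) (by gcongr) (by rw [← hb]; gcongr) (mapsTo_comp_mul hr hm))

/-- Multiplication of the covector of an integral curve by a positive constant. -/
theorem isIntegralCurve_smul {x : ℝ → M} {α : ∀ t, CotangentSpace n (x t)} {a b c : ℝ}
    (hc : 0 < c) (h : IsIntegralCurve (extendedField F) x α a b) :
    IsIntegralCurve (extendedField F) x (fun t => c • α t) a b := by
  refine ⟨h.1, fun φ hφ s t has hst htb hm => ?_⟩
  obtain ⟨h1, h2⟩ := h.2 φ hφ s t has hst htb hm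
  let L : CotCoord n →L[ℝ] CotCoord n :=
    (ContinuousLinearMap.fst ℝ _ _).prod (c • ContinuousLinearMap.snd ℝ _ _)
  have hL : ∀ τ, covectorCoord φ (x τ) (c • α τ) = L (covectorCoord φ (x τ) (α τ)) := fun τ => rfl
  simp only [hL]
  refine ⟨ac_comp_lipschitz h1 L.lipschitz.lipschitzOnWith (mapsTo_univ _ _), ?_⟩
  filter_upwards [h2] with τ hτ
  obtain ⟨V, ⟨hp0, Ω, f, hf, hpΩ, u, hu, rfl⟩, hd⟩ := hτ
  refine ⟨_, ⟨smul_ne_zero hc.ne' hp0, Ω, f, hf, hpΩ, u, fun v => ?_, ?_⟩,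
    L.hasFDerivAt.comp_hasDerivAt τ hd⟩
  · exact mul_le_mul_of_nonneg_left (hu v) hc.le
  · refine Prod.ext rfl ?_
    ext1 w
    simp [L, hamiltonianField]

theorem hasSpeed_comp_mul (hF : IsC0Finsler F) {x : ℝ → M} {a b c r a' b' : ℝ} (hr : 0 < r)
    (ha : r * a' = a) (hb : r * b' = b) (hc : 0 < c) (hx : ContinuousOn x (Icc a b))
    (h : HasSpeed F x a b c) : HasSpeed F (fun t => x (r * t)) a' b' (r * c) := by
  rw [HasSpeed, ae_restrict_iff' measurableSet_Icc] at h ⊢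
  have h0 : ∀ᵐ t, t ∈ Icc (r * a') (r * b') → (t ∈ Ioo a b ∧ F (velocity n x t) = c) := by
    filter_upwards [h, ae_mem_Ioo a b] with t h1 h2 ht
    rw [ha, hb] at ht
    exact ⟨h2 ht, h1 ht⟩
  filter_upwards [ae_comp_mul hr h0] with t h1 ht
  obtain ⟨hmem, hsp⟩ := h1 ht
  have hcont : ContinuousAt x (r * t) := hx.continuousAt (Icc_mem_nhds hmem.1 hmem.2)
  have hφ := isCoordSystem_chartAt (n := n) (x (r * t))
  have hsrc := mem_chart_source (Coord n) (x (r * t))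
  have hd := (differentiableAt_of_velocity hF hφ hsrc (by rw [hsp]; exact hc.ne')).hasDerivAt
  rw [velocity_eq F hφ hsrc hcont hd] at hsp
  have hlin : HasDerivAt (fun τ : ℝ => r * τ) r t := by
    simpa using (hasDerivAt_id t).const_mul r
  have hd' : HasDerivAt (fun τ => chartAt (Coord n) (x (r * t)) (x (r * τ))) _ t :=
    HasDerivAt.scomp (g₁ := fun σ => chartAt (Coord n) (x (r * t)) (x σ)) t hd hlin
  have hcont' : ContinuousAt (fun τ => x (r * τ)) t :=
    ContinuousAt.comp (f := fun τ => r * τ) (g := x) hcont (by fun_prop)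
  rw [velocity_eq F hφ (x := fun τ => x (r * τ)) hsrc hcont' hd',
    (isAsymmetricNorm_inChart hF hφ (OpenPartialHomeomorph.map_source _ hsrc)).smul_pos _ _ hr, hsp]

omit [IsManifold (𝓡 n) ∞ M] in
theorem pathLength_of_hasSpeed {x : ℝ → M} {a b c : ℝ} (hc : 0 ≤ c) (h : HasSpeed F x a b c) :
    pathLength F x a b = ENNReal.ofReal (c * (b - a)) := by
  rw [pathLength, lintegral_congr_ae (g := fun _ => ENNReal.ofReal c)
    (h.mono fun t ht => by rw [ht])]
  simp [ENNReal.ofReal_mul hc]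

theorem isMinimizing_comp_mul (hF : IsC0Finsler F) {x : ℝ → M} {a b c r a' b' : ℝ} (hr : 0 < r)
    (ha : r * a' = a) (hb : r * b' = b) (hc : 0 < c) (h : HasSpeed F x a b c)
    (hx : IsMinimizing F x a b) : IsMinimizing F (fun t => x (r * t)) a' b' := by
  refine ⟨isACPath_comp_mul hr ha hb hx.1, fun y s t hst hy hys hyt => ?_⟩
  change y s = x (r * a') at hys
  change y t = x (r * b') at hyt
  rw [ha] at hys
  rw [hb] at hyt
  have := hx.2 y s t hst hy hys hyt
  rw [pathLength_of_hasSpeed hc.le h] at this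
  rw [pathLength_of_hasSpeed (by positivity) (hasSpeed_comp_mul hF hr ha hb hc hx.1.1 h)]
  convert! this using 2
  rw [← ha, ← hb]
  ring

end Curves

/-! ### Variations of a path by convex combinations of controls -/

section C1Along

variable {E : Type*} [NormedAddCommGroup E] [NormedSpace ℝ E] {s t : ℝ} {x : ℝ → E}

theorem isC1Along_zero (s t : ℝ) (x : ℝ → E) :
    IsC1Along (fun _ _ => (0 : E)) (fun _ => 0) x s t 0 where
  meas := aestronglyMeasurable_const
  bound := by simp
  strict := fun η hη => ⟨1, one_pos, fun σ _ ξ _ ζ _ => by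
    simpa using mul_nonneg hη.le (norm_nonneg (ξ - ζ))⟩
  bound_base := ⟨0, by simp⟩
  meas_along := ⟨1, one_pos, fun _ _ _ => aestronglyMeasurable_const⟩

theorem IsC1Along.sub {g h : ℝ → E → E} {g' h' : ℝ → E →L[ℝ] E} {C D : ℝ}
    (hg : IsC1Along g g' x s t C) (hh : IsC1Along h h' x s t D) :
    IsC1Along (fun σ ξ => g σ ξ - h σ ξ) (fun σ => g' σ - h' σ) x s t (C + D) where
  meas := hg.meas.sub hh.meas
  bound := fun σ hσ => (norm_sub_le _ _).trans (add_le_add (hg.bound σ hσ) (hh.bound σ hσ))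
  strict := fun η hη => by
    obtain ⟨δ₁, h₁, k₁⟩ := hg.strict (η / 2) (by positivity)
    obtain ⟨δ₂, h₂, k₂⟩ := hh.strict (η / 2) (by positivity)
    refine ⟨min δ₁ δ₂, lt_min h₁ h₂, fun σ hσ ξ hξ ζ hζ => ?_⟩
    have e₁ := k₁ σ hσ ξ (Metric.ball_subset_ball (min_le_left _ _) hξ) ζ
      (Metric.ball_subset_ball (min_le_left _ _) hζ)
    have e₂ := k₂ σ hσ ξ (Metric.ball_subset_ball (min_le_right _ _) hξ) ζ
      (Metric.ball_subset_ball (min_le_right _ _) hζ)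
    calc ‖g σ ξ - h σ ξ - (g σ ζ - h σ ζ) - (g' σ - h' σ) (ξ - ζ)‖
        = ‖(g σ ξ - g σ ζ - g' σ (ξ - ζ)) - (h σ ξ - h σ ζ - h' σ (ξ - ζ))‖ := by
          rw [sub_apply]; congr 1; abel
      _ ≤ η / 2 * ‖ξ - ζ‖ + η / 2 * ‖ξ - ζ‖ := (norm_sub_le _ _).trans (add_le_add e₁ e₂)
      _ = η * ‖ξ - ζ‖ := by ring
  bound_base := by
    obtain ⟨B₁, h₁⟩ := hg.bound_base
    obtain ⟨B₂, h₂⟩ := hh.bound_base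
    exact ⟨B₁ + B₂, fun σ hσ => (norm_sub_le _ _).trans (add_le_add (h₁ σ hσ) (h₂ σ hσ))⟩
  meas_along := by
    obtain ⟨δ₁, h₁, k₁⟩ := hg.meas_along
    obtain ⟨δ₂, h₂, k₂⟩ := hh.meas_along
    refine ⟨min δ₁ δ₂, lt_min h₁ h₂, fun y hy hb => ?_⟩
    exact (k₁ y hy fun σ hσ => Metric.ball_subset_ball (min_le_left _ _) (hb σ hσ)).sub
      (k₂ y hy fun σ hσ => Metric.ball_subset_ball (min_le_right _ _) (hb σ hσ))

theorem norm_indicator_smul_le (B : Set ℝ) (σ : ℝ) (z : E) :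
    ‖B.indicator (fun _ => (1 : ℝ)) σ • z‖ ≤ ‖z‖ := by
  rcases indicator_eq_zero_or_self B (fun _ => (1 : ℝ)) σ with h | h <;> rw [h] <;> simp

theorem IsC1Along.indicator {g : ℝ → E → E} {g' : ℝ → E →L[ℝ] E} {C : ℝ}
    (hg : IsC1Along g g' x s t C) {B : Set ℝ} (hB : MeasurableSet B) :
    IsC1Along (fun σ ξ => B.indicator (fun _ => (1 : ℝ)) σ • g σ ξ)
      (fun σ => B.indicator (fun _ => (1 : ℝ)) σ • g' σ) x s t C := by
  have hm : AEStronglyMeasurable (B.indicator fun _ => (1 : ℝ)) (volume.restrict (Icc s t)) :=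
    (measurable_const.indicator hB).aestronglyMeasurable
  refine { meas := hm.smul hg.meas, bound := fun σ hσ => ?_, strict := fun η hη => ?_,
           bound_base := ?_, meas_along := ?_ }
  · exact (norm_indicator_smul_le _ _ _).trans (hg.bound σ hσ)
  · obtain ⟨δ, hδ, k⟩ := hg.strict η hη
    refine ⟨δ, hδ, fun σ hσ ξ hξ ζ hζ => ?_⟩
    rw [smul_apply, ← smul_sub, ← smul_sub]
    exact (norm_indicator_smul_le _ _ _).trans (k σ hσ ξ hξ ζ hζ)
  · obtain ⟨b, hb⟩ := hg.bound_base
    exact ⟨b, fun σ hσ => (norm_indicator_smul_le _ _ _).trans (hb σ hσ)⟩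
  · obtain ⟨δ, hδ, k⟩ := hg.meas_along
    exact ⟨δ, hδ, fun y hy hb => hm.smul (k y hy hb)⟩

end C1Along

section Piece

variable {n : ℕ} {M : Type*} [TopologicalSpace M] [ChartedSpace (Coord n) M]

/-- A piece `[s, t]` of a path `x`, contained in the domain of a control family `f`, driven by a
measurable control `u`, and so short that the linearized equation can be solved by a Neumann
series. -/
structure Piece (F : TangentBundle (𝓡 n) M → ℝ) (x : ℝ → M) (s t : ℝ) where
  chart : OpenPartialHomeomorph M (Coord n)
  isCoordSystem : IsCoordSystem chart
  dom : Set (Coord n)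
  field : Metric.sphere (0 : Coord n) 1 → Coord n → Coord n
  isControlFamily : IsControlFamily F chart dom field
  source : ∀ σ ∈ Icc s t, x σ ∈ chart.source
  mem_dom : ∀ σ ∈ Icc s t, chart (x σ) ∈ dom
  const : ℝ
  norm_fderiv_le : ∀ σ ∈ Icc s t, ∀ v, ‖fderiv ℝ (field v) (chart (x σ))‖ ≤ const
  short : const * (t - s) < 1
  control : ℝ → Metric.sphere (0 : Coord n) 1
  measurable_control : Measurable control
  continuousOn : ContinuousOn (fun σ => chart (x σ)) (Icc s t)
  eq_integral : ∀ τ ∈ Icc s t,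
    chart (x τ) = chart (x s) + ∫ σ in s..τ, field (control σ) (chart (x σ))

/-- A variation of a control: `none` replaces the velocity by `0`, at all times, and `some (B, v)`
replaces the control by `v` at the times in `B i` of the `i`-th piece. -/
abbrev Variation (n : ℕ) : Type :=
  Option ((ℕ → {B : Set ℝ // MeasurableSet B}) × Metric.sphere (0 : Coord n) 1)

/-- The times of the `i`-th piece at which a variation acts. -/
def Variation.times (j : Variation n) (i : ℕ) : Set ℝ := j.elim univ fun p => (p.1 i).1

/-- The vector field by which a variation replaces the velocity. -/
def Variation.target (f : Metric.sphere (0 : Coord n) 1 → Coord n → Coord n) (j : Variation n) :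
    Coord n → Coord n := j.elim (fun _ => 0) fun p => f p.2

/-- The rate at which a variation decreases length. -/
def Variation.gain (j : Variation n) : ℝ := j.elim 1 fun _ => 0

theorem Variation.measurableSet_times (j : Variation n) (i : ℕ) : MeasurableSet (j.times i) := by
  cases j with
  | none => exact MeasurableSet.univ
  | some p => exact (p.1 i).2

namespace Piece

variable {F : TangentBundle (𝓡 n) M → ℝ} {x : ℝ → M} {s t : ℝ} (P : Piece F x s t)

/-- The path in coordinates. -/
def path (σ : ℝ) : Coord n := P.chart (x σ)

/-- The linearization of the control equation along the path. -/
def lin (σ : ℝ) : Coord n →L[ℝ] Coord n := fderiv ℝ (P.field (P.control σ)) (P.path σ)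

/-- The field which a variation adds to the control equation. -/
def variationField (i : ℕ) (j : Variation n) (σ : ℝ) (ξ : Coord n) : Coord n :=
  (j.times i).indicator (fun _ => (1 : ℝ)) σ • (j.target P.field ξ - P.field (P.control σ) ξ)

theorem isC1Along : IsC1Along (fun σ => P.field (P.control σ)) P.lin P.path s t P.const :=
  P.isControlFamily.isC1Along P.continuousOn P.mem_dom P.measurable_control P.norm_fderiv_le

theorem isC1Along_variationField (i : ℕ) (j : Variation n) :
    ∃ k' K, IsC1Along (P.variationField i j) k' P.path s t K := by
  cases j with
  | none => exact ⟨_, _, ((isC1Along_zero s t P.path).sub P.isC1Along).indicator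
      (Variation.measurableSet_times none i)⟩
  | some p => exact ⟨_, _, ((P.isControlFamily.isC1Along (u := fun _ => p.2) P.continuousOn
      P.mem_dom measurable_const P.norm_fderiv_le).sub P.isC1Along).indicator
      (Variation.measurableSet_times (some p) i)⟩

/-- By convexity, a small positive combination of variations produces velocities of length at most
`1`, and less if `none` takes part. -/
theorem inChart_variation_le {ι : Type*} [Fintype ι] (i : ℕ) (v : ι → Variation n) {ξ : Coord n}
    (hξ : ξ ∈ P.dom) (hN : IsAsymmetricNorm (inChart F P.chart ξ)) {ε : ι → ℝ}
    (hε : ∀ j, 0 ≤ ε j) (hε1 : ∑ j, ε j ≤ 1) (σ : ℝ) :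
    inChart F P.chart ξ (P.field (P.control σ) ξ + ∑ j, ε j • P.variationField i (v j) σ ξ) ≤
      1 - ∑ j, ε j * (v j).gain := by
  set N := inChart F P.chart ξ
  set χ : ι → ℝ := fun j => ((v j).times i).indicator (fun _ => (1 : ℝ)) σ
  have hχ0 : ∀ j, 0 ≤ χ j := fun j => indicator_nonneg (fun _ _ => zero_le_one) _
  have hχ1 : ∀ j, χ j ≤ 1 := fun j => indicator_le_self' (fun _ _ => zero_le_one) _
  have hsmul : ∀ (c : ℝ) (y : Coord n), 0 ≤ c → N (c • y) = c * N y := by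
    intro c y hc
    rcases hc.eq_or_lt with rfl | hc
    · rw [zero_smul, zero_mul]; exact (hN.eq_zero_iff 0).2 rfl
    · exact hN.smul_pos c y hc
  have hsum : ∀ (S : Finset ι) (y : ι → Coord n), N (∑ j ∈ S, y j) ≤ ∑ j ∈ S, N (y j) := by
    classical
    intro S y
    induction S using Finset.induction_on with
    | empty => simp [(hN.eq_zero_iff 0).2 rfl]
    | insert a S ha ih =>
      rw [Finset.sum_insert ha, Finset.sum_insert ha]
      exact (hN.add_le _ _).trans (by gcongr)
  have hle : ∑ j, ε j * χ j ≤ 1 := le_trans (Finset.sum_le_sum fun j _ =>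
    mul_le_of_le_one_right (hε j) (hχ1 j)) hε1
  have hu : N (P.field (P.control σ) ξ) = 1 := P.isControlFamily.unit hξ _
  have hdec : P.field (P.control σ) ξ + ∑ j, ε j • P.variationField i (v j) σ ξ =
      (1 - ∑ j, ε j * χ j) • P.field (P.control σ) ξ +
        ∑ j, (ε j * χ j) • (v j).target P.field ξ := by
    have : ∀ j, ε j • P.variationField i (v j) σ ξ =
        (ε j * χ j) • (v j).target P.field ξ - (ε j * χ j) • P.field (P.control σ) ξ := fun j => by
      rw [variationField, smul_smul, smul_sub]
    simp only [this, Finset.sum_sub_distrib, sub_smul, one_smul, ← Finset.sum_smul]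
    abel
  have htar : ∀ j, χ j * N ((v j).target P.field ξ) = χ j - (v j).gain := by
    intro j
    rcases h : v j with _ | p
    · simp only [Variation.target, Variation.gain, Option.elim_none, χ, h, Variation.times,
        indicator_univ]
      rw [(hN.eq_zero_iff 0).2 rfl]; simp
    · have : N (P.field p.2 ξ) = 1 := P.isControlFamily.unit hξ _
      simp only [Variation.target, Variation.gain, Option.elim_some, this]
      ring
  rw [hdec]
  refine (hN.add_le _ _).trans ?_
  calc N ((1 - ∑ j, ε j * χ j) • P.field (P.control σ) ξ) +
        N (∑ j, (ε j * χ j) • (v j).target P.field ξ)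
      ≤ (1 - ∑ j, ε j * χ j) + ∑ j, ε j * (χ j - (v j).gain) := by
        refine add_le_add ?_ ((hsum _ _).trans (Finset.sum_le_sum fun j _ => ?_))
        · rw [hsmul _ _ (by linarith), hu, mul_one]
        · rw [hsmul _ _ (mul_nonneg (hε j) (hχ0 j)), mul_assoc, htar]
    _ = 1 - ∑ j, ε j * (v j).gain := by
        simp only [mul_sub, Finset.sum_sub_distrib]; ring

/-- The variation of a piece: solutions of the perturbed control equation, with initial point `ξ`,
the strict derivative of the final point, and its duality with the adjoint equation. -/
theorem exists_variation [IsManifold (𝓡 n) ∞ M] (hF : IsPontryaginType F) (hst : s ≤ t) (i : ℕ)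
    {ι : Type*} [Fintype ι] (v : ι → Variation n) :
    ∃ (Y : (ι → ℝ) × Coord n → ℝ → Coord n) (T : (ι → ℝ) × Coord n →L[ℝ] Coord n),
      HasStrictFDerivAt (fun q => Y q t) T (0, P.path s) ∧
      Y (0, P.path s) t = P.path t ∧
      (∀ᶠ q in 𝓝 (0, P.path s), (∀ τ ∈ Icc s t, Y q τ ∈ P.dom) ∧ Y q s = q.2 ∧
        AbsolutelyContinuousOnInterval (Y q) s t ∧
        ((∀ j, 0 ≤ q.1 j) → ∀ᵐ σ, σ ∈ Icc s t → ∃ w, HasDerivAt (Y q) w σ ∧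
          inChart F P.chart (Y q σ) w ≤ 1 - ∑ j, q.1 j * (v j).gain)) ∧
      ∀ a : ℝ → Coord n →L[ℝ] ℝ, ContinuousOn a (Icc s t) →
        (∀ τ ∈ Icc s t, a τ = a t + ∫ σ in t..τ, -(a σ ∘L P.lin σ)) → ∀ q,
          a t (T q) = a s q.2 +
            ∫ σ in s..t, a σ (∑ j, q.1 j • P.variationField i (v j) σ (P.path σ)) := by
  choose k' K hk using fun j => P.isC1Along_variationField i (v j)
  obtain ⟨Y, D, T, h1, h2, h3, h4, h5, h6, h7⟩ :=
    exists_flow hst P.continuousOn P.isC1Along P.short P.eq_integral hk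
  refine ⟨Y, T, h1, h3 t (right_mem_Icc.2 hst), ?_, ?_⟩
  · have hK : IsCompact (P.path '' Icc s t) := isCompact_Icc.image_of_continuousOn P.continuousOn
    have hKΩ : P.path '' Icc s t ⊆ P.dom := by rintro _ ⟨σ, hσ, rfl⟩; exact P.mem_dom σ hσ
    obtain ⟨δ, hδ, hsub⟩ := hK.exists_thickening_subset_open P.isControlFamily.isOpen hKΩ
    have hsum : ∀ᶠ q : (ι → ℝ) × Coord n in 𝓝 (0, P.path s), ∑ j, q.1 j < 1 := by
      have hc : Continuous fun q : (ι → ℝ) × Coord n => ∑ j, q.1 j := by fun_prop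
      exact hc.continuousAt.eventually_lt continuousAt_const (by simp)
    filter_upwards [h5 δ hδ, h6, hsum] with q k5 ⟨B, hB, hint, heq⟩ hq
    have hdom : ∀ τ ∈ Icc s t, Y q τ ∈ P.dom := fun τ hτ =>
      hsub (Metric.mem_thickening_iff.2 ⟨P.path τ, mem_image_of_mem _ hτ, k5 τ hτ⟩)
    have hs := left_mem_Icc.2 hst
    refine ⟨hdom, by simpa using heq s hs, ac_of_eq_integral hs hint hB heq, fun hpos => ?_⟩
    filter_upwards [ae_hasDerivAt_of_eq_integral hs hint heq] with σ hσd hσ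
    exact ⟨_, hσd hσ, P.inChart_variation_le i v (hdom σ hσ)
      (hF.isAsymmetricNorm P.isCoordSystem P.isControlFamily _ (hdom σ hσ)) hpos hq.le σ⟩
  · intro a ha haeq q
    obtain ⟨k1, k2, k3⟩ := h7 q
    have hbase : ∀ j, ∃ B, ∀ σ ∈ Icc s t, ‖P.variationField i (v j) σ (P.path σ)‖ ≤ B :=
      fun j => (hk j).bound_base
    choose B hB using hbase
    have hw : ∀ j, IntegrableOn (fun σ => P.variationField i (v j) σ (P.path σ)) (Icc s t) := by
      intro j
      obtain ⟨δ, hδ, h⟩ := (hk j).exists_integrableOn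
      obtain ⟨_, _, h'⟩ := h P.path P.continuousOn fun σ _ => Metric.mem_ball_self hδ
      exact h'
    rw [h2]
    refine adjoint_duality hst P.isC1Along.toIsBoundedField ha haeq (B := ∑ j, ‖q.1 j‖ * B j) k1
      (integrable_finsetSum _ fun j _ => (hw j).smul (q.1 j)) (fun σ hσ => ?_) k3
    refine (norm_sum_le _ _).trans (Finset.sum_le_sum fun j _ => ?_)
    rw [norm_smul]
    exact mul_le_mul_of_nonneg_left (hB j σ hσ) (norm_nonneg _)

end Piece

end Piece

/-! ### Variations of a minimizing path -/

section Paths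

variable {n : ℕ} {M : Type*} [TopologicalSpace M] [ChartedSpace (Coord n) M]
  {F : TangentBundle (𝓡 n) M → ℝ}

theorem velocity_congr {x y : ℝ → M} {t : ℝ} (h : x =ᶠ[𝓝 t] y) :
    velocity n x t = velocity n y t := by
  have h1 : x t = y t := h.eq_of_nhds
  have h2 : (mfderiv 𝓘(ℝ, ℝ) (𝓡 n) x t (1 : ℝ) : Coord n) =
      mfderiv 𝓘(ℝ, ℝ) (𝓡 n) y t (1 : ℝ) := by rw [h.mfderiv_eq]; rfl
  have key : ∀ (p q : M) (v w : Coord n), p = q → v = w →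
      (⟨p, v⟩ : TangentBundle (𝓡 n) M) = ⟨q, w⟩ := by rintro p _ v _ rfl rfl; rfl
  exact key _ _ _ _ h1 h2

theorem isACPath_congr {x y : ℝ → M} {a b : ℝ} (hx : IsACPath n x a b) (h : EqOn x y (Icc a b)) :
    IsACPath n y a b := by
  refine ⟨hx.1.congr h.symm, fun φ hφ c d hac hcd hdb hm => ?_⟩
  have hsub : Icc c d ⊆ Icc a b := Icc_subset_Icc hac hdb
  refine ac_congr (hx.2 φ hφ c d hac hcd hdb fun τ hτ => ?_) fun τ hτ => ?_
  · rw [h (hsub hτ)]; exact hm hτ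
  · rw [uIcc_of_le hcd] at hτ
    exact congrArg φ (h (hsub hτ))

theorem pathLength_congr {x y : ℝ → M} {a b : ℝ} (h : EqOn x y (Icc a b)) :
    pathLength F x a b = pathLength F y a b := by
  refine lintegral_congr_ae ?_
  rw [EventuallyEq, ae_restrict_iff' measurableSet_Icc]
  filter_upwards [ae_mem_Ioo a b] with t ht h'
  rw [velocity_congr (h.eventuallyEq_of_mem (Icc_mem_nhds (ht h').1 (ht h').2))]

theorem pathLength_le_add {x : ℝ → M} {a b c : ℝ} :
    pathLength F x a b ≤ pathLength F x a c + pathLength F x c b := by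
  refine (lintegral_mono_set' (LE.le.eventuallyLE ?_)).trans
    (lintegral_union_le _ (Icc a c) (Icc c b))
  intro t ht
  rcases le_total t c with h | h
  · exact Or.inl ⟨ht.1, h⟩
  · exact Or.inr ⟨h, ht.2⟩

theorem pathLength_le {x : ℝ → M} {a b m : ℝ} (hm : 0 ≤ m)
    (h : ∀ᵐ t, t ∈ Icc a b → F (velocity n x t) ≤ m) :
    pathLength F x a b ≤ ENNReal.ofReal (m * (b - a)) := by
  have h1 : pathLength F x a b ≤ ∫⁻ _ in Icc a b, ENNReal.ofReal m := by
    refine lintegral_mono_ae ?_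
    rw [ae_restrict_iff' measurableSet_Icc]
    filter_upwards [h] with t ht h'
    exact ENNReal.ofReal_le_ofReal (ht h')
  refine h1.trans_eq ?_
  simp [ENNReal.ofReal_mul hm]

end Paths

section Variation

variable {n : ℕ} {M : Type*} [TopologicalSpace M] [ChartedSpace (Coord n) M]
  [IsManifold (𝓡 n) ∞ M] {F : TangentBundle (𝓡 n) M → ℝ}

/-- A path parameterized by arclength is divided into pieces. -/
theorem exists_pieces [Nonempty (Metric.sphere (0 : Coord n) 1)] (hF : IsPontryaginType F)
    {x : ℝ → M} {a b : ℝ} (hab : a ≤ b) (hx : IsACPath n x a b) (hsp : HasSpeed F x a b 1) :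
    ∃ (t : ℕ → ℝ) (N : ℕ), Monotone t ∧ t 0 = a ∧ t N = b ∧ (∀ i, t i ∈ Icc a b) ∧
      ∀ i, Nonempty (Piece F x (t i) (t (i + 1))) := by
  refine exists_partition hab (P := fun s t => Nonempty (Piece F x s t)) fun τ hτ => ?_
  obtain ⟨φ, hφ, Ω, f, hf, hΩ, H⟩ := hF.exists_family_near hx.1 hτ
  obtain ⟨B, hB0, hB⟩ := hf.eventually_bound hΩ
  obtain ⟨δ, hδ, Hδ⟩ := H _ hB
  refine ⟨min δ (1 / (4 * (B + 1))), lt_min hδ (by positivity), fun s t has hst htb hs ht => ?_⟩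
  have hin := mapsTo_of_near has htb (hs.trans_le (min_le_left _ _))
    (ht.trans_le (min_le_left _ _)) Hδ
  have hshort : B * (t - s) < 1 := by
    have h1 := hs.trans_le (min_le_right δ (1 / (4 * (B + 1))))
    have h2 := ht.trans_le (min_le_right δ (1 / (4 * (B + 1))))
    rw [abs_lt] at h1 h2
    have h3 : t - s ≤ 2 * (1 / (4 * (B + 1))) := by linarith
    calc B * (t - s) ≤ (B + 1) * (2 * (1 / (4 * (B + 1)))) := by
          refine mul_le_mul (by linarith) h3 (by linarith) (by linarith)
      _ = 1 / 2 := by field_simp; norm_num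
      _ < 1 := by norm_num
  have hac := hx.2 φ hφ s t has hst htb fun σ hσ => (hin σ hσ).1
  have hc : ContinuousOn (fun σ => φ (x σ)) (Icc s t) := by
    have := hac.continuousOn
    rwa [uIcc_of_le hst] at this
  rw [HasSpeed, ae_restrict_iff' measurableSet_Icc] at hsp
  obtain ⟨u, hu, hud⟩ := hf.exists_measurable_control hst hc (fun σ hσ => (hin σ hσ).2.1) (by
    filter_upwards [hsp, ae_mem_Ioo s t] with σ k1 k3 hσ
    have h1 := k1 ⟨has.trans hσ.1, hσ.2.trans htb⟩
    have hd := (differentiableAt_of_velocity hF.toIsC0Finsler hφ (hin σ hσ).1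
      (by rw [h1]; exact one_ne_zero)).hasDerivAt
    refine ⟨_, hd, ?_⟩
    rw [← velocity_eq F hφ (hin σ hσ).1 (hx.1.continuousAt (Icc_mem_nhds
      (lt_of_le_of_lt has (k3 hσ).1) (lt_of_lt_of_le (k3 hσ).2 htb))) hd]
    exact h1)
  have hfb : ∀ σ ∈ Icc s t, ‖f (u σ) (φ (x σ))‖ ≤ B := fun σ hσ => ((hin σ hσ).2.2.2 _).1
  have hint := integrableOn_of_bound (aestronglyMeasurable_comp_control hf.isOpen hf.continuousOn
    hc (fun σ hσ => (hin σ hσ).2.1) hu) hfb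
  exact ⟨{ chart := φ, isCoordSystem := hφ, dom := Ω, field := f, isControlFamily := hf
           source := fun σ hσ => (hin σ hσ).1
           mem_dom := fun σ hσ => (hin σ hσ).2.1
           const := B
           norm_fderiv_le := fun σ hσ v => ((hin σ hσ).2.2.2 v).2
           short := hshort
           control := u
           measurable_control := hu
           continuousOn := hc
           eq_integral := eq_integral_of_ac hst hac hint hfb hud }⟩

/-- The coordinates of a covector along a piece. -/
def Piece.covector {x : ℝ → M} {s t : ℝ} (P : Piece F x s t) (α : ∀ t, CotangentSpace n (x t))
    (σ : ℝ) : Coord n →L[ℝ] ℝ := (covectorCoord P.chart (x σ) (α σ)).2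

/-- The covector `α` solves the adjoint equation along a piece. -/
def Piece.IsAdjoint {x : ℝ → M} {s t : ℝ} (P : Piece F x s t) (α : ∀ t, CotangentSpace n (x t)) :
    Prop :=
  ContinuousOn (P.covector α) (Icc s t) ∧
    ∀ τ ∈ Icc s t, P.covector α τ =
      P.covector α t + ∫ σ in t..τ, -(P.covector α σ ∘L P.lin σ)

variable {x : ℝ → M} {a b : ℝ} {t : ℕ → ℝ} (P : ∀ i, Piece F x (t i) (t (i + 1)))

/-- The components of a covector at a point of the overlap of two coordinate systems. -/
theorem covectorCoord_snd_transition {φ ψ : OpenPartialHomeomorph M (Coord n)}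
    (hφ : IsCoordSystem φ) (hψ : IsCoordSystem ψ) {p : M} (hpφ : p ∈ φ.source)
    (hpψ : p ∈ ψ.source) (α : CotangentSpace n p) (w : Coord n) :
    (covectorCoord ψ p α).2 (fderiv ℝ (transition φ ψ) (φ p) w) = (covectorCoord φ p α).2 w := by
  rw [covectorCoord_snd hψ hpψ, covectorCoord_snd hφ hpφ, ← transition_apply ψ hpφ]
  exact congrArg α (mfderiv_symm_transition hφ hψ (mem_overlap hpφ hpψ) w)

/-- The first variation of the endpoint of a path driven by controls, with respect to finitely many
variations: the perturbed paths, the bound on their lengths, and the pairing of the derivative of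
the endpoint with the solutions of the adjoint equation. The point at time `t i`, where the `i`-th piece
starts, is read in the coordinates of that piece. -/
theorem exists_path_variation (hF : IsPontryaginType F) (hmono : Monotone t)
    {ι : Type*} [Fintype ι] (v : ι → Variation n) (i : ℕ) :
    ∃ (Y : (ι → ℝ) → ℝ → M) (L : (ι → ℝ) →L[ℝ] Coord n),
      Y 0 (t i) = x (t i) ∧ (∀ᶠ ε in 𝓝 0, Y ε (t i) ∈ (P i).chart.source) ∧
      HasStrictFDerivAt (fun ε => (P i).chart (Y ε (t i))) L 0 ∧
      (∀ᶠ ε in 𝓝 0, (∀ j, 0 ≤ ε j) → IsACPath n (Y ε) (t 0) (t i) ∧ Y ε (t 0) = x (t 0) ∧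
        pathLength F (Y ε) (t 0) (t i) ≤
          ENNReal.ofReal ((1 - ∑ j, ε j * (v j).gain) * (t i - t 0))) ∧
      ∀ α : ∀ τ, CotangentSpace n (x τ), (∀ k < i, (P k).IsAdjoint α) → ∀ ε,
        (P i).covector α (t i) (L ε) = ∑ k ∈ Finset.range i, ∫ σ in t k..t (k + 1),
          (P k).covector α σ (∑ j, ε j • (P k).variationField k (v j) σ ((P k).path σ)) := by
  induction i with
  | zero =>
    have h0 := (P 0).source (t 0) (left_mem_Icc.2 (hmono (Nat.zero_le 1)))
    refine ⟨fun _ => x, 0, rfl, Eventually.of_forall fun _ => h0, hasStrictFDerivAt_const _ _,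
      Eventually.of_forall fun ε _ => ⟨⟨?_, fun φ hφ c d hc hcd hd hm => ?_⟩, rfl, ?_⟩, by simp⟩
    · rw [Icc_self]; exact continuousOn_singleton _ _
    · obtain rfl : c = d := le_antisymm hcd (hd.trans hc)
      exact ac_self _ _
    · simp [pathLength]
  | succ i ih =>
    obtain ⟨Y, L, h1, h2, h3, h4, h5⟩ := ih
    have h0i : t 0 ≤ t i := hmono (Nat.zero_le i)
    have hst : t i ≤ t (i + 1) := hmono (Nat.le_succ i)
    have hst' : t (i + 1) ≤ t (i + 2) := hmono (Nat.le_succ (i + 1))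
    obtain ⟨Z, T, k1, k2, k3, k4⟩ := (P i).exists_variation hF hst i v
    set φ := (P i).chart with hφdef
    set ψ := (P (i + 1)).chart with hψdef
    have hφ : IsCoordSystem φ := (P i).isCoordSystem
    have hψ : IsCoordSystem ψ := (P (i + 1)).isCoordSystem
    have hxφ : x (t (i + 1)) ∈ φ.source := (P i).source _ (right_mem_Icc.2 hst)
    have hxψ : x (t (i + 1)) ∈ ψ.source := (P (i + 1)).source _ (left_mem_Icc.2 hst')
    set q : (ι → ℝ) → (ι → ℝ) × Coord n := fun ε => (ε, φ (Y ε (t i))) with hq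
    have hq0 : q 0 = (0, (P i).path (t i)) := by rw [hq]; simp only [h1]; rfl
    have hqd : HasStrictFDerivAt q ((ContinuousLinearMap.id ℝ (ι → ℝ)).prod L) 0 :=
      (hasStrictFDerivAt_id _).prodMk h3
    have hqc : Tendsto q (𝓝 0) (𝓝 (0, (P i).path (t i))) := by
      rw [← hq0]; exact hqd.continuousAt
    have hev := hqc.eventually k3
    set Z' : (ι → ℝ) → ℝ → M := fun ε τ => if τ ≤ t i then Y ε τ else φ.symm (Z (q ε) τ) with hZ'
    have hZle : ∀ ε, EqOn (Y ε) (Z' ε) (Icc (t 0) (t i)) := fun ε τ hτ => (if_pos hτ.2).symm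
    -- the two definitions agree at the time `t i`
    have hZge : ∀ᶠ ε in 𝓝 0, EqOn (fun τ => φ.symm (Z (q ε) τ)) (Z' ε) (Icc (t i) (t (i + 1))) := by
      filter_upwards [hev, h2] with ε e1 e2 τ hτ
      rcases hτ.1.eq_or_lt with rfl | h
      · have : Z' ε (t i) = Y ε (t i) := if_pos le_rfl
        change φ.symm (Z (q ε) (t i)) = _
        rw [this, e1.2.1]
        exact φ.left_inv e2
      · exact (if_neg (not_le.2 h)).symm
    have hZφ : ∀ᶠ ε in 𝓝 0, ∀ τ ∈ Icc (t i) (t (i + 1)), Z' ε τ ∈ φ.source ∧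
        φ (Z' ε τ) = Z (q ε) τ := by
      filter_upwards [hev, hZge] with ε e1 e2 τ hτ
      have htar := (P i).isControlFamily.subset_target (e1.1 τ hτ)
      rw [← e2 hτ]
      exact ⟨φ.map_target htar, φ.right_inv htar⟩
    have hr := right_mem_Icc.2 hst
    have hZ0 : Z' 0 (t (i + 1)) = x (t (i + 1)) := by
      obtain ⟨e1, e2⟩ := hZφ.self_of_nhds _ hr
      refine φ.injOn e1 hxφ ?_
      rw [e2, hq0, k2]; rfl
    have hZd : HasStrictFDerivAt (fun ε => φ (Z' ε (t (i + 1))))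
        (T ∘L (ContinuousLinearMap.id ℝ (ι → ℝ)).prod L) 0 := by
      have : HasStrictFDerivAt (fun q => Z q (t (i + 1))) T (q 0) := by rw [hq0]; exact k1
      refine (this.comp 0 hqd).congr_of_eventuallyEq ?_
      filter_upwards [hZφ] with ε e1
      exact ((e1 _ hr).2).symm
    have hψmem : ∀ᶠ ε in 𝓝 0, φ (Z' ε (t (i + 1))) ∈ overlap φ ψ := by
      refine hZd.continuousAt.eventually ((isOpen_overlap φ ψ).mem_nhds ?_)
      change φ (Z' 0 (t (i + 1))) ∈ overlap φ ψ
      rw [hZ0]; exact mem_overlap hxφ hxψ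
    have htr : HasStrictFDerivAt (transition φ ψ) (fderiv ℝ (transition φ ψ) (φ (x (t (i + 1)))))
        (φ (Z' 0 (t (i + 1)))) := by
      rw [hZ0]
      exact (contDiffAt_transition hφ hψ (mem_overlap hxφ hxψ)).hasStrictFDerivAt (by simp)
    refine ⟨Z', _, hZ0, ?_, (htr.comp 0 hZd).congr_of_eventuallyEq ?_, ?_, fun α hα ε => ?_⟩
    · filter_upwards [hψmem, hZφ] with ε e1 e2
      have h' : φ.symm (φ (Z' ε (t (i + 1)))) ∈ ψ.source := e1.2
      rwa [φ.left_inv (e2 _ hr).1] at h'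
    · filter_upwards [hZφ] with ε e2
      exact transition_apply ψ (e2 _ hr).1
    · have hsum : ∀ᶠ ε : ι → ℝ in 𝓝 0, ∑ j, ε j * (v j).gain < 1 := by
        have hc : Continuous fun ε : ι → ℝ => ∑ j, ε j * (v j).gain := by fun_prop
        exact hc.continuousAt.eventually_lt continuousAt_const (by simp)
      filter_upwards [h4, hev, hZφ, hsum] with ε e1 e2 e3 e4 hε
      obtain ⟨l1, l2, l3⟩ := e1 hε
      have hac : AbsolutelyContinuousOnInterval (fun τ => φ (Z' ε τ)) (t i) (t (i + 1)) := by
        refine ac_congr e2.2.2.1 fun τ hτ => ?_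
        rw [uIcc_of_le hst] at hτ
        exact (e3 τ hτ).2.symm
      have hpath := isACPath_of_chart hφ hst (fun τ hτ => (e3 τ hτ).1) hac
      refine ⟨isACPath_glue h0i hst (isACPath_congr l1 (hZle ε)) hpath, ?_, ?_⟩
      · rw [← hZle ε (left_mem_Icc.2 h0i), l2]
      · have hlen : pathLength F (Z' ε) (t i) (t (i + 1)) ≤
            ENNReal.ofReal ((1 - ∑ j, ε j * (v j).gain) * (t (i + 1) - t i)) := by
          refine pathLength_le (by linarith) ?_
          filter_upwards [e2.2.2.2 hε, ae_mem_Ioo (t i) (t (i + 1))] with σ m1 m2 hσ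
          obtain ⟨w, hw, hle⟩ := m1 hσ
          have hnhds := Icc_mem_nhds (m2 hσ).1 (m2 hσ).2
          have hw' : HasDerivAt (fun τ => φ (Z' ε τ)) w σ := by
            refine hw.congr_of_eventuallyEq ?_
            filter_upwards [hnhds] with τ hτ using (e3 τ hτ).2
          rw [velocity_eq F hφ (e3 σ hσ).1 (hpath.1.continuousAt hnhds) hw', (e3 σ hσ).2]
          exact hle
        refine (pathLength_le_add (c := t i)).trans ((add_le_add
          ((pathLength_congr (hZle ε)).symm.trans_le l3) hlen).trans_eq ?_)
        rw [← ENNReal.ofReal_add (mul_nonneg (by linarith) (by linarith))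
          (mul_nonneg (by linarith) (by linarith))]
        congr 1; ring
    · have had := hα i (Nat.lt_succ_self i)
      have e1 := k4 ((P i).covector α) had.1 had.2 (ε, L ε)
      rw [Finset.sum_range_succ, ← h5 α (fun k hk => hα k (hk.trans (Nat.lt_succ_self i))) ε, ← e1]
      exact covectorCoord_snd_transition hφ hψ hxφ hxψ _ _

end Variation

/-! ### The maximum principle -/

section MaximumPrinciple

variable {n : ℕ} {M : Type*} [TopologicalSpace M] [ChartedSpace (Coord n) M]
  [IsManifold (𝓡 n) ∞ M] {F : TangentBundle (𝓡 n) M → ℝ}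

theorem covectorCoord_snd_eq_zero_iff {φ : OpenPartialHomeomorph M (Coord n)}
    (hφ : IsCoordSystem φ) {p : M} (hp : p ∈ φ.source) (α : CotangentSpace n p) :
    (covectorCoord φ p α).2 = 0 ↔ ∀ y : TangentSpace (𝓡 n) p, α y = 0 := by
  have hb := mfderiv_symm_bijective hφ (φ.map_source hp)
  constructor
  · intro h y
    obtain ⟨η, hη⟩ := hb.2 (show TangentSpace (𝓡 n) (φ.symm (φ p)) from (y : Coord n))
    have h1 := covectorCoord_snd hφ hp α η
    rw [h] at h1
    refine Eq.trans (congrArg α ?_) h1.symm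
    exact hη.symm
  · intro h
    ext1 η
    rw [covectorCoord_snd hφ hp]
    exact h _

variable {x : ℝ → M} {a b : ℝ} {t : ℕ → ℝ} (P : ∀ i, Piece F x (t i) (t (i + 1)))

/-- The adjoint equation has a solution with any final value. -/
theorem exists_adjoint (hmono : Monotone t) (i : ℕ) (p : Coord n →L[ℝ] ℝ) :
    ∃ α : ∀ τ, CotangentSpace n (x τ), (P i).covector α (t i) = p ∧
      ∀ k < i, (P k).IsAdjoint α := by
  induction i generalizing p with
  | zero =>
    have h0 := (P 0).source (t 0) (left_mem_Icc.2 (hmono (Nat.zero_le 1)))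
    refine ⟨fun τ => ofCoord (P 0).chart (x τ) p, ?_, by simp⟩
    exact congrArg Prod.snd (covectorCoord_ofCoord (P 0).isCoordSystem h0 p)
  | succ i ih =>
    have hst : t i ≤ t (i + 1) := hmono (Nat.le_succ i)
    have hst' : t (i + 1) ≤ t (i + 2) := hmono (Nat.le_succ (i + 1))
    set φ := (P i).chart with hφdef
    set ψ := (P (i + 1)).chart with hψdef
    have hφ : IsCoordSystem φ := (P i).isCoordSystem
    have hψ : IsCoordSystem ψ := (P (i + 1)).isCoordSystem
    have hxφ : x (t (i + 1)) ∈ φ.source := (P i).source _ (right_mem_Icc.2 hst)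
    have hxψ : x (t (i + 1)) ∈ ψ.source := (P (i + 1)).source _ (left_mem_Icc.2 hst')
    obtain ⟨β, hβc, hβt, hβ⟩ := exists_adjoint_solution hst (P i).isC1Along.toIsBoundedField
      (P i).short (covectorCoord φ (x (t (i + 1))) (ofCoord ψ (x (t (i + 1))) p)).2
    obtain ⟨α, hα0, hα⟩ := ih (β (t i))
    set α' : ∀ τ, CotangentSpace n (x τ) := fun τ =>
      if τ ≤ t i then α τ else ofCoord φ (x τ) (β τ) with hα'
    have hle : ∀ τ ≤ t i, α' τ = α τ := fun τ h => if_pos h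
    have hcov : ∀ τ ∈ Icc (t i) (t (i + 1)), (P i).covector α' τ = β τ := by
      intro τ hτ
      rcases hτ.1.eq_or_lt with rfl | h
      · rw [Piece.covector, hle _ le_rfl]; exact hα0
      · have : α' τ = ofCoord φ (x τ) (β τ) := if_neg (not_le.2 h)
        rw [Piece.covector, this]
        exact congrArg Prod.snd (covectorCoord_ofCoord hφ ((P i).source τ hτ) _)
    refine ⟨α', ?_, fun k hk => ?_⟩
    · have h1 : covectorCoord φ (x (t (i + 1))) (α' (t (i + 1))) =
          covectorCoord φ (x (t (i + 1))) (ofCoord ψ (x (t (i + 1))) p) := by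
        refine Prod.ext rfl ?_
        exact (hcov _ (right_mem_Icc.2 hst)).trans hβt
      have h2 := congrArg (cotTransition φ ψ) h1
      rw [cotTransition_covectorCoord hφ hψ hxφ hxψ, cotTransition_covectorCoord hφ hψ hxφ hxψ,
        covectorCoord_ofCoord hψ hxψ] at h2
      exact congrArg Prod.snd h2
    · have key : ∀ k, (t k ≤ t (k + 1)) → ∀ γ : ℝ → Coord n →L[ℝ] ℝ,
          (∀ τ ∈ Icc (t k) (t (k + 1)), (P k).covector α' τ = γ τ) →
          ContinuousOn γ (Icc (t k) (t (k + 1))) →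
          (∀ τ ∈ Icc (t k) (t (k + 1)), γ τ = γ (t (k + 1)) +
            ∫ σ in t (k + 1)..τ, -(γ σ ∘L (P k).lin σ)) → (P k).IsAdjoint α' := by
        intro k hk γ hγ hc he
        refine ⟨hc.congr hγ, fun τ hτ => ?_⟩
        rw [hγ τ hτ, hγ _ (right_mem_Icc.2 hk), he τ hτ]
        congr 1
        refine intervalIntegral.integral_congr fun σ hσ => ?_
        rw [uIcc_of_ge hτ.2] at hσ
        simp only [hγ σ ⟨hτ.1.trans hσ.1, hσ.2⟩]
      rcases Nat.lt_succ_iff_lt_or_eq.1 hk with hk | rfl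
      · have hki : t (k + 1) ≤ t i := hmono hk
        refine key k (hmono (Nat.le_succ k)) ((P k).covector α) (fun τ hτ => ?_) (hα k hk).1
          (hα k hk).2
        rw [Piece.covector, hle τ (hτ.2.trans hki)]; rfl
      · exact key k hst β hcov hβc hβ

/-- If no finite family of variations can be combined into a shorter path with the same endpoints,
then some solution of the adjoint equation pairs nonpositively with all variations. -/
theorem exists_adjoint_nonpos (hF : IsPontryaginType F) (hmono : Monotone t) {N : ℕ}
    (h0N : t 0 < t N) (hmin : IsMinimizing F x (t 0) (t N)) (hsp : HasSpeed F x (t 0) (t N) 1) :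
    ∃ α : ∀ τ, CotangentSpace n (x τ), (P N).covector α (t N) ≠ 0 ∧
      (∀ k < N, (P k).IsAdjoint α) ∧ ∀ j : Variation n,
        ∑ k ∈ Finset.range N, ∫ σ in t k..t (k + 1),
          (P k).covector α σ ((P k).variationField k j σ ((P k).path σ)) ≤ 0 := by
  choose α hα0 hα using fun p => exists_adjoint P hmono N p
  set m : (Coord n →L[ℝ] ℝ) → Variation n → ℝ := fun p j =>
    ∑ k ∈ Finset.range N, ∫ σ in t k..t (k + 1),
      (P k).covector (α p) σ ((P k).variationField k j σ ((P k).path σ)) with hm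
  -- the derivative of the endpoint in the direction of one variation
  have hy : ∀ j : Variation n, ∃ y : Coord n, ∀ p : Coord n →L[ℝ] ℝ, p y = m p j := by
    intro j
    obtain ⟨_, L, _, _, _, _, h⟩ := exists_path_variation P hF hmono (ι := Unit) (fun _ => j) N
    refine ⟨L fun _ => 1, fun p => ?_⟩
    have := h (α p) (hα p) fun _ => 1
    rw [hα0] at this
    simpa using this
  choose y hy using hy
  rcases exists_functional_or_positive_combination y none with ⟨p, hp, hle⟩ | ⟨S, hS, ⟨c, hc, hc0⟩, hd⟩
  · exact ⟨α p, by rwa [hα0], hα p, fun j => (hy j p).symm.trans_le (hle j)⟩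
  -- otherwise a positive combination of variations is a shorter path with the same endpoints
  · classical
    exfalso
    obtain ⟨Y, L, h1, h2, h3, h4, h5⟩ :=
      exists_path_variation P hF hmono (ι := S) (fun j => (j : Variation n)) N
    have hext : ∀ z w : Coord n, (∀ p : Coord n →L[ℝ] ℝ, p z = p w) → z = w := fun z w h =>
      (SeparatingDual.eq_iff_forall_dual_eq (R := ℝ)).2 h
    have hLsingle : ∀ j : S, L (Pi.single j 1) = y j := by
      intro j
      refine hext _ _ fun p => ?_
      have := h5 (α p) (hα p) (Pi.single j 1)
      rw [hα0] at this
      rw [hy, this]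
      refine Finset.sum_congr rfl fun k _ => ?_
      congr 1
      ext σ
      congr 1
      rw [Finset.sum_eq_single j (fun i _ hi => by simp [hi]) (by simp)]
      simp
    have hL : ∀ ε : S → ℝ, L ε = ∑ j, ε j • y j := by
      intro ε
      have : ε = ∑ j, ε j • (Pi.single j 1 : S → ℝ) := by
        ext i
        rw [Finset.sum_apply, Finset.sum_eq_single i (fun j _ hj => by simp [hj.symm]) (by simp)]
        simp
      conv_lhs => rw [this]
      simp only [map_sum, map_smul, hLsingle]
    have hev := h2.and h4
    obtain ⟨ε, ⟨e1, e2⟩, hpos, he⟩ := exists_positive_solution h3 (c := fun j : S => c j) (by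
        rw [LinearMap.range_eq_top]
        intro w
        obtain ⟨d, hd⟩ := hd w
        refine ⟨fun j => d j, ?_⟩
        rw [← hd, ← Finset.sum_coe_sort S]
        exact hL _) (fun j => hc j) (by
        rw [hL, ← hc0, ← Finset.sum_coe_sort S]) hev
    obtain ⟨k1, k2, k3⟩ := e2 fun j => (hpos j).le
    have hend : Y ε (t N) = x (t N) := by
      refine (P N).chart.injOn e1 ((P N).source _ (left_mem_Icc.2 (hmono (Nat.le_succ N)))) ?_
      rw [he, h1]
    have hlen := (hmin.2 (Y ε) _ _ h0N.le k1 k2 hend).trans k3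
    rw [pathLength_of_hasSpeed zero_le_one hsp, ENNReal.ofReal_le_ofReal_iff'] at hlen
    have hgain : 0 < ∑ j : S, ε j * Variation.gain (j : Variation n) := by
      refine Finset.sum_pos' (fun j _ => mul_nonneg (hpos j).le ?_)
        ⟨⟨none, hS⟩, Finset.mem_univ _, ?_⟩
      · rcases (j : Variation n) with _ | q
        · exact zero_le_one
        · exact le_rfl
      · simpa [Variation.gain] using hpos ⟨none, hS⟩
    rcases hlen with h | h <;> nlinarith [mul_pos hgain (sub_pos.2 h0N)]

/-- The maximum condition: an adjoint solution which pairs nonpositively with all variations is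
maximized, at almost all times, by the control of the path. -/
theorem ae_maximum {N : ℕ} (hmono : Monotone t) {α : ∀ τ, CotangentSpace n (x τ)}
    (hα : ∀ k < N, (P k).IsAdjoint α)
    (hle : ∀ j : Variation n, ∑ k ∈ Finset.range N, ∫ σ in t k..t (k + 1),
      (P k).covector α σ ((P k).variationField k j σ ((P k).path σ)) ≤ 0) {i : ℕ} (hi : i < N) :
    ∀ᵐ σ, σ ∈ Icc (t i) (t (i + 1)) → ∀ v, (P i).covector α σ ((P i).field v ((P i).path σ)) ≤
      (P i).covector α σ ((P i).field ((P i).control σ) ((P i).path σ)) := by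
  classical
  have hst : t i ≤ t (i + 1) := hmono (Nat.le_succ i)
  have hone : ∀ v, ∀ᵐ σ, σ ∈ Icc (t i) (t (i + 1)) →
      (P i).covector α σ ((P i).field v ((P i).path σ)) ≤
        (P i).covector α σ ((P i).field ((P i).control σ) ((P i).path σ)) := by
    intro v
    set g : ℝ → ℝ := fun σ => (P i).covector α σ ((P i).field ((P i).control σ) ((P i).path σ)) -
      (P i).covector α σ ((P i).field v ((P i).path σ)) with hg
    have hc1 := (P i).isC1Along
    have hc2 := (P i).isControlFamily.isC1Along (u := fun _ => v) (P i).continuousOn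
      (P i).mem_dom measurable_const (P i).norm_fderiv_le
    have hgint : IntegrableOn g (Icc (t i) (t (i + 1))) := by
      obtain ⟨δ, hδ, h⟩ := hc1.exists_integrableOn
      obtain ⟨_, hb, h'⟩ := h (P i).path (P i).continuousOn fun σ _ => Metric.mem_ball_self hδ
      obtain ⟨δ₂, hδ₂, h₂⟩ := hc2.exists_integrableOn
      obtain ⟨_, hb₂, h₂'⟩ := h₂ (P i).path (P i).continuousOn fun σ _ => Metric.mem_ball_self hδ₂
      obtain ⟨_, _, k⟩ := exists_integrableOn_covector_apply (hα i hi).1 h' hb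
      obtain ⟨_, _, k₂⟩ := exists_integrableOn_covector_apply (hα i hi).1 h₂' hb₂
      exact k.sub k₂
    have hnn : 0 ≤ᵐ[volume.restrict (Icc (t i) (t (i + 1)))] g := by
      refine ae_nonneg_of_forall_setIntegral_nonneg hgint fun B hB _ => ?_
      -- the variation acting on the `i`-th piece only, at the times in `B`
      let j : Variation n := some (fun k => if k = i then ⟨B, hB⟩ else ⟨∅, MeasurableSet.empty⟩, v)
      have hj := hle j
      rw [Finset.sum_eq_single i (fun k _ hk => ?_) (fun h => absurd (Finset.mem_range.2 hi) h)]
        at hj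
      · have hfun : ∀ σ, (P i).covector α σ ((P i).variationField i j σ ((P i).path σ)) =
            B.indicator (fun σ => -g σ) σ := by
          intro σ
          have ht : j.times i = B := by simp [j, Variation.times]
          rw [Piece.variationField, ht]
          by_cases hσ : σ ∈ B
          · simp [hσ, hg, j, Variation.target]
          · simp [hσ]
        simp only [hfun] at hj
        rw [intervalIntegral.integral_of_le hst, ← integral_Icc_eq_integral_Ioc,
          integral_indicator hB, integral_neg] at hj
        linarith
      · have : ∀ σ, (P k).variationField k j σ ((P k).path σ) = 0 := fun σ => by
          have ht : j.times k = ∅ := by simp [j, Variation.times, hk]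
          rw [Piece.variationField, ht]; simp
        simp [this]
    rw [EventuallyLE, ae_restrict_iff' measurableSet_Icc] at hnn
    filter_upwards [hnn] with σ h hσ
    exact sub_nonneg.1 (h hσ)
  by_cases hne : Nonempty (Metric.sphere (0 : Coord n) 1)
  -- a countable dense set of controls gives one null set for all of them
  · have hall := ae_all_iff.2 fun k : ℕ => hone (TopologicalSpace.denseSeq _ k)
    filter_upwards [hall] with σ h hσ v
    have hcont : Continuous fun v => (P i).covector α σ ((P i).field v ((P i).path σ)) :=
      ((P i).covector α σ).continuous.comp
        ((P i).isControlFamily.continuous_control ((P i).mem_dom σ hσ))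
    refine (TopologicalSpace.denseRange_denseSeq _).induction_on
      (p := fun v => (P i).covector α σ ((P i).field v ((P i).path σ)) ≤ _) v
      (isClosed_le hcont continuous_const) fun k => h k hσ
  · exact Eventually.of_forall fun σ _ v => absurd ⟨v⟩ hne

/-- The maximum principle: a minimizing path parameterized by arclength is the projection of an
integral curve of the extended geodesic field. -/
theorem exists_integralCurve (hF : IsPontryaginType F) (hab : a < b) (hmin : IsMinimizing F x a b)
    (hsp : HasSpeed F x a b 1) :
    ∃ α : ∀ t, CotangentSpace n (x t), IsIntegralCurve (extendedField F) x α a b := by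
  -- the unit sphere is nonempty, since there are unit velocities
  have hne : Nonempty (Metric.sphere (0 : Coord n) 1) := by
    have hne := neBot_ae_Icc hab
    obtain ⟨τ, ⟨h1, h2⟩, hτ⟩ := (hsp.and (ae_restrict_of_ae (ae_mem_Ioo a b))).and
      (ae_restrict_mem measurableSet_Icc) |>.exists
    replace hτ := h2 hτ
    have hcont := hmin.1.1.continuousAt (Icc_mem_nhds hτ.1 hτ.2)
    obtain ⟨φ, hφ, hs, Ω, f, hΩ, hf⟩ := hF.exists_family (x τ)
    have hd := (differentiableAt_of_velocity hF.toIsC0Finsler hφ hs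
      (by rw [h1]; exact one_ne_zero)).hasDerivAt
    rw [velocity_eq F hφ hs hcont hd] at h1
    obtain ⟨u, _⟩ := hf.exists_eq hΩ h1
    exact ⟨u⟩
  obtain ⟨t, N, hmono, rfl, rfl, -, hP⟩ := exists_pieces hF hab.le hmin.1 hsp
  obtain ⟨P⟩ := Classical.nonempty_pi.2 hP
  obtain ⟨α, hαN, hα, hle⟩ := exists_adjoint_nonpos P hF hmono hab hmin hsp
  refine ⟨α, ?_⟩
  have hst : ∀ i, t i ≤ t (i + 1) := fun i => hmono (Nat.le_succ i)
  -- the Hamiltonian equations on each piece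
  have hac : ∀ i < N, AbsolutelyContinuousOnInterval
      (fun τ => covectorCoord (P i).chart (x τ) (α τ)) (t i) (t (i + 1)) ∧
      ∀ᵐ τ, τ ∈ Icc (t i) (t (i + 1)) → HasDerivAt (fun τ => covectorCoord (P i).chart (x τ) (α τ))
        (hamiltonianField ((P i).field ((P i).control τ))
          (covectorCoord (P i).chart (x τ) (α τ))) τ := by
    intro i hi
    obtain ⟨hc, heq⟩ := hα i hi
    obtain ⟨δ, hδ, h⟩ := (P i).isC1Along.exists_integrableOn
    obtain ⟨B, hB, hint⟩ := h (P i).path (P i).continuousOn fun σ _ => Metric.mem_ball_self hδ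
    obtain ⟨_, hwB, hwint⟩ := (P i).isC1Along.exists_integrableOn_neg_comp hc
    have hl := left_mem_Icc.2 (hst i)
    have hr := right_mem_Icc.2 (hst i)
    refine ⟨ac_prodMk (ac_of_eq_integral hl hint hB (P i).eq_integral)
      (ac_of_eq_integral hr hwint hwB heq), ?_⟩
    filter_upwards [ae_hasDerivAt_of_eq_integral hl hint (P i).eq_integral,
      ae_hasDerivAt_of_eq_integral hr hwint heq] with τ k1 k2 hτ
    exact (k1 hτ).prodMk (k2 hτ)
  have hmax := fun i (hi : i < N) => ae_maximum P hmono hα hle hi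
  -- the covector does not vanish, since the maximized Hamiltonian is constant on each piece
  have hstep : ∀ i < N, (∃ y : TangentSpace (𝓡 n) (x (t (i + 1))), α (t (i + 1)) y ≠ 0) →
      ∀ τ ∈ Icc (t i) (t (i + 1)), (covectorCoord (P i).chart (x τ) (α τ)).2 ≠ 0 := by
    intro i hi ⟨y, hy⟩ τ hτ h0
    have hr := right_mem_Icc.2 (hst i)
    have hN := hF.isAsymmetricNorm (P i).isCoordSystem (P i).isControlFamily
    have hconst := dualNorm_const hF (P i).isCoordSystem (P i).isControlFamily (hst i) (hac i hi).1
      (fun σ hσ => (P i).mem_dom σ hσ) (by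
        filter_upwards [(hac i hi).2, hmax i hi] with σ k1 k2 hσ
        exact ⟨_, _, _, (P i).isControlFamily, (P i).mem_dom σ hσ, k2 hσ, 1,
          by rw [one_smul]; exact k1 hσ⟩)
    have h1 := (hconst _ hr).trans (hconst _ hτ).symm
    rw [h0] at h1
    replace h1 := h1.trans (dualNorm_zero (hN _ ((P i).mem_dom τ hτ)))
    refine ((P i).isControlFamily.dualNorm_pos ((P i).mem_dom _ hr) (hN _ ((P i).mem_dom _ hr))
      fun h => hy ?_).ne' h1
    exact (covectorCoord_snd_eq_zero_iff (P i).isCoordSystem ((P i).source _ hr) _).1 h y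
  have hnz : ∀ i ≤ N, ∃ y : TangentSpace (𝓡 n) (x (t i)), α (t i) y ≠ 0 := by
    intro i hi
    refine Nat.decreasingInduction' (P := fun i => ∃ y : TangentSpace (𝓡 n) (x (t i)), α (t i) y ≠ 0)
      (fun k hk _ h => ?_) hi ?_
    · by_contra! h0
      have hl := left_mem_Icc.2 (hst k)
      exact hstep k hk h _ hl
        ((covectorCoord_snd_eq_zero_iff (P k).isCoordSystem ((P k).source _ hl) _).2 h0)
    · by_contra! h0
      exact hαN ((covectorCoord_snd_eq_zero_iff (P N).isCoordSystem
        ((P N).source _ (left_mem_Icc.2 (hst N))) _).2 h0)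
  have hcurve : ∀ i ≤ N, IsIntegralCurve (extendedField F) x α (t 0) (t i) := by
    intro i
    induction i with
    | zero =>
      refine fun _ => ⟨by rw [Icc_self]; exact continuousOn_singleton _ _,
        fun φ hφ c d hc hcd hd hm => ?_⟩
      obtain rfl : c = d := le_antisymm hcd (hd.trans hc)
      exact ⟨ac_self _ _, by simp⟩
    | succ i ih =>
      intro hi
      refine isIntegralCurve_glue (hmono (Nat.zero_le i)) (hst i) (ih (Nat.le_of_succ_le hi)) ?_
      refine isIntegralCurve_of_chart (P i).isCoordSystem (hst i)
        (hmin.1.1.mono (Icc_subset_Icc (hmono (Nat.zero_le i)) (hmono hi)))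
        (fun τ hτ => (P i).source τ hτ) (hac i hi).1 ?_
      rw [ae_restrict_iff' measurableSet_Icc]
      filter_upwards [(hac i hi).2, hmax i hi] with τ k1 k2 hτ
      exact ⟨_, ⟨hstep i hi (hnz _ hi) τ hτ, _, _, (P i).isControlFamily, (P i).mem_dom τ hτ, _,
        k2 hτ, rfl⟩, k1 hτ⟩
  exact hcurve N le_rfl

end MaximumPrinciple

/-! ### Minimizing paths and integral curves -/

section Minimizing

variable {n : ℕ} {M : Type*} [TopologicalSpace M] [ChartedSpace (Coord n) M]
  [IsManifold (𝓡 n) ∞ M] {F : TangentBundle (𝓡 n) M → ℝ} {x : ℝ → M} {a b : ℝ}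

theorem hasSpeed_one_of_integralCurve (hF : IsPontryaginType F) (hab : a ≤ b)
    {α : ∀ t, CotangentSpace n (x t)} (h : IsIntegralCurve (extendedField F) x α a b) :
    HasSpeed F x a b 1 :=
  hasSpeed_of_integralCurve hF hab one_pos h fun _ _ _ _ _ V hV => ⟨V, hV, (one_smul ℝ V).symm⟩

/-- An integral curve of `𝓔` of dual norm `1`, slowed down or accelerated by the factor `c`, with its
covector multiplied by `c`, is an integral curve of `F_* 𝓔`. -/
theorem isIntegralCurve_scaledField {α : ∀ t, CotangentSpace n (x t)} {c a' b' : ℝ} (hc : 0 < c)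
    (ha : c * a' = a) (hb : c * b' = b) (h : IsIntegralCurve (extendedField F) x α a b)
    (hα : ∀ t ∈ Icc a b, dualF F (x t) (α t) = 1) :
    IsIntegralCurve (scaledField F) (fun t => x (c * t)) (fun t => c • α (c * t)) a' b' := by
  refine isIntegralCurve_comp_mul (α := fun t => c • α t) hc ha hb (isIntegralCurve_smul hc h)
    fun t ht φ hφ hx V hV => ⟨V, hV, ?_⟩
  have h1 : dualNorm (inChart F φ (φ (x t))) (covectorCoord φ (x t) (c • α t)).2 = c := by
    rw [← dualF_eq F hφ hx, dualF, dualNorm_smul _ _ hc]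
    exact (congrArg (c * ·) (hα t ht)).trans (mul_one c)
  exact congrArg (· • V) h1

/-- Every constant speed parameterization of the projection of an integral curve of `𝓔` is the
projection of an integral curve of `F_* 𝓔`. -/
theorem exists_integralCurve_scaledField (hF : IsPontryaginType F) (hab : a < b)
    {α : ∀ t, CotangentSpace n (x t)} (h : IsIntegralCurve (extendedField F) x α a b) {c a' b' : ℝ}
    (hc : 0 < c) (ha : c * a' = a) (hb : c * b' = b) :
    ∃ β : ∀ t, CotangentSpace n (x (c * t)),
      IsIntegralCurve (scaledField F) (fun t => x (c * t)) β a' b' := by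
  obtain ⟨m, hm, hconst⟩ := dualF_pos_const hF isMultiple_extendedField hab h
  refine ⟨_, isIntegralCurve_scaledField hc ha hb (isIntegralCurve_smul (inv_pos.2 hm) h)
    fun t ht => ?_⟩
  rw [dualF, dualNorm_smul _ _ (inv_pos.2 hm)]
  exact (congrArg (m⁻¹ * ·) (hconst t ht)).trans (inv_mul_cancel₀ hm.ne')

theorem hasSpeed_of_integralCurve_scaledField (hF : IsPontryaginType F) (hab : a ≤ b)
    {α : ∀ t, CotangentSpace n (x t)} {c : ℝ} (hc : 0 < c)
    (h : IsIntegralCurve (scaledField F) x α a b)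
    (hα : ∀ t ∈ Icc a b, dualF F (x t) (α t) = c) : HasSpeed F x a b c := by
  refine hasSpeed_of_integralCurve hF hab hc h fun t ht φ hφ hx V hV => ?_
  obtain ⟨V₀, hV₀, rfl⟩ := hV
  exact ⟨V₀, hV₀, congrArg (· • V₀) ((dualF_eq F hφ hx (α t)).symm.trans (hα t ht))⟩

/-- A minimizing path with constant positive speed is the projection of an integral curve of
`F_* 𝓔`. -/
theorem exists_integralCurve_of_hasSpeed (hF : IsPontryaginType F) (hab : a < b)
    (hmin : IsMinimizing F x a b) {c : ℝ} (hc : 0 < c) (h : HasSpeed F x a b c) :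
    ∃ α : ∀ t, CotangentSpace n (x t), IsIntegralCurve (scaledField F) x α a b := by
  have hc' : 0 < c⁻¹ := inv_pos.2 hc
  have ha : c⁻¹ * (c * a) = a := inv_mul_cancel_left₀ hc.ne' a
  have hb : c⁻¹ * (c * b) = b := inv_mul_cancel_left₀ hc.ne' b
  have hsp := hasSpeed_comp_mul hF.toIsC0Finsler hc' ha hb hc hmin.1.1 h
  rw [inv_mul_cancel₀ hc.ne'] at hsp
  obtain ⟨α, hα⟩ := exists_integralCurve hF (by gcongr)
    (isMinimizing_comp_mul hF.toIsC0Finsler hc' ha hb hc h hmin) hsp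
  have key := exists_integralCurve_scaledField hF (by gcongr) hα hc (a' := a) (b' := b) rfl rfl
  have hx : (fun t => x (c⁻¹ * (c * t))) = x := by
    ext t; rw [inv_mul_cancel_left₀ hc.ne']
  -- the covectors depend on the path, which has to be replaced by an equal one
  have gen : ∀ y : ℝ → M, y = x → (∃ β : ∀ t, CotangentSpace n (y t),
      IsIntegralCurve (scaledField F) y β a b) → ∃ β : ∀ t, CotangentSpace n (x t),
      IsIntegralCurve (scaledField F) x β a b := by rintro y rfl h; exact h
  exact gen _ hx key

/-- An integral curve of `F_* 𝓔` of dual norm `c`, reparameterized by arclength, is an integral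
curve of `𝓔`. -/
theorem isIntegralCurve_extendedField_div {α : ∀ t, CotangentSpace n (x t)} {c : ℝ} (hc : 0 < c)
    (h : IsIntegralCurve (scaledField F) x α a b)
    (hα : ∀ t ∈ Icc a b, dualF F (x t) (α t) = c) :
    IsIntegralCurve (extendedField F) (fun t => x (t / c)) (fun t => α (t / c)) (c * a) (c * b) := by
  have key := isIntegralCurve_comp_mul (Ψ := extendedField F) (inv_pos.2 hc)
    (inv_mul_cancel_left₀ hc.ne' a) (inv_mul_cancel_left₀ hc.ne' b) h
    fun t ht φ hφ hx V hV => by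
      obtain ⟨V₀, hV₀, rfl⟩ := hV
      have h1 : dualNorm (inChart F φ (φ (x t))) (covectorCoord φ (x t) (α t)).2 = c :=
        (dualF_eq F hφ hx (α t)).symm.trans (hα t ht)
      have h2 : c⁻¹ • dualNorm (inChart F φ (φ (x t))) (covectorCoord φ (x t) (α t)).2 • V₀ = V₀ := by
        rw [h1, inv_smul_smul₀ hc.ne']
      exact h2.symm ▸ hV₀
  -- the covectors depend on the path, which has to be replaced by an equal one
  have gen : ∀ (g k : ℝ → ℝ), g = k →
      IsIntegralCurve (extendedField F) (fun t => x (g t)) (fun t => α (g t)) (c * a) (c * b) →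
      IsIntegralCurve (extendedField F) (fun t => x (k t)) (fun t => α (k t)) (c * a) (c * b) := by
    rintro g _ rfl h; exact h
  exact gen (fun t => c⁻¹ * t) _ (funext fun t => by rw [div_eq_inv_mul]) key

/-- The correspondences `𝓔` and `F_* 𝓔` represent the minimizing paths with constant speed of a
structure of Pontryagin type. -/
theorem minimizing_iff_integralCurve (hF : IsPontryaginType F) (hab : a < b)
    (hmin : IsMinimizing F x a b) :
    (HasSpeed F x a b 1 ↔
      ∃ α : ∀ t, CotangentSpace n (x t), IsIntegralCurve (extendedField F) x α a b) ∧
    ((∃ c : ℝ, 0 < c ∧ HasSpeed F x a b c) ↔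
      ∃ α : ∀ t, CotangentSpace n (x t), IsIntegralCurve (scaledField F) x α a b) ∧
    (∀ α : ∀ t, CotangentSpace n (x t), IsIntegralCurve (extendedField F) x α a b →
      (∃ m : ℝ, 0 < m ∧ ∀ t ∈ Icc a b, dualF F (x t) (α t) = m) ∧
      (∀ c : ℝ, 0 < c → IsIntegralCurve (extendedField F) x (fun t => c • α t) a b) ∧
      ((∀ t ∈ Icc a b, dualF F (x t) (α t) = 1) → ∀ c : ℝ, 0 < c →
        IsIntegralCurve (scaledField F) (fun t => x (c * t)) (fun t => c • α (c * t))
          (a / c) (b / c)) ∧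
      (∀ c : ℝ, 0 < c → ∃ β : ∀ t, CotangentSpace n (x (c * t)),
        IsIntegralCurve (scaledField F) (fun t => x (c * t)) β (a / c) (b / c))) ∧
    (∀ α : ∀ t, CotangentSpace n (x t), IsIntegralCurve (scaledField F) x α a b →
      ∃ c : ℝ, 0 < c ∧ (∀ t ∈ Icc a b, dualF F (x t) (α t) = c) ∧ HasSpeed F x a b c ∧
        HasSpeed F (fun t => x (t / c)) (c * a) (c * b) 1 ∧
        IsIntegralCurve (extendedField F) (fun t => x (t / c)) (fun t => α (t / c))
          (c * a) (c * b)) := by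
  have hd : ∀ α : ∀ t, CotangentSpace n (x t), IsIntegralCurve (scaledField F) x α a b →
      ∃ c : ℝ, 0 < c ∧ (∀ t ∈ Icc a b, dualF F (x t) (α t) = c) ∧ HasSpeed F x a b c ∧
        HasSpeed F (fun t => x (t / c)) (c * a) (c * b) 1 ∧
        IsIntegralCurve (extendedField F) (fun t => x (t / c)) (fun t => α (t / c))
          (c * a) (c * b) := by
    intro α hα
    obtain ⟨c, hc, hconst⟩ := dualF_pos_const hF isMultiple_scaledField hab hα
    have hE := isIntegralCurve_extendedField_div hc hα hconst
    exact ⟨c, hc, hconst, hasSpeed_of_integralCurve_scaledField hF hab.le hc hα hconst,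
      hasSpeed_one_of_integralCurve hF (by gcongr) hE, hE⟩
  refine ⟨⟨exists_integralCurve hF hab hmin, fun ⟨α, hα⟩ =>
      hasSpeed_one_of_integralCurve hF hab.le hα⟩,
    ⟨fun ⟨c, hc, h⟩ => exists_integralCurve_of_hasSpeed hF hab hmin hc h, fun ⟨α, hα⟩ => ?_⟩,
    fun α hα => ⟨dualF_pos_const hF isMultiple_extendedField hab hα,
      fun c hc => isIntegralCurve_smul hc hα, fun h c hc => ?_, fun c hc => ?_⟩, hd⟩
  · obtain ⟨c, hc, _, h, _⟩ := hd α hα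
    exact ⟨c, hc, h⟩
  · exact isIntegralCurve_scaledField hc (mul_div_cancel₀ a hc.ne') (mul_div_cancel₀ b hc.ne') hα h
  · exact exists_integralCurve_scaledField hF hab hα hc (mul_div_cancel₀ a hc.ne')
      (mul_div_cancel₀ b hc.ne')

end Minimizing

/-! ### Minkowski norms -/

section Minkowski

variable {E : Type*} [NormedAddCommGroup E] [NormedSpace ℝ E]

/-- A Minkowski norm: a nonnegative, positively homogeneous function, of class `C²` off the origin,
whose square has positive definite second derivatives. -/
structure IsMinkowski (N : E → ℝ) : Prop where
  nonneg : ∀ y, 0 ≤ N y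
  smul_pos : ∀ (c : ℝ) (y : E), 0 < c → N (c • y) = c * N y
  contDiffOn : ContDiffOn ℝ 2 N {0}ᶜ
  posDef : ∀ η ≠ 0, ∀ w ≠ 0, 0 < fderiv ℝ (fderiv ℝ fun y => N y ^ 2) η w w

/-- The Legendre map `η ↦ ½ d(N²)(η)` of a Minkowski norm. -/
def legendreMap (N : E → ℝ) (η : E) : E →L[ℝ] ℝ := (1 / 2 : ℝ) • fderiv ℝ (fun y => N y ^ 2) η

namespace IsMinkowski

variable {N : E → ℝ} (hN : IsMinkowski N)
include hN

theorem map_zero : N 0 = 0 := by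
  have := hN.smul_pos 2 0 two_pos
  rw [smul_zero] at this
  linarith

theorem contDiffAt {η : E} (hη : η ≠ 0) : ContDiffAt ℝ 2 N η :=
  hN.contDiffOn.contDiffAt (isOpen_compl_singleton.mem_nhds hη)

theorem hasFDerivAt_sq {η : E} (hη : η ≠ 0) :
    HasFDerivAt (fun y => N y ^ 2) (fderiv ℝ (fun y => N y ^ 2) η) η :=
  (((hN.contDiffAt hη).pow 2).differentiableAt (by simp)).hasFDerivAt

theorem hasFDerivAt_fderiv_sq {η : E} (hη : η ≠ 0) :
    HasFDerivAt (fderiv ℝ fun y => N y ^ 2) (fderiv ℝ (fderiv ℝ fun y => N y ^ 2) η) η :=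
  ((((hN.contDiffAt hη).pow 2).fderiv_right (m := 1) (by norm_num)).differentiableAt
    (by simp)).hasFDerivAt

/-- The derivative of `N²` is homogeneous of degree one. -/
theorem fderiv_sq_smul {η : E} (hη : η ≠ 0) {c : ℝ} (hc : 0 < c) :
    fderiv ℝ (fun y => N y ^ 2) (c • η) = c • fderiv ℝ (fun y => N y ^ 2) η := by
  have h1 : HasFDerivAt (fun y : E => c • y) (c • ContinuousLinearMap.id ℝ E) η :=
    (hasFDerivAt_id η).const_smul c
  have h2 := (hN.hasFDerivAt_sq (smul_ne_zero hc.ne' hη)).comp η h1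
  have h3 : HasFDerivAt (fun y => N (c • y) ^ 2) (c ^ 2 • fderiv ℝ (fun y => N y ^ 2) η) η := by
    refine ((hN.hasFDerivAt_sq hη).const_mul (c ^ 2)).congr_of_eventuallyEq
      (Eventually.of_forall fun y => ?_)
    simp only [hN.smul_pos c y hc]; ring
  have h4 := h2.unique h3
  ext w
  have h5 := congrArg (fun L : E →L[ℝ] ℝ => L w) h4
  simp only [ContinuousLinearMap.comp_apply, smul_apply,
    ContinuousLinearMap.id_apply, _root_.map_smul, smul_eq_mul] at h5 ⊢
  have h6 : c * (fderiv ℝ (fun y => N y ^ 2) (c • η) w) =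
    c * (c * fderiv ℝ (fun y => N y ^ 2) η w) := by rw [h5]; ring
  exact mul_left_cancel₀ hc.ne' h6

/-- The Euler identity for `N²`, homogeneous of degree two. -/
theorem fderiv_sq_self {η : E} (hη : η ≠ 0) :
    fderiv ℝ (fun y => N y ^ 2) η η = 2 * N η ^ 2 := by
  have h1 : HasDerivAt (fun s : ℝ => s • η) η 1 := by
    simpa using (hasDerivAt_id (1 : ℝ)).smul_const η
  have h0 := hN.hasFDerivAt_sq hη
  have h2 : HasDerivAt (fun s : ℝ => N (s • η) ^ 2) (fderiv ℝ (fun y => N y ^ 2) η η) 1 := by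
    rw [← one_smul ℝ η] at h0
    have := h0.comp_hasDerivAt 1 h1
    rwa [one_smul] at this
  have h3 : HasDerivAt (fun s : ℝ => N (s • η) ^ 2) (2 * N η ^ 2) 1 := by
    have : HasDerivAt (fun s : ℝ => s ^ 2 * N η ^ 2) (2 * N η ^ 2) 1 := by
      simpa using (hasDerivAt_pow 2 (1 : ℝ)).mul_const (N η ^ 2)
    refine this.congr_of_eventuallyEq ?_
    filter_upwards [lt_mem_nhds one_pos] with s hs
    rw [hN.smul_pos s η hs]; ring
  exact h2.unique h3

/-- The Euler identity for the derivative of `N²`, homogeneous of degree one. -/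
theorem fderiv_fderiv_sq_self {η : E} (hη : η ≠ 0) :
    fderiv ℝ (fderiv ℝ fun y => N y ^ 2) η η = fderiv ℝ (fun y => N y ^ 2) η := by
  have h1 : HasDerivAt (fun s : ℝ => s • η) η 1 := by
    simpa using (hasDerivAt_id (1 : ℝ)).smul_const η
  have h0 := hN.hasFDerivAt_fderiv_sq hη
  have h2 : HasDerivAt (fun s : ℝ => fderiv ℝ (fun y => N y ^ 2) (s • η))
      (fderiv ℝ (fderiv ℝ fun y => N y ^ 2) η η) 1 := by
    rw [← one_smul ℝ η] at h0
    have := h0.comp_hasDerivAt 1 h1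
    rwa [one_smul] at this
  have h3 : HasDerivAt (fun s : ℝ => fderiv ℝ (fun y => N y ^ 2) (s • η))
      (fderiv ℝ (fun y => N y ^ 2) η) 1 := by
    have : HasDerivAt (fun s : ℝ => s • fderiv ℝ (fun y => N y ^ 2) η)
        (fderiv ℝ (fun y => N y ^ 2) η) 1 := by
      simpa using (hasDerivAt_id (1 : ℝ)).smul_const (fderiv ℝ (fun y => N y ^ 2) η)
    refine this.congr_of_eventuallyEq ?_
    filter_upwards [lt_mem_nhds one_pos] with s hs
    exact hN.fderiv_sq_smul hη hs
  exact h2.unique h3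

theorem pos {η : E} (hη : η ≠ 0) : 0 < N η := by
  have h := hN.posDef η hη η hη
  rw [hN.fderiv_fderiv_sq_self hη, hN.fderiv_sq_self hη] at h
  refine lt_of_le_of_ne (hN.nonneg η) fun h0 => ?_
  rw [← h0] at h
  simp at h

theorem eq_zero_iff (η : E) : N η = 0 ↔ η = 0 := by
  refine ⟨fun h => ?_, fun h => by rw [h, hN.map_zero]⟩
  by_contra hη
  exact (hN.pos hη).ne' h

theorem legendreMap_self {η : E} (hη : η ≠ 0) : legendreMap N η η = N η ^ 2 := by
  rw [legendreMap, smul_apply, hN.fderiv_sq_self hη, smul_eq_mul]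
  ring

theorem legendreMap_smul {η : E} (hη : η ≠ 0) {c : ℝ} (hc : 0 < c) :
    legendreMap N (c • η) = c • legendreMap N η := by
  rw [legendreMap, legendreMap, hN.fderiv_sq_smul hη hc, smul_comm]

theorem legendreMap_ne_zero {η : E} (hη : η ≠ 0) : legendreMap N η ≠ 0 := fun h => by
  have h1 := hN.legendreMap_self hη
  rw [h, zero_apply] at h1
  exact (pow_pos (hN.pos hη) 2).ne h1

theorem hasFDerivAt {η : E} (hη : η ≠ 0) : HasFDerivAt N ((N η)⁻¹ • legendreMap N η) η := by
  have h := ((hN.contDiffAt hη).differentiableAt (by simp)).hasFDerivAt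
  have h2 : fderiv ℝ (fun y => N y ^ 2) η = (2 * N η) • fderiv ℝ N η := by
    have := (h.pow 2).fderiv
    simpa using this
  have hpos := (hN.pos hη).ne'
  rw [legendreMap, h2, smul_smul, smul_smul]
  have : (N η)⁻¹ * (1 / 2) * (2 * N η) = 1 := by field_simp
  rwa [this, one_smul]

/-- Strict convexity of `N²` along a segment which avoids the origin. -/
theorem fderiv_sq_lt {η w : E} (hne : w ≠ η) (hseg : ∀ s ∈ Icc (0 : ℝ) 1, η + s • (w - η) ≠ 0) :
    fderiv ℝ (fun y => N y ^ 2) η w < N η ^ 2 + N w ^ 2 := by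
  set d := w - η
  have hd : d ≠ 0 := sub_ne_zero.2 hne
  have hη : η ≠ 0 := by simpa using hseg 0 (by simp)
  have hline : ∀ s : ℝ, HasDerivAt (fun s : ℝ => η + s • d) d s := fun s => by
    simpa using ((hasDerivAt_id s).smul_const d).const_add η
  have h1 : ∀ s ∈ Icc (0 : ℝ) 1, HasDerivAt (fun s : ℝ => N (η + s • d) ^ 2)
      (fderiv ℝ (fun y => N y ^ 2) (η + s • d) d) s := by
    intro s hs
    have := hN.hasFDerivAt_sq (hseg s hs)
    exact HasFDerivAt.comp_hasDerivAt (f := fun s : ℝ => η + s • d) s this (hline s)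
  have h2 : ∀ s ∈ Icc (0 : ℝ) 1, HasDerivAt (fun s : ℝ => fderiv ℝ (fun y => N y ^ 2) (η + s • d) d)
      (fderiv ℝ (fderiv ℝ fun y => N y ^ 2) (η + s • d) d d) s := by
    intro s hs
    have h := hN.hasFDerivAt_fderiv_sq (hseg s hs)
    have h' := HasFDerivAt.comp_hasDerivAt (f := fun s : ℝ => η + s • d) s h (hline s)
    exact (h'.clm_apply (hasDerivAt_const s d)).congr_deriv (by simp)
  obtain ⟨c, hc, hc'⟩ := exists_hasDerivAt_eq_slope _ _ one_pos
    (fun s hs => (h1 s hs).continuousAt.continuousWithinAt)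
    fun s hs => h1 s (Ioo_subset_Icc_self hs)
  have hsub : Icc 0 c ⊆ Icc (0 : ℝ) 1 := Icc_subset_Icc_right hc.2.le
  obtain ⟨e, he, he'⟩ := exists_hasDerivAt_eq_slope _ _ hc.1
    (fun s hs => (h2 s (hsub hs)).continuousAt.continuousWithinAt)
    fun s hs => h2 s (hsub (Ioo_subset_Icc_self hs))
  have hpos := hN.posDef _ (hseg e (hsub (Ioo_subset_Icc_self he))) d hd
  rw [he', sub_zero, div_pos_iff_of_pos_right hc.1, hc'] at hpos
  have e1 : η + (1 : ℝ) • d = w := by simp [d]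
  rw [e1, zero_smul, add_zero, sub_zero, div_one, map_sub, hN.fderiv_sq_self hη] at hpos
  linarith

/-- The fundamental inequality of Minkowski norms, with its case of equality. -/
theorem legendreMap_lt {η w : E} (hη : η ≠ 0) (hw : w ≠ 0) (hne : (N η / N w) • w ≠ η) :
    legendreMap N η w < N η * N w := by
  have hpη := hN.pos hη
  have hpw := hN.pos hw
  set c := N η / N w
  have hc : 0 < c := by positivity
  have hcw : N (c • w) = N η := by rw [hN.smul_pos c w hc]; exact div_mul_cancel₀ _ hpw.ne'
  have key : fderiv ℝ (fun y => N y ^ 2) η (c • w) < 2 * N η ^ 2 := by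
    by_cases hseg : ∀ s ∈ Icc (0 : ℝ) 1, η + s • (c • w - η) ≠ 0
    · have := hN.fderiv_sq_lt hne hseg
      rw [hcw] at this
      linarith
    · -- the segment meets the origin only if `w` is a negative multiple of `η`
      push Not at hseg
      obtain ⟨s, hs, h0⟩ := hseg
      have hs0 : s ≠ 0 := by rintro rfl; exact hη (by simpa using h0)
      have hspos : 0 < s := lt_of_le_of_ne hs.1 hs0.symm
      have h1 : s • c • w = -((1 - s) • η) := by
        rw [eq_neg_iff_add_eq_zero, ← h0]
        module
      have h2 := congrArg (fderiv ℝ (fun y => N y ^ 2) η) h1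
      rw [_root_.map_smul, map_neg, _root_.map_smul _ (1 - s), hN.fderiv_sq_self hη, smul_eq_mul,
        smul_eq_mul] at h2
      have h3 : 0 ≤ (1 - s) * (2 * N η ^ 2) :=
        mul_nonneg (by linarith [hs.2]) (by positivity)
      have h4 : fderiv ℝ (fun y => N y ^ 2) η (c • w) ≤ 0 := by
        by_contra! h
        have := mul_pos hspos h
        linarith
      exact h4.trans_lt (by positivity)
  rw [_root_.map_smul, smul_eq_mul] at key
  rw [legendreMap, smul_apply, smul_eq_mul]
  have h5 : c * (N η * N w) = N η ^ 2 := by simp only [c]; field_simp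
  by_contra! h
  have := mul_le_mul_of_nonneg_left h hc.le
  linarith

theorem legendreMap_le {η : E} (hη : η ≠ 0) (w : E) : legendreMap N η w ≤ N η * N w := by
  rcases eq_or_ne w 0 with rfl | hw
  · simp [hN.map_zero]
  by_cases hne : (N η / N w) • w = η
  · have hpη := hN.pos hη
    have hpw := hN.pos hw
    have h := hN.legendreMap_self hη
    nth_rewrite 2 [← hne] at h
    rw [_root_.map_smul, smul_eq_mul] at h
    have : legendreMap N η w = N η * N w := by
      field_simp at h
      exact h
    exact this.le
  · exact (hN.legendreMap_lt hη hw hne).le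

/-- The triangle inequality for `y + z` is the fundamental inequality at the covector `legendreMap N (y + z)`,
applied to `y` and to `z`. -/
theorem isAsymmetricNorm : IsAsymmetricNorm N where
  nonneg := hN.nonneg
  eq_zero_iff := hN.eq_zero_iff
  smul_pos := hN.smul_pos
  add_le y z := by
    rcases eq_or_ne (y + z) 0 with h | h
    · rw [h, hN.map_zero]
      exact add_nonneg (hN.nonneg y) (hN.nonneg z)
    · have h1 := hN.legendreMap_self h
      rw [_root_.map_add] at h1
      have h2 := hN.legendreMap_le h y
      have h3 := hN.legendreMap_le h z
      have h4 := hN.pos h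
      nlinarith

theorem dualNorm_legendreMap {η : E} (hη : η ≠ 0) : dualNorm N (legendreMap N η) = N η := by
  have hp := hN.pos hη
  refine IsGreatest.csSup_eq ⟨⟨(N η)⁻¹ • η, ?_, ?_⟩, ?_⟩
  · change N ((N η)⁻¹ • η) ≤ 1
    rw [hN.smul_pos _ _ (inv_pos.2 hp), inv_mul_cancel₀ hp.ne']
  · change legendreMap N η ((N η)⁻¹ • η) = N η
    rw [_root_.map_smul, hN.legendreMap_self hη, smul_eq_mul]
    field_simp
  · rintro _ ⟨y, hy, rfl⟩
    exact (hN.legendreMap_le hη y).trans (mul_le_of_le_one_right hp.le hy)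

theorem injOn_legendreMap : InjOn (legendreMap N) {η | η ≠ 0} := by
  intro η hη w hw h
  have h1 : N η = N w := by
    rw [← hN.dualNorm_legendreMap hη, h, hN.dualNorm_legendreMap hw]
  by_contra hne
  have h2 := hN.legendreMap_lt hη hw (by
    rw [h1, div_self (hN.pos hw).ne', one_smul]; exact fun h => hne h.symm)
  rw [h, hN.legendreMap_self hw, h1] at h2
  linarith [sq (N w)]

/-- A unit vector at which a covector attains its maximum on the unit sphere is mapped to a multiple
of this covector by the Legendre map. -/
theorem eq_smul_legendreMap {a : E →L[ℝ] ℝ} {w : E} (hw : N w = 1)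
    (hmax : ∀ y, N y = 1 → a y ≤ a w) : a = a w • legendreMap N w := by
  have hw0 : w ≠ 0 := by rintro rfl; rw [hN.map_zero] at hw; exact zero_ne_one hw
  have hle : ∀ y, y ≠ 0 → a y ≤ a w * N y := by
    intro y hy
    have hp := hN.pos hy
    have := hmax ((N y)⁻¹ • y) (by
      rw [hN.smul_pos _ _ (inv_pos.2 hp), inv_mul_cancel₀ hp.ne'])
    rwa [_root_.map_smul, smul_eq_mul, inv_mul_le_iff₀ hp, mul_comm] at this
  have hd : HasFDerivAt (fun y => a w * N y - a y)
      (a w • ((N w)⁻¹ • legendreMap N w) - a) w :=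
    ((hN.hasFDerivAt hw0).const_mul (a w)).sub a.hasFDerivAt
  have hmin : IsLocalMin (fun y => a w * N y - a y) w := by
    filter_upwards [isOpen_compl_singleton.mem_nhds hw0] with y hy
    have := hle y hy
    simp only [hw]
    linarith
  have := hmin.hasFDerivAt_eq_zero hd
  rw [hw, inv_one, one_smul, sub_eq_zero] at this
  exact this.symm

/-- Every nonzero covector attains its maximum on the unit sphere, and this maximum is positive. -/
theorem exists_maximizer [FiniteDimensional ℝ E] {a : E →L[ℝ] ℝ} (ha : a ≠ 0) :
    ∃ w, N w = 1 ∧ 0 < a w ∧ ∀ y, N y = 1 → a y ≤ a w := by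
  obtain ⟨z, hz⟩ : ∃ z, 0 < a z := by
    by_contra! h
    refine ha (ContinuousLinearMap.ext fun y => le_antisymm (h y) ?_)
    have := h (-y)
    rw [map_neg] at this
    simpa using this
  have hz0 : z ≠ 0 := by rintro rfl; simp at hz
  have hcont : ContinuousOn (fun y => (N y)⁻¹ * a y) (Metric.sphere (0 : E) 1) := by
    have h0 : ∀ y ∈ Metric.sphere (0 : E) 1, y ≠ 0 := fun y hy h => by simp [h] at hy
    refine ContinuousOn.mul (ContinuousOn.inv₀ (hN.contDiffOn.continuousOn.mono h0)
      fun y hy => (hN.pos (h0 y hy)).ne') a.continuous.continuousOn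
  have hnz : 0 < ‖z‖ := norm_pos_iff.2 hz0
  obtain ⟨y, hy, hmax⟩ := (isCompact_sphere (0 : E) 1).exists_isMaxOn
    ⟨‖z‖⁻¹ • z, by simp [norm_smul, hnz.ne']⟩ hcont
  have hval : ∀ u : E, u ≠ 0 → (N (‖u‖⁻¹ • u))⁻¹ * a (‖u‖⁻¹ • u) = (N u)⁻¹ * a u := by
    intro u hu
    have hu' : 0 < ‖u‖ := norm_pos_iff.2 hu
    rw [hN.smul_pos _ _ (inv_pos.2 hu'), _root_.map_smul, smul_eq_mul]
    have := (hN.pos hu).ne'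
    field_simp
  have hle : ∀ u : E, u ≠ 0 → (N u)⁻¹ * a u ≤ (N y)⁻¹ * a y := by
    intro u hu
    rw [← hval u hu]
    exact hmax (by simp [norm_smul, (norm_pos_iff.2 hu).ne'])
  have hy0 : y ≠ 0 := by rintro rfl; simp at hy
  have hpy := hN.pos hy0
  refine ⟨(N y)⁻¹ • y, ?_, ?_, fun u hu => ?_⟩
  · rw [hN.smul_pos _ _ (inv_pos.2 hpy), inv_mul_cancel₀ hpy.ne']
  · rw [_root_.map_smul, smul_eq_mul]
    exact (mul_pos (inv_pos.2 (hN.pos hz0)) hz).trans_le (hle z hz0)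
  · have hu0 : u ≠ 0 := by rintro rfl; rw [hN.map_zero] at hu; exact zero_ne_one hu
    have := hle u hu0
    rwa [hu, inv_one, one_mul, ← smul_eq_mul, ← _root_.map_smul] at this

/-- The maximum of a covector on the unit sphere is attained at one vector only. -/
theorem eq_of_maximizer {a : E →L[ℝ] ℝ} {w y : E} (hw : N w = 1) (hpos : 0 < a w)
    (hmax : ∀ y, N y = 1 → a y ≤ a w) (hy : N y = 1) (hya : a y = a w) : y = w := by
  have hw0 : w ≠ 0 := by rintro rfl; rw [hN.map_zero] at hw; exact zero_ne_one hw
  have hy0 : y ≠ 0 := by rintro rfl; rw [hN.map_zero] at hy; exact zero_ne_one hy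
  by_contra hne
  have h1 := hN.legendreMap_lt hw0 hy0 (by rwa [hw, hy, div_one, one_smul])
  have h2 := congrArg (fun L : E →L[ℝ] ℝ => L y) (hN.eq_smul_legendreMap hw hmax)
  simp only [smul_apply, smul_eq_mul] at h2
  rw [hw, hy, one_mul] at h1
  rw [hya] at h2
  nlinarith

/-- The inverse of the Legendre map sends a covector to its maximizer `w` on the unit sphere, multiplied by
the maximum. -/
theorem bijOn_legendreMap [FiniteDimensional ℝ E] :
    BijOn (legendreMap N) {η | η ≠ 0} {a | a ≠ 0} := by
  refine ⟨fun η hη => hN.legendreMap_ne_zero hη, hN.injOn_legendreMap, fun a ha => ?_⟩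
  obtain ⟨w, hw, hpos, hmax⟩ := hN.exists_maximizer ha
  have hw0 : w ≠ 0 := by rintro rfl; rw [hN.map_zero] at hw; exact zero_ne_one hw
  refine ⟨a w • w, smul_ne_zero hpos.ne' hw0, ?_⟩
  rw [hN.legendreMap_smul hw0 hpos]
  exact (hN.eq_smul_legendreMap hw hmax).symm

end IsMinkowski

end Minkowski

/-! ### Finsler structures in coordinates -/

section FinslerChart

variable {n : ℕ} {M : Type*} [TopologicalSpace M] [ChartedSpace (Coord n) M]
  [IsManifold (𝓡 n) ∞ M] {φ : OpenPartialHomeomorph M (Coord n)}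

/-- The natural coordinates of the tangent bundle are smooth. -/
theorem contMDiffOn_lift (hφ : IsCoordSystem φ) :
    ContMDiffOn 𝓘(ℝ, Coord n × Coord n) (𝓡 n).tangent ∞
      (fun p : Coord n × Coord n => (⟨φ.symm p.1,
        mfderiv 𝓘(ℝ, Coord n) (𝓡 n) φ.symm p.1 p.2⟩ : TangentBundle (𝓡 n) M))
      (φ.target ×ˢ univ) := by
  have h := (contMDiffOn_symm_of_mem_maximalAtlas hφ).contMDiffOn_tangentMapWithin (m := ∞)
    (by simp) φ.open_target.uniqueMDiffOn
  have h2 : ContMDiff 𝓘(ℝ, Coord n × Coord n) 𝓘(ℝ, Coord n).tangent ∞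
      (fun p : Coord n × Coord n => (⟨p.1, p.2⟩ : TangentBundle 𝓘(ℝ, Coord n) (Coord n))) := by
    rw [modelWithCornersSelf_prod]
    exact contMDiff_tangentBundleModelSpaceHomeomorph_symm (I := 𝓘(ℝ, Coord n)) (n := ∞)
  have h3 := h.comp (h2.contMDiffOn (s := φ.target ×ˢ univ)) (fun p hp => hp.1)
  refine (h3.congr fun p hp => ?_)
  simp only [Function.comp]
  rw [tangentMapWithin_eq_tangentMap (φ.open_target.uniqueMDiffOn _ hp.1)
    (hφ.mdifferentiable.mdifferentiableAt_symm hp.1)]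
  rfl

/-- The natural coordinates of a tangent vector depend continuously on it. -/
theorem continuousOn_tangentCoord (hφ : IsCoordSystem φ) :
    ContinuousOn (fun v : TangentBundle (𝓡 n) M =>
      ((φ v.1, mfderiv (𝓡 n) 𝓘(ℝ, Coord n) φ v.1 v.2) : Coord n × Coord n))
      (Bundle.TotalSpace.proj ⁻¹' φ.source) := by
  have h := (contMDiffOn_of_mem_maximalAtlas hφ).continuousOn_tangentMapWithin
    (by simp) φ.open_source.uniqueMDiffOn
  have h2 := (tangentBundleModelSpaceHomeomorph (𝓘(ℝ, Coord n))).continuous.comp_continuousOn h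
  refine h2.congr fun v hv => ?_
  simp only [Function.comp]
  rw [tangentMapWithin_eq_tangentMap (φ.open_source.uniqueMDiffOn _ hv)
    (hφ.mdifferentiable.mdifferentiableAt hv)]
  rfl

theorem inChart_tangentCoord (F : TangentBundle (𝓡 n) M → ℝ) (hφ : IsCoordSystem φ)
    {v : TangentBundle (𝓡 n) M} (hv : v.1 ∈ φ.source) :
    inChart F φ (φ v.1) (mfderiv (𝓡 n) 𝓘(ℝ, Coord n) φ v.1 v.2 : Coord n) = F v := by
  have key : ∀ (y z : M) (v : TangentSpace (𝓡 n) y) (w : TangentSpace (𝓡 n) z), y = z →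
      (v : Coord n) = w → F ⟨y, v⟩ = F ⟨z, w⟩ := by
    rintro y _ v _ rfl rfl
    rfl
  refine key _ _ _ _ (φ.left_inv hv) ?_
  have := hφ.mdifferentiable.symm_comp_deriv hv
  exact congrArg (fun L : TangentSpace (𝓡 n) v.1 →L[ℝ] TangentSpace (𝓡 n) v.1 => (L v.2 : Coord n))
    this

variable {F : TangentBundle (𝓡 n) M → ℝ}

/-- The domain of the natural coordinates of `TM ∖ 0`. -/
def slitDomain (φ : OpenPartialHomeomorph M (Coord n)) : Set (Coord n × Coord n) :=
  φ.target ×ˢ {0}ᶜ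

omit [IsManifold (𝓡 n) ∞ M] in
theorem isOpen_slitDomain (φ : OpenPartialHomeomorph M (Coord n)) : IsOpen (slitDomain φ) :=
  φ.open_target.prod isOpen_compl_singleton

theorem IsFinsler.contDiffOn (hF : IsFinsler F) (hφ : IsCoordSystem φ) :
    ContDiffOn ℝ ∞ (fun p : Coord n × Coord n => inChart F φ p.1 p.2) (slitDomain φ) := by
  rw [← contMDiffOn_iff_contDiffOn]
  refine hF.smooth.comp ((contMDiffOn_lift hφ).mono (prod_mono le_rfl (subset_univ _)))
    fun p hp => ?_
  have h := (mfderiv_symm_bijective hφ hp.1).injective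
  intro h0
  exact hp.2 (h (Eq.trans (b := 0) h0
    (mfderiv 𝓘(ℝ, Coord n) (𝓡 n) φ.symm p.1).map_zero.symm))

theorem IsFinsler.inChart_smul (hF : IsFinsler F) (ξ : Coord n) (c : ℝ) (y : Coord n) (hc : 0 < c) :
    inChart F φ ξ (c • y) = c * inChart F φ ξ y := by
  have h := hF.smul_pos (φ.symm ξ) (mfderiv 𝓘(ℝ, Coord n) (𝓡 n) φ.symm ξ y) c hc
  exact (congrArg (fun w => F ⟨φ.symm ξ, w⟩)
    ((mfderiv 𝓘(ℝ, Coord n) (𝓡 n) φ.symm ξ).map_smul c y)).trans h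

/-- The square `F²` in natural coordinates. -/
def energy (F : TangentBundle (𝓡 n) M → ℝ) (φ : OpenPartialHomeomorph M (Coord n))
    (p : Coord n × Coord n) : ℝ := inChart F φ p.1 p.2 ^ 2

/-- The vertical derivative of `F²` in natural coordinates. -/
def vertDeriv (F : TangentBundle (𝓡 n) M → ℝ) (φ : OpenPartialHomeomorph M (Coord n))
    (p : Coord n × Coord n) : Coord n →L[ℝ] ℝ :=
  fderiv ℝ (energy F φ) p ∘L ContinuousLinearMap.inr ℝ (Coord n) (Coord n)

theorem IsFinsler.contDiffOn_energy (hF : IsFinsler F) (hφ : IsCoordSystem φ) :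
    ContDiffOn ℝ ∞ (energy F φ) (slitDomain φ) :=
  (hF.contDiffOn hφ).pow 2

theorem IsFinsler.hasFDerivAt_energy (hF : IsFinsler F) (hφ : IsCoordSystem φ)
    {p : Coord n × Coord n} (hp : p ∈ slitDomain φ) :
    HasFDerivAt (energy F φ) (fderiv ℝ (energy F φ) p) p :=
  (((hF.contDiffOn_energy hφ).contDiffAt ((isOpen_slitDomain φ).mem_nhds hp)).differentiableAt
    (by simp)).hasFDerivAt

theorem IsFinsler.contDiffOn_vertDeriv (hF : IsFinsler F) (hφ : IsCoordSystem φ) :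
    ContDiffOn ℝ ∞ (vertDeriv F φ) (slitDomain φ) := by
  have h := (hF.contDiffOn_energy hφ).fderiv_of_isOpen (m := ∞) (isOpen_slitDomain φ) (by simp)
  exact h.clm_comp contDiffOn_const

theorem IsFinsler.hasFDerivAt_vertDeriv (hF : IsFinsler F) (hφ : IsCoordSystem φ)
    {p : Coord n × Coord n} (hp : p ∈ slitDomain φ) :
    HasFDerivAt (vertDeriv F φ) (fderiv ℝ (vertDeriv F φ) p) p :=
  (((hF.contDiffOn_vertDeriv hφ).contDiffAt ((isOpen_slitDomain φ).mem_nhds hp)).differentiableAt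
    (by simp)).hasFDerivAt

theorem IsFinsler.fderiv_sq (hF : IsFinsler F) (hφ : IsCoordSystem φ) {ξ η : Coord n}
    (hξ : ξ ∈ φ.target) (hη : η ≠ 0) :
    fderiv ℝ (fun y => inChart F φ ξ y ^ 2) η = vertDeriv F φ (ξ, η) :=
  ((hF.hasFDerivAt_energy hφ (p := (ξ, η)) ⟨hξ, hη⟩).comp η (hasFDerivAt_prodMk_right ξ η)).fderiv

theorem IsFinsler.fderiv_fderiv_sq (hF : IsFinsler F) (hφ : IsCoordSystem φ) {ξ η : Coord n}
    (hξ : ξ ∈ φ.target) (hη : η ≠ 0) (w : Coord n) :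
    fderiv ℝ (fderiv ℝ fun y => inChart F φ ξ y ^ 2) η w = fderiv ℝ (vertDeriv F φ) (ξ, η) (0, w) := by
  have h1 : (fderiv ℝ fun y => inChart F φ ξ y ^ 2) =ᶠ[𝓝 η] fun y => vertDeriv F φ (ξ, y) := by
    filter_upwards [isOpen_compl_singleton.mem_nhds hη] with y hy using hF.fderiv_sq hφ hξ hy
  rw [h1.fderiv_eq]
  have h2 := (hF.hasFDerivAt_vertDeriv hφ (p := (ξ, η)) ⟨hξ, hη⟩).comp η
    (hasFDerivAt_prodMk_right ξ η)
  exact congrArg (fun L : Coord n →L[ℝ] Coord n →L[ℝ] ℝ => L w) h2.fderiv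

theorem IsFinsler.fundamentalTensor_eq (hF : IsFinsler F) (hφ : IsCoordSystem φ) {ξ η : Coord n}
    (hξ : ξ ∈ φ.target) (hη : η ≠ 0) (i j : Fin n) :
    fundamentalTensor F φ ξ η i j = (1 / 2 : ℝ) * fderiv ℝ (vertDeriv F φ) (ξ, η)
      (0, EuclideanSpace.single i 1) (EuclideanSpace.single j 1) := by
  rw [fundamentalTensor, ← hF.fderiv_fderiv_sq hφ hξ hη]
  congr 1
  have hd : DifferentiableAt ℝ (fderiv ℝ fun y => inChart F φ ξ y ^ 2) η := by
    have h1 : (fderiv ℝ fun y => inChart F φ ξ y ^ 2) =ᶠ[𝓝 η] fun y => vertDeriv F φ (ξ, y) := by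
      filter_upwards [isOpen_compl_singleton.mem_nhds hη] with y hy using hF.fderiv_sq hφ hξ hy
    exact (((hF.hasFDerivAt_vertDeriv hφ (p := (ξ, η)) ⟨hξ, hη⟩).comp η
      (hasFDerivAt_prodMk_right ξ η)).congr_of_eventuallyEq h1).differentiableAt
  have h2 := hd.hasFDerivAt.clm_apply (hasFDerivAt_const (EuclideanSpace.single j (1 : ℝ)) η)
  rw [h2.fderiv]
  simp

theorem sum_single_eq (w : Coord n) : w = ∑ i, w i • EuclideanSpace.single i (1 : ℝ) := by
  have := (EuclideanSpace.basisFun (Fin n) ℝ).sum_repr w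
  simpa using this.symm

/-- The Minkowski norm of a Finsler structure at a point. -/
theorem IsFinsler.isMinkowski (hF : IsFinsler F) (hφ : IsCoordSystem φ) {ξ : Coord n}
    (hξ : ξ ∈ φ.target) : IsMinkowski (inChart F φ ξ) where
  nonneg y := hF.nonneg _
  smul_pos c y hc := hF.inChart_smul ξ c y hc
  contDiffOn := ((hF.contDiffOn hφ).comp (contDiffOn_const.prodMk contDiffOn_id)
    fun η hη => ⟨hξ, hη⟩).of_le (by norm_cast)
  posDef η hη w hw := by
    have h := (hF.posDef φ hφ ξ hξ η hη).dotProduct_mulVec_pos (x := fun i => w i)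
      (fun h => hw (by ext i; exact congrFun h i))
    rw [hF.fderiv_fderiv_sq hφ hξ hη]
    have hsum : fderiv ℝ (vertDeriv F φ) (ξ, η) (0, w) w = ∑ i, ∑ j, w i * w j *
        fderiv ℝ (vertDeriv F φ) (ξ, η) (0, EuclideanSpace.single i 1)
          (EuclideanSpace.single j 1) := by
      have hw' : ((0 : Coord n), w) = ∑ i, w i • ((0 : Coord n), EuclideanSpace.single i (1 : ℝ)) := by
        refine Prod.ext ?_ ?_
        · simp [Prod.fst_sum]
        · rw [Prod.snd_sum]; exact sum_single_eq w
      rw [hw', map_sum, sum_apply]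
      refine Finset.sum_congr rfl fun i _ => ?_
      rw [_root_.map_smul, smul_apply]
      have hexp := congrArg (fderiv ℝ (vertDeriv F φ) (ξ, η) (0, EuclideanSpace.single i 1))
        (sum_single_eq w)
      rw [hexp, map_sum, Finset.smul_sum]
      refine Finset.sum_congr rfl fun j _ => ?_
      rw [_root_.map_smul, smul_eq_mul, smul_eq_mul]
      ring
    have h2 : star (fun i => w i) ⬝ᵥ (fundamentalTensor F φ ξ η).mulVec (fun i => w i) =
        (1 / 2 : ℝ) * fderiv ℝ (vertDeriv F φ) (ξ, η) (0, w) w := by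
      rw [hsum]
      simp only [dotProduct, Matrix.mulVec, hF.fundamentalTensor_eq hφ hξ hη, Finset.mul_sum]
      refine Finset.sum_congr rfl fun i _ => Finset.sum_congr rfl fun j _ => ?_
      simp
      ring
    rw [h2] at h
    linarith

end FinslerChart

/-! ### Finsler structures are of Pontryagin type -/

section FinslerPontryagin

variable {n : ℕ} {M : Type*} [TopologicalSpace M] [ChartedSpace (Coord n) M]
  [IsManifold (𝓡 n) ∞ M] {φ : OpenPartialHomeomorph M (Coord n)}
  {F : TangentBundle (𝓡 n) M → ℝ}

theorem IsFinsler.continuousOn_inChart (hF : IsFinsler F) (hφ : IsCoordSystem φ) :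
    ContinuousOn (fun p : Coord n × Coord n => inChart F φ p.1 p.2) (φ.target ×ˢ univ) := by
  rintro ⟨ξ, η⟩ ⟨hξ, -⟩
  refine ContinuousAt.continuousWithinAt ?_
  rcases ne_or_eq η 0 with hη | rfl
  · exact (hF.contDiffOn hφ).continuousOn.continuousAt ((isOpen_slitDomain φ).mem_nhds ⟨hξ, hη⟩)
  -- near the zero section `F` is bounded by a multiple of the Euclidean norm
  obtain ⟨r, hr, hsub⟩ := Metric.nhds_basis_closedBall.mem_iff.1 (φ.open_target.mem_nhds hξ)
  obtain ⟨C, hC⟩ := ((isCompact_closedBall ξ r).prod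
    (isCompact_sphere (0 : Coord n) 1)).exists_bound_of_continuousOn
    ((hF.contDiffOn hφ).continuousOn.mono fun p hp => ⟨hsub hp.1, fun h => by
      have := hp.2
      rw [mem_singleton_iff.1 h] at this
      simp at this⟩)
  have h0 : inChart F φ ξ 0 = 0 := (hF.isMinkowski hφ hξ).map_zero
  rw [ContinuousAt]
  simp only [h0]
  have hlim : Tendsto (fun p : Coord n × Coord n => C * ‖p.2‖) (𝓝 (ξ, 0)) (𝓝 0) := by
    have : Continuous fun p : Coord n × Coord n => C * ‖p.2‖ := by fun_prop
    simpa using this.tendsto (ξ, 0)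
  refine squeeze_zero_norm' ?_ hlim
  have hball : ∀ᶠ p : Coord n × Coord n in 𝓝 (ξ, 0), p.1 ∈ Metric.closedBall ξ r :=
    continuous_fst.continuousAt.eventually (Metric.closedBall_mem_nhds ξ hr)
  filter_upwards [hball] with p hp
  rcases eq_or_ne p.2 0 with h | h
  · rw [h, (hF.isMinkowski hφ (hsub hp)).map_zero]; simp
  · have hpos : 0 < ‖p.2‖ := norm_pos_iff.2 h
    have h1 := hC (p.1, ‖p.2‖⁻¹ • p.2) ⟨hp, by simp [norm_smul, hpos.ne']⟩
    simp only at h1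
    rw [hF.inChart_smul _ _ _ (inv_pos.2 hpos), norm_mul, norm_inv, norm_norm,
      inv_mul_le_iff₀ hpos] at h1
    linarith

/-- Continuity at the zero section, where `F` is not smooth, comes from homogeneity. -/
theorem IsFinsler.continuous (hF : IsFinsler F) : Continuous F := by
  rw [continuous_iff_continuousAt]
  intro v
  set φ := chartAt (Coord n) v.1
  have hφ : IsCoordSystem φ := isCoordSystem_chartAt v.1
  have hv : v.1 ∈ φ.source := mem_chart_source _ _
  have hopen : IsOpen (Bundle.TotalSpace.proj ⁻¹' φ.source : Set (TangentBundle (𝓡 n) M)) :=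
    φ.open_source.preimage (FiberBundle.continuous_proj _ _)
  have h := (hF.continuousOn_inChart hφ).comp (continuousOn_tangentCoord hφ)
    fun w hw => ⟨φ.map_source hw, mem_univ _⟩
  exact (h.congr fun w hw => (inChart_tangentCoord F hφ hw).symm).continuousAt
    (hopen.mem_nhds hv)

theorem IsFinsler.isC0Finsler (hF : IsFinsler F) : IsC0Finsler F where
  continuous := hF.continuous
  asymmetricNorm x := by
    set φ := chartAt (Coord n) x
    have hφ : IsCoordSystem φ := isCoordSystem_chartAt x
    have hx : x ∈ φ.source := mem_chart_source _ _
    have h := (hF.isMinkowski hφ (φ.map_source hx)).isAsymmetricNorm.comp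
      (mfderiv (𝓡 n) 𝓘(ℝ, Coord n) φ x) (hφ.mdifferentiable.mfderiv_injective hx)
    have hfun : (fun y : TangentSpace (𝓡 n) x => F ⟨x, y⟩) = fun y =>
        inChart F φ (φ x) (mfderiv (𝓡 n) 𝓘(ℝ, Coord n) φ x y : Coord n) :=
      funext fun y => (inChart_tangentCoord F hφ (v := ⟨x, y⟩) hx).symm
    rw [hfun]
    exact h

/-- The radial projection of the Euclidean sphere onto the unit spheres of `F`. -/
def radialField (F : TangentBundle (𝓡 n) M → ℝ) (φ : OpenPartialHomeomorph M (Coord n))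
    (p : Coord n × Coord n) : Coord n := (inChart F φ p.1 p.2)⁻¹ • p.2

theorem IsFinsler.contDiffOn_radialField (hF : IsFinsler F) (hφ : IsCoordSystem φ) :
    ContDiffOn ℝ ∞ (radialField F φ) (slitDomain φ) :=
  ((hF.contDiffOn hφ).inv fun _ hp => ((hF.isMinkowski hφ hp.1).pos hp.2).ne').smul contDiffOn_snd

theorem sphere_ne_zero (u : Metric.sphere (0 : Coord n) 1) : (u : Coord n) ≠ 0 := by
  intro h
  have := u.2
  rw [h] at this
  simp at this

/-- Radial projection of the Euclidean sphere is a control family on the whole coordinate domain. -/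
theorem IsFinsler.isControlFamily (hF : IsFinsler F) (hφ : IsCoordSystem φ) :
    IsControlFamily F φ φ.target fun u ξ => radialField F φ (ξ, u) where
  isOpen := φ.open_target
  subset_target := le_rfl
  contDiffOn u := ((hF.contDiffOn_radialField hφ).comp (contDiffOn_id.prodMk contDiffOn_const)
    fun ξ hξ => ⟨hξ, sphere_ne_zero u⟩).of_le (by norm_cast)
  continuousOn := (hF.contDiffOn_radialField hφ).continuousOn.comp
    (f := fun p : Coord n × Metric.sphere (0 : Coord n) 1 => (p.1, (p.2 : Coord n)))
    (by fun_prop) fun p hp => ⟨hp.1, sphere_ne_zero p.2⟩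
  continuousOn_fderiv := by
    have h1 : ContinuousOn (fderiv ℝ (radialField F φ)) (slitDomain φ) :=
      (hF.contDiffOn_radialField hφ).continuousOn_fderiv_of_isOpen (isOpen_slitDomain φ) (by simp)
    have h2 := h1.comp
      (f := fun p : Coord n × Metric.sphere (0 : Coord n) 1 => (p.1, (p.2 : Coord n)))
      (s := φ.target ×ˢ univ) (by fun_prop) fun p hp => ⟨hp.1, sphere_ne_zero p.2⟩
    refine (h2.clm_comp (continuousOn_const (c := ContinuousLinearMap.inl ℝ (Coord n)
      (Coord n)))).congr fun p hp => ?_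
    have hd := (((hF.contDiffOn_radialField hφ).contDiffAt ((isOpen_slitDomain φ).mem_nhds
      (show (p.1, (p.2 : Coord n)) ∈ slitDomain φ from ⟨hp.1, sphere_ne_zero p.2⟩))).differentiableAt
      (by simp)).hasFDerivAt
    exact (HasFDerivAt.comp (f := fun ζ : Coord n => (ζ, (p.2 : Coord n))) p.1 hd
      (hasFDerivAt_prodMk_left p.1 (p.2 : Coord n))).fderiv
  homeo ξ hξ := by
    have hN := hF.isMinkowski hφ hξ
    have hne : ∀ η : {η : Coord n // inChart F φ ξ η = 1}, (η : Coord n) ≠ 0 := fun η h => by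
      have := η.2
      rw [h, hN.map_zero] at this
      exact zero_ne_one this
    refine ⟨{ toFun := fun u => ⟨radialField F φ (ξ, u), ?_⟩
              invFun := fun η => ⟨‖(η : Coord n)‖⁻¹ • (η : Coord n), ?_⟩
              left_inv := fun u => ?_
              right_inv := fun η => ?_
              continuous_toFun := ?_
              continuous_invFun := ?_ }, fun u => rfl⟩
    · have := hN.pos (sphere_ne_zero u)
      change inChart F φ ξ ((inChart F φ ξ u)⁻¹ • (u : Coord n)) = 1
      rw [hN.smul_pos _ _ (inv_pos.2 this), inv_mul_cancel₀ this.ne']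
    · simp [norm_smul, hne η]
    · have hpos := hN.pos (sphere_ne_zero u)
      have hu : ‖(u : Coord n)‖ = 1 := by simp
      ext1
      change ‖(inChart F φ ξ u)⁻¹ • (u : Coord n)‖⁻¹ • (inChart F φ ξ u)⁻¹ • (u : Coord n) = u
      rw [norm_smul, hu, norm_inv, Real.norm_of_nonneg hpos.le, mul_one, inv_inv, smul_smul,
        mul_inv_cancel₀ hpos.ne', one_smul]
    · have hpos : 0 < ‖(η : Coord n)‖ := norm_pos_iff.2 (hne η)
      ext1
      change (inChart F φ ξ (‖(η : Coord n)‖⁻¹ • (η : Coord n)))⁻¹ • ‖(η : Coord n)‖⁻¹ •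
        (η : Coord n) = η
      rw [hN.smul_pos _ _ (inv_pos.2 hpos), η.2, mul_one, inv_inv, smul_smul,
        mul_inv_cancel₀ hpos.ne', one_smul]
    · refine Continuous.subtype_mk ?_ _
      exact (hF.contDiffOn_radialField hφ).continuousOn.comp_continuous
        (f := fun u : Metric.sphere (0 : Coord n) 1 => (ξ, (u : Coord n))) (by fun_prop)
        fun u => ⟨hξ, sphere_ne_zero u⟩
    · refine Continuous.subtype_mk ?_ _
      exact (continuous_subtype_val.norm.inv₀ fun η => (norm_pos_iff.2 (hne η)).ne').smul
        continuous_subtype_val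

theorem IsFinsler.isPontryaginType (hF : IsFinsler F) : IsPontryaginType F where
  toIsC0Finsler := hF.isC0Finsler
  exists_family p := ⟨chartAt (Coord n) p, isCoordSystem_chartAt p, mem_chart_source _ _, _, _,
    (chartAt (Coord n) p).map_source (mem_chart_source _ _),
    hF.isControlFamily (isCoordSystem_chartAt p)⟩

/-- The derivative of a control family of a Finsler structure, paired with the Legendre transform of
the control, from the differentiation of `F(x, f_u(x)) = 1`. -/
theorem IsFinsler.legendreMap_comp_fderiv (hF : IsFinsler F) (hφ : IsCoordSystem φ)
    {Ω : Set (Coord n)} {f : Metric.sphere (0 : Coord n) 1 → Coord n → Coord n}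
    (hf : IsControlFamily F φ Ω f) {ξ : Coord n} (hξ : ξ ∈ Ω)
    (u : Metric.sphere (0 : Coord n) 1) :
    legendreMap (inChart F φ ξ) (f u ξ) ∘L fderiv ℝ (f u) ξ = -((1 / 2 : ℝ) •
      (fderiv ℝ (energy F φ) (ξ, f u ξ) ∘L ContinuousLinearMap.inl ℝ (Coord n) (Coord n))) := by
  have hξ' := hf.subset_target hξ
  have hN := hF.isMinkowski hφ hξ'
  have hne : f u ξ ≠ 0 := fun h => by
    have := hf.unit hξ u
    rw [h, hN.map_zero] at this
    exact zero_ne_one this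
  have h1 : HasFDerivAt (fun ζ => (ζ, f u ζ))
      ((ContinuousLinearMap.id ℝ (Coord n)).prod (fderiv ℝ (f u) ξ)) ξ :=
    (hasFDerivAt_id ξ).prodMk (hf.differentiableAt u hξ).hasFDerivAt
  have h2 := (hF.hasFDerivAt_energy hφ (p := (ξ, f u ξ)) ⟨hξ', hne⟩).comp ξ h1
  have h3 : HasFDerivAt (energy F φ ∘ fun ζ => (ζ, f u ζ)) (0 : Coord n →L[ℝ] ℝ) ξ := by
    refine (hasFDerivAt_const (1 : ℝ) ξ).congr_of_eventuallyEq ?_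
    filter_upwards [hf.isOpen.mem_nhds hξ] with ζ hζ
    simp [energy, hf.unit hζ u]
  have h4 := h2.unique h3
  rw [legendreMap, hF.fderiv_sq hφ hξ' hne]
  ext w
  have h5 := congrArg (fun L : Coord n →L[ℝ] ℝ => L w) h4
  simp only [ContinuousLinearMap.comp_apply, ContinuousLinearMap.prod_apply,
    ContinuousLinearMap.id_apply, zero_apply] at h5
  have h6 : (w, fderiv ℝ (f u) ξ w) = ((w, 0) : Coord n × Coord n) + (0, fderiv ℝ (f u) ξ w) := by
    simp
  rw [h6, _root_.map_add] at h5
  simp only [vertDeriv, ContinuousLinearMap.comp_apply, smul_apply,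
    neg_apply, ContinuousLinearMap.inl_apply, ContinuousLinearMap.inr_apply,
    smul_eq_mul]
  linarith

/-- The horizontal derivative of `F²` is homogeneous of degree two. -/
theorem IsFinsler.fderiv_energy_smul (hF : IsFinsler F) (hφ : IsCoordSystem φ) {ξ η : Coord n}
    (hξ : ξ ∈ φ.target) (hη : η ≠ 0) {c : ℝ} (hc : 0 < c) (w : Coord n) :
    fderiv ℝ (energy F φ) (ξ, c • η) (w, 0) = c ^ 2 * fderiv ℝ (energy F φ) (ξ, η) (w, 0) := by
  have h1 := HasFDerivAt.comp (f := fun ζ : Coord n => (ζ, c • η)) ξ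
    (hF.hasFDerivAt_energy hφ (p := (ξ, c • η)) ⟨hξ, smul_ne_zero hc.ne' hη⟩)
    (hasFDerivAt_prodMk_left ξ (c • η))
  have h2 := (HasFDerivAt.comp (f := fun ζ : Coord n => (ζ, η)) ξ
    (hF.hasFDerivAt_energy hφ (p := (ξ, η)) ⟨hξ, hη⟩)
    (hasFDerivAt_prodMk_left ξ η)).const_mul (c ^ 2)
  have h3 := h1.unique (h2.congr_of_eventuallyEq (Eventually.of_forall fun ζ => by
    simp only [Function.comp, energy, hF.inChart_smul _ _ _ hc]; ring))
  have h4 := congrArg (fun L : Coord n →L[ℝ] ℝ => L w) h3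
  simpa using h4

/-- At the Legendre transform of `η`, the extended geodesic field of a Finsler structure is the single
vector `F(η)⁻¹ (η, ½ ∂F²/∂x)`. -/
theorem IsFinsler.extendedField_eq (hF : IsFinsler F) (hφ : IsCoordSystem φ) {ξ η : Coord n}
    (hξ : ξ ∈ φ.target) (hη : η ≠ 0) :
    extendedField F φ (ξ, legendreMap (inChart F φ ξ) η) = {(inChart F φ ξ η)⁻¹ •
      (η, (1 / 2 : ℝ) •
        (fderiv ℝ (energy F φ) (ξ, η) ∘L ContinuousLinearMap.inl ℝ (Coord n) (Coord n)))} := by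
  have hN := hF.isMinkowski hφ hξ
  set N := inChart F φ ξ with hNdef
  set a := legendreMap N η with ha
  have hp := hN.pos hη
  set w := (N η)⁻¹ • η with hw
  have hNw : N w = 1 := by rw [hw, hN.smul_pos _ _ (inv_pos.2 hp), inv_mul_cancel₀ hp.ne']
  have haw : a w = N η := by
    rw [hw, _root_.map_smul, hN.legendreMap_self hη, smul_eq_mul]; field_simp
  have hmax : ∀ y, N y = 1 → a y ≤ a w := fun y hy => by
    have := hN.legendreMap_le hη y
    rwa [hy, mul_one, ← haw] at this
  have hapos : 0 < a w := by rw [haw]; exact hp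
  have hηw : η = N η • w := by rw [hw, smul_smul, mul_inv_cancel₀ hp.ne', one_smul]
  have hw0 : w ≠ 0 := smul_ne_zero (inv_ne_zero hp.ne') hη
  have hmem : ∀ V, V ∈ extendedField F φ (ξ, a) → V = (N η)⁻¹ • (η, (1 / 2 : ℝ) •
      (fderiv ℝ (energy F φ) (ξ, η) ∘L ContinuousLinearMap.inl ℝ (Coord n) (Coord n))) := by
    rintro V ⟨_, Ω, f, hf, hξΩ, u, hu, rfl⟩
    have hfu : f u ξ = w := by
      refine hN.eq_of_maximizer hNw hapos hmax (hf.unit hξΩ u) (le_antisymm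
        (hmax _ (hf.unit hξΩ u)) ?_)
      obtain ⟨v, hv⟩ := hf.exists_eq hξΩ hNw
      rw [← hv]
      exact hu v
    refine Prod.ext hfu ?_
    have h1 := hF.legendreMap_comp_fderiv hφ hf hξΩ u
    have h2 : a = N η • legendreMap N w := by
      have := hN.eq_smul_legendreMap hNw hmax
      rwa [haw] at this
    change -(a ∘L fderiv ℝ (f u) ξ) = _
    rw [hfu] at h1
    ext z
    have h3 := congrArg (fun L : Coord n →L[ℝ] ℝ => L z) h1
    have h4 := hF.fderiv_energy_smul hφ hξ hw0 hp z
    rw [← hηw] at h4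
    simp only [ContinuousLinearMap.comp_apply, neg_apply,
      smul_apply, ContinuousLinearMap.inl_apply, smul_eq_mul] at h3
    simp only [h2, Prod.smul_snd, ContinuousLinearMap.comp_apply, neg_apply,
      smul_apply, ContinuousLinearMap.inl_apply, smul_eq_mul, h4]
    change -(N η * legendreMap N w (fderiv ℝ (f u) ξ z)) = _
    rw [h3]
    field_simp
  refine Subset.antisymm (fun V hV => hmem V hV) ?_
  rintro _ rfl
  have hf := hF.isControlFamily hφ
  have hne : Nonempty (Metric.sphere (0 : Coord n) 1) := by
    obtain ⟨u, _⟩ := hf.exists_eq hξ hNw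
    exact ⟨u⟩
  obtain ⟨u, hu⟩ := hf.exists_maximizer hξ a
  have hV : hamiltonianField (fun ζ => radialField F φ (ζ, u)) (ξ, a) ∈ extendedField F φ (ξ, a) :=
    ⟨hN.legendreMap_ne_zero hη, _, _, hf, hξ, u, hu, rfl⟩
  rw [← hmem _ hV]
  exact hV

end FinslerPontryagin

/-! ### The geodesic spray -/

section Spray

variable {n : ℕ} {M : Type*} [TopologicalSpace M] [ChartedSpace (Coord n) M]
  [IsManifold (𝓡 n) ∞ M] {φ : OpenPartialHomeomorph M (Coord n)}
  {F : TangentBundle (𝓡 n) M → ℝ} {ξ η : Coord n}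

theorem IsFinsler.fundamentalTensor_symm (hF : IsFinsler F) (hφ : IsCoordSystem φ)
    (hξ : ξ ∈ φ.target) (hη : η ≠ 0) (i j : Fin n) :
    fundamentalTensor F φ ξ η i j = fundamentalTensor F φ ξ η j i := by
  have h := (hF.posDef φ hφ ξ hξ η hη).isHermitian.apply j i
  simpa using h

theorem apply_snd_eq_sum {G : Type*} [NormedAddCommGroup G] [NormedSpace ℝ G]
    (L : Coord n × Coord n →L[ℝ] G) (w : Coord n) :
    L (0, w) = ∑ i, w i • L (0, EuclideanSpace.single i 1) := by
  have h := congrArg (L ∘L ContinuousLinearMap.inr ℝ (Coord n) (Coord n)) (sum_single_eq w)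
  rw [map_sum] at h
  simpa only [_root_.map_smul, ContinuousLinearMap.comp_apply, ContinuousLinearMap.inr_apply] using h

theorem apply_fst_eq_sum {G : Type*} [NormedAddCommGroup G] [NormedSpace ℝ G]
    (L : Coord n × Coord n →L[ℝ] G) (w : Coord n) :
    L (w, 0) = ∑ i, w i • L (EuclideanSpace.single i 1, 0) := by
  have h := congrArg (L ∘L ContinuousLinearMap.inl ℝ (Coord n) (Coord n)) (sum_single_eq w)
  rw [map_sum] at h
  simpa only [_root_.map_smul, ContinuousLinearMap.comp_apply, ContinuousLinearMap.inl_apply] using h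

theorem clm_ext_single {L L' : Coord n →L[ℝ] ℝ}
    (h : ∀ i, L (EuclideanSpace.single i 1) = L' (EuclideanSpace.single i 1)) : L = L' := by
  ext w
  rw [sum_single_eq w, map_sum, map_sum]
  simp only [_root_.map_smul, h]

/-- Lowering the index of an arbitrary vector. -/
theorem IsFinsler.sum_fundamentalTensor_mul (hF : IsFinsler F) (hφ : IsCoordSystem φ)
    (hξ : ξ ∈ φ.target) (hη : η ≠ 0) (z : Coord n) (m : Fin n) :
    ∑ j, fundamentalTensor F φ ξ η m j * z j =
      (1 / 2 : ℝ) * fderiv ℝ (vertDeriv F φ) (ξ, η) (0, z) (EuclideanSpace.single m 1) := by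
  rw [apply_snd_eq_sum, sum_apply, Finset.mul_sum]
  refine Finset.sum_congr rfl fun j _ => ?_
  rw [hF.fundamentalTensor_symm hφ hξ hη, hF.fundamentalTensor_eq hφ hξ hη,
    smul_apply, smul_eq_mul]
  ring

theorem IsFinsler.fderiv_vertDeriv_self (hF : IsFinsler F) (hφ : IsCoordSystem φ)
    (hξ : ξ ∈ φ.target) (hη : η ≠ 0) :
    fderiv ℝ (vertDeriv F φ) (ξ, η) (0, η) = vertDeriv F φ (ξ, η) := by
  rw [← hF.fderiv_fderiv_sq hφ hξ hη, (hF.isMinkowski hφ hξ).fderiv_fderiv_sq_self hη,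
    hF.fderiv_sq hφ hξ hη]

theorem IsFinsler.sum_fundamentalTensor_self (hF : IsFinsler F) (hφ : IsCoordSystem φ)
    (hξ : ξ ∈ φ.target) (hη : η ≠ 0) (m : Fin n) :
    ∑ j, fundamentalTensor F φ ξ η m j * η j =
      (1 / 2 : ℝ) * vertDeriv F φ (ξ, η) (EuclideanSpace.single m 1) := by
  rw [hF.sum_fundamentalTensor_mul hφ hξ hη, hF.fderiv_vertDeriv_self hφ hξ hη]

theorem IsFinsler.sum_sum_fundamentalTensor_self (hF : IsFinsler F) (hφ : IsCoordSystem φ)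
    (hξ : ξ ∈ φ.target) (hη : η ≠ 0) :
    ∑ i, ∑ j, fundamentalTensor F φ ξ η i j * η i * η j = energy F φ (ξ, η) := by
  have h1 : ∀ i, ∑ j, fundamentalTensor F φ ξ η i j * η i * η j =
      η i * ((1 / 2 : ℝ) * vertDeriv F φ (ξ, η) (EuclideanSpace.single i 1)) := fun i => by
    rw [← hF.sum_fundamentalTensor_self hφ hξ hη, Finset.mul_sum]
    exact Finset.sum_congr rfl fun j _ => by ring
  have h2 : vertDeriv F φ (ξ, η) η = 2 * energy F φ (ξ, η) := by
    rw [← hF.fderiv_sq hφ hξ hη, (hF.isMinkowski hφ hξ).fderiv_sq_self hη, energy]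
  have h3 := congrArg (vertDeriv F φ (ξ, η)) (sum_single_eq η)
  rw [h2, map_sum] at h3
  simp only [_root_.map_smul, smul_eq_mul] at h3
  simp only [h1]
  have h4 : ∀ i, η i * ((1 / 2 : ℝ) * vertDeriv F φ (ξ, η) (EuclideanSpace.single i 1)) =
      (1 / 2 : ℝ) * (η i * vertDeriv F φ (ξ, η) (EuclideanSpace.single i 1)) := fun i => by ring
  simp only [h4]
  rw [← Finset.mul_sum, ← h3]
  ring

theorem IsFinsler.legendre_eq (hF : IsFinsler F) (hφ : IsCoordSystem φ)
    (hξ : ξ ∈ φ.target) (hη : η ≠ 0) :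
    legendre F φ (ξ, η) = (ξ, (1 / 2 : ℝ) • vertDeriv F φ (ξ, η)) := by
  refine Prod.ext rfl (clm_ext_single fun m => ?_)
  simp only [legendre, sum_apply, smul_apply, smul_eq_mul]
  rw [← hF.sum_fundamentalTensor_self hφ hξ hη, Finset.sum_eq_single m]
  · simp
  · intro i _ hi
    simp [hi]
  · simp

/-- The Legendre transform of a Finsler structure is, in each fibre, the Legendre map of its Minkowski norm. -/
theorem IsFinsler.legendre_eq_legendreMap (hF : IsFinsler F) (hφ : IsCoordSystem φ)
    (hξ : ξ ∈ φ.target) (hη : η ≠ 0) :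
    legendre F φ (ξ, η) = (ξ, legendreMap (inChart F φ ξ) η) := by
  rw [hF.legendre_eq hφ hξ hη, legendreMap, hF.fderiv_sq hφ hξ hη]

theorem IsFinsler.hasFDerivAt_fundamentalTensor (hF : IsFinsler F) (hφ : IsCoordSystem φ)
    (hξ : ξ ∈ φ.target) (hη : η ≠ 0) (i j : Fin n) :
    HasFDerivAt (fun ξ' => fundamentalTensor F φ ξ' η i j)
      (fderiv ℝ (fun ξ' => fundamentalTensor F φ ξ' η i j) ξ) ξ := by
  have h1 : ContDiffOn ℝ ∞ (fun p => (1 / 2 : ℝ) * fderiv ℝ (vertDeriv F φ) p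
      (0, EuclideanSpace.single i 1) (EuclideanSpace.single j 1)) (slitDomain φ) := by
    have := (hF.contDiffOn_vertDeriv hφ).fderiv_of_isOpen (m := ∞) (isOpen_slitDomain φ) (by simp)
    exact contDiffOn_const.mul ((this.clm_apply contDiffOn_const).clm_apply contDiffOn_const)
  have h2 : DifferentiableAt ℝ (fun ξ' : Coord n => (1 / 2 : ℝ) * fderiv ℝ (vertDeriv F φ) (ξ', η)
      (0, EuclideanSpace.single i 1) (EuclideanSpace.single j 1)) ξ :=
    ((h1.comp (contDiffOn_id.prodMk contDiffOn_const) (s := φ.target)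
      fun ξ' hξ' => ⟨hξ', hη⟩).contDiffAt (φ.open_target.mem_nhds hξ)).differentiableAt (by simp)
  refine (h2.congr_of_eventuallyEq ?_).hasFDerivAt
  filter_upwards [φ.open_target.mem_nhds hξ] with ξ' hξ' using
    hF.fundamentalTensor_eq hφ hξ' hη i j

/-- The derivative in `x` of `g_{mj}(x, η) η^j = ½ ∂F²/∂y^m`. -/
theorem IsFinsler.sum_tensorDeriv_mul (hF : IsFinsler F) (hφ : IsCoordSystem φ)
    (hξ : ξ ∈ φ.target) (hη : η ≠ 0) (m k : Fin n) :
    ∑ j, tensorDeriv F φ ξ η m j k * η j = (1 / 2 : ℝ) * fderiv ℝ (vertDeriv F φ) (ξ, η)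
      (EuclideanSpace.single k 1, 0) (EuclideanSpace.single m 1) := by
  have h1 := HasFDerivAt.fun_sum (u := Finset.univ) fun j _ =>
    (hF.hasFDerivAt_fundamentalTensor hφ hξ hη m j).mul_const (η j)
  have h2 := HasFDerivAt.comp (f := fun ζ : Coord n => (ζ, η)) ξ
    (hF.hasFDerivAt_vertDeriv hφ (p := (ξ, η)) ⟨hξ, hη⟩) (hasFDerivAt_prodMk_left ξ η)
  have h3 := (h2.clm_apply (hasFDerivAt_const (EuclideanSpace.single m (1 : ℝ)) ξ)).const_mul
    (1 / 2 : ℝ)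
  have h4 := h1.unique (h3.congr_of_eventuallyEq (by
    filter_upwards [φ.open_target.mem_nhds hξ] with ξ' hξ' using
      hF.sum_fundamentalTensor_self hφ hξ' hη m))
  have h5 := congrArg (fun L : Coord n →L[ℝ] ℝ => L (EuclideanSpace.single k 1)) h4
  simp only [sum_apply, smul_apply, smul_eq_mul] at h5
  simp only [tensorDeriv]
  rw [Finset.sum_congr rfl fun j _ => mul_comm _ (η j), h5]
  simp

/-- The derivative in `x` of `g_{ij}(x, η) η^i η^j = F²`. -/
theorem IsFinsler.sum_sum_tensorDeriv_mul (hF : IsFinsler F) (hφ : IsCoordSystem φ)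
    (hξ : ξ ∈ φ.target) (hη : η ≠ 0) (k : Fin n) :
    ∑ i, ∑ j, tensorDeriv F φ ξ η i j k * η i * η j =
      fderiv ℝ (energy F φ) (ξ, η) (EuclideanSpace.single k 1, 0) := by
  have h1 := HasFDerivAt.fun_sum (u := Finset.univ) fun i _ =>
    HasFDerivAt.fun_sum (u := Finset.univ) fun j _ =>
    ((hF.hasFDerivAt_fundamentalTensor hφ hξ hη i j).mul_const (η i)).mul_const (η j)
  have h2 := HasFDerivAt.comp (f := fun ζ : Coord n => (ζ, η)) ξ
    (hF.hasFDerivAt_energy hφ (p := (ξ, η)) ⟨hξ, hη⟩) (hasFDerivAt_prodMk_left ξ η)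
  have h4 := h1.unique (h2.congr_of_eventuallyEq (by
    filter_upwards [φ.open_target.mem_nhds hξ] with ξ' hξ' using
      hF.sum_sum_fundamentalTensor_self hφ hξ' hη))
  have h5 := congrArg (fun L : Coord n →L[ℝ] ℝ => L (EuclideanSpace.single k 1)) h4
  simp only [sum_apply, smul_apply, smul_eq_mul] at h5
  simp only [tensorDeriv]
  refine Eq.trans (Finset.sum_congr rfl fun i _ => Finset.sum_congr rfl fun j _ => ?_) (h5.trans ?_)
  · ring
  · simp

/-- Lowering the index of the vertical component of the geodesic spray. -/
theorem IsFinsler.fderiv_vertDeriv_geodesicSpray (hF : IsFinsler F) (hφ : IsCoordSystem φ)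
    (hξ : ξ ∈ φ.target) (hη : η ≠ 0) :
    fderiv ℝ (vertDeriv F φ) (ξ, η) (0, (geodesicSpray F φ (ξ, η)).2) =
      fderiv ℝ (energy F φ) (ξ, η) ∘L ContinuousLinearMap.inl ℝ (Coord n) (Coord n) -
        fderiv ℝ (vertDeriv F φ) (ξ, η) (η, 0) := by
  refine clm_ext_single fun m => ?_
  set g := fundamentalTensor F φ ξ η with hg
  set T := tensorDeriv F φ ξ η with hT
  set c : Fin n → ℝ := fun s =>
    (1 / 2 : ℝ) * ∑ j, ∑ k, (T s j k + T s k j - T j k s) * η j * η k with hc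
  have hz : ∀ i, (geodesicSpray F φ (ξ, η)).2 i = -(g⁻¹.mulVec c) i := by
    intro i
    change -∑ j, ∑ k, christoffel F φ ξ η i j k * η j * η k = _
    congr 1
    simp only [christoffel, Matrix.mulVec, dotProduct, hc, Finset.mul_sum, Finset.sum_mul]
    rw [Finset.sum_congr rfl fun j _ => Finset.sum_comm, Finset.sum_comm]
    refine Finset.sum_congr rfl fun s _ => Finset.sum_congr rfl fun j _ =>
      Finset.sum_congr rfl fun k _ => ?_
    ring
  have hunit : IsUnit g.det := (hF.posDef φ hφ ξ hξ η hη).det_pos.ne'.isUnit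
  have hgz : ∑ j, g m j * (geodesicSpray F φ (ξ, η)).2 j = -c m := by
    have h1 : g.mulVec (g⁻¹.mulVec c) = c := by
      rw [Matrix.mulVec_mulVec, Matrix.mul_nonsing_inv _ hunit, Matrix.one_mulVec]
    have h2 := congrFun h1 m
    simp only [hz, mul_neg, Finset.sum_neg_distrib]
    exact congrArg Neg.neg h2
  have hD : ∑ k, η k * ∑ j, T m j k * η j = (1 / 2 : ℝ) *
      fderiv ℝ (vertDeriv F φ) (ξ, η) (η, 0) (EuclideanSpace.single m 1) := by
    rw [apply_fst_eq_sum _ η, sum_apply, Finset.mul_sum]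
    refine Finset.sum_congr rfl fun k _ => ?_
    rw [hF.sum_tensorDeriv_mul hφ hξ hη, smul_apply, smul_eq_mul]
    ring
  have hcm : c m = (1 / 2 : ℝ) * (fderiv ℝ (vertDeriv F φ) (ξ, η) (η, 0)
      (EuclideanSpace.single m 1) -
        fderiv ℝ (energy F φ) (ξ, η) (EuclideanSpace.single m 1, 0)) := by
    have e1 : ∑ j, ∑ k, T m j k * η j * η k = ∑ k, η k * ∑ j, T m j k * η j := by
      rw [Finset.sum_comm]
      refine Finset.sum_congr rfl fun k _ => ?_
      rw [Finset.mul_sum]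
      exact Finset.sum_congr rfl fun j _ => by ring
    have e2 : ∑ j, ∑ k, T m k j * η j * η k = ∑ k, η k * ∑ j, T m j k * η j := by
      refine Finset.sum_congr rfl fun k _ => ?_
      rw [Finset.mul_sum]
      exact Finset.sum_congr rfl fun j _ => by ring
    rw [hc]
    simp only [sub_mul, add_mul, Finset.sum_add_distrib, Finset.sum_sub_distrib]
    rw [e1, e2, hD, hF.sum_sum_tensorDeriv_mul hφ hξ hη]
    ring
  have h := hF.sum_fundamentalTensor_mul hφ hξ hη (geodesicSpray F φ (ξ, η)).2 m
  rw [hgz, hcm] at h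
  simp only [sub_apply, ContinuousLinearMap.comp_apply,
    ContinuousLinearMap.inl_apply]
  linarith

/-- The push-forward of the geodesic spray by the Legendre transform is `(η, ½ ∂F²/∂x)`. -/
theorem IsFinsler.fderiv_legendre_geodesicSpray (hF : IsFinsler F) (hφ : IsCoordSystem φ)
    (hξ : ξ ∈ φ.target) (hη : η ≠ 0) :
    fderiv ℝ (legendre F φ) (ξ, η) (geodesicSpray F φ (ξ, η)) = (η, (1 / 2 : ℝ) •
      (fderiv ℝ (energy F φ) (ξ, η) ∘L ContinuousLinearMap.inl ℝ (Coord n) (Coord n))) := by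
  have h1 : legendre F φ =ᶠ[𝓝 (ξ, η)] fun p => (p.1, (1 / 2 : ℝ) • vertDeriv F φ p) := by
    filter_upwards [(isOpen_slitDomain φ).mem_nhds (show (ξ, η) ∈ slitDomain φ from ⟨hξ, hη⟩)]
      with p hp using hF.legendre_eq hφ hp.1 hp.2
  have h2 : HasFDerivAt (fun p : Coord n × Coord n => (p.1, (1 / 2 : ℝ) • vertDeriv F φ p)) _ (ξ, η) :=
    hasFDerivAt_fst.prodMk
      ((hF.hasFDerivAt_vertDeriv hφ (p := (ξ, η)) ⟨hξ, hη⟩).const_smul (1 / 2 : ℝ))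
  rw [h1.fderiv_eq, h2.fderiv]
  refine Prod.ext rfl ?_
  change (1 / 2 : ℝ) • fderiv ℝ (vertDeriv F φ) (ξ, η) (geodesicSpray F φ (ξ, η)) = _
  have h3 : geodesicSpray F φ (ξ, η) = (η, 0) + (0, (geodesicSpray F φ (ξ, η)).2) := by
    rw [Prod.mk_add_mk, add_zero, zero_add]; rfl
  rw [h3, _root_.map_add, hF.fderiv_vertDeriv_geodesicSpray hφ hξ hη, add_sub_cancel]

theorem IsFinsler.bijOn_legendre (hF : IsFinsler F) (hφ : IsCoordSystem φ) (hξ : ξ ∈ φ.target) :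
    BijOn (fun η => (legendre F φ (ξ, η)).2) {η | η ≠ 0} {a | a ≠ 0} :=
  (hF.isMinkowski hφ hξ).bijOn_legendreMap.congr fun η hη => by
    simp only [hF.legendre_eq_legendreMap hφ hξ hη]

/-- The push-forward of the geodesic spray is single-valued, since the Legendre transform is injective. -/
theorem IsFinsler.cotangentSpray_eq (hF : IsFinsler F) (hφ : IsCoordSystem φ)
    (hξ : ξ ∈ φ.target) (hη : η ≠ 0) :
    cotangentSpray F φ (ξ, legendreMap (inChart F φ ξ) η) = {(η, (1 / 2 : ℝ) •
      (fderiv ℝ (energy F φ) (ξ, η) ∘L ContinuousLinearMap.inl ℝ (Coord n) (Coord n)))} := by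
  rw [← hF.fderiv_legendre_geodesicSpray hφ hξ hη, ← hF.legendre_eq_legendreMap hφ hξ hη]
  refine Subset.antisymm ?_ ?_
  · rintro _ ⟨⟨ξ', η'⟩, hη', heq, rfl⟩
    obtain rfl : ξ' = ξ := congrArg Prod.fst heq
    obtain rfl : η' = η := (hF.bijOn_legendre hφ hξ).injOn hη' hη (congrArg Prod.snd heq)
    rfl
  · rintro _ rfl
    exact ⟨(ξ, η), hη, rfl, rfl⟩

/-- On the slit cotangent bundle of a Finsler structure, the extended geodesic field is single-valued
and its multiple by the dual norm is the geodesic spray. -/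
theorem IsFinsler.exists_extendedField_eq (hF : IsFinsler F) (hφ : IsCoordSystem φ)
    (hξ : ξ ∈ φ.target) {a : Coord n →L[ℝ] ℝ} (ha : a ≠ 0) :
    ∃ V : CotCoord n, extendedField F φ (ξ, a) = {V} ∧
      cotangentSpray F φ (ξ, a) = {dualNorm (inChart F φ ξ) a • V} ∧
      cotangentSpray F φ (ξ, a) = scaledField F φ (ξ, a) := by
  have hN := hF.isMinkowski hφ hξ
  obtain ⟨η, hη, rfl⟩ := hN.bijOn_legendreMap.surjOn ha
  have h1 := hF.extendedField_eq hφ hξ hη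
  have h2 : cotangentSpray F φ (ξ, legendreMap (inChart F φ ξ) η) =
      {dualNorm (inChart F φ ξ) (legendreMap (inChart F φ ξ) η) • ((inChart F φ ξ η)⁻¹ •
        (η, (1 / 2 : ℝ) • (fderiv ℝ (energy F φ) (ξ, η) ∘L
          ContinuousLinearMap.inl ℝ (Coord n) (Coord n))))} := by
    rw [hF.cotangentSpray_eq hφ hξ hη, hN.dualNorm_legendreMap hη,
      smul_inv_smul₀ (hN.pos hη).ne']
  exact ⟨_, h1, h2, by rw [h2, scaledField, h1, image_singleton]⟩

end Spray

end PontryaginFinsler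

end

open PontryaginFinsler in
theorem mainTheorem3 {n : ℕ} {M : Type*} [TopologicalSpace M] [T2Space M]
    [ChartedSpace (Coord n) M] [IsManifold (𝓡 n) ∞ M] (F : TangentBundle (𝓡 n) M → ℝ) :
    -- In the Finsler case `F` is of Pontryagin type, the Legendre transform is a bijection,
    -- `𝓔` is single-valued and `𝓖 = F_* 𝓔`.
    (IsFinsler F →
      IsPontryaginType F ∧
      ∀ φ : OpenPartialHomeomorph M (Coord n), IsCoordSystem φ → ∀ ξ ∈ φ.target,
        BijOn (fun η => (legendre F φ (ξ, η)).2) {η | η ≠ 0} {a | a ≠ 0} ∧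
        ∀ a : Coord n →L[ℝ] ℝ, a ≠ 0 →
          ∃ V : CotCoord n, extendedField F φ (ξ, a) = {V} ∧
            cotangentSpray F φ (ξ, a) = {dualNorm (inChart F φ ξ) a • V} ∧
            cotangentSpray F φ (ξ, a) = scaledField F φ (ξ, a)) ∧
    -- Minimizing paths of a Pontryagin type structure.
    (IsPontryaginType F →
      ∀ (a b : ℝ) (x : ℝ → M), a < b → IsMinimizing F x a b →
        -- `𝓔` represents the minimizing paths parameterized by arclength
        (HasSpeed F x a b 1 ↔
          ∃ α : ∀ t, CotangentSpace n (x t), IsIntegralCurve (extendedField F) x α a b) ∧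
        -- `F_* 𝓔` represents the minimizing paths with constant speed
        ((∃ c : ℝ, 0 < c ∧ HasSpeed F x a b c) ↔
          ∃ α : ∀ t, CotangentSpace n (x t), IsIntegralCurve (scaledField F) x α a b) ∧
        -- from `𝓔` to `F_* 𝓔`
        (∀ α : ∀ t, CotangentSpace n (x t), IsIntegralCurve (extendedField F) x α a b →
          (∃ m : ℝ, 0 < m ∧ ∀ t ∈ Icc a b, dualF F (x t) (α t) = m) ∧
          (∀ c : ℝ, 0 < c → IsIntegralCurve (extendedField F) x (fun t => c • α t) a b) ∧
          ((∀ t ∈ Icc a b, dualF F (x t) (α t) = 1) → ∀ c : ℝ, 0 < c →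
            IsIntegralCurve (scaledField F) (fun t => x (c * t)) (fun t => c • α (c * t))
              (a / c) (b / c)) ∧
          (∀ c : ℝ, 0 < c → ∃ β : ∀ t, CotangentSpace n (x (c * t)),
            IsIntegralCurve (scaledField F) (fun t => x (c * t)) β (a / c) (b / c))) ∧
        -- from `F_* 𝓔` to `𝓔`
        (∀ α : ∀ t, CotangentSpace n (x t), IsIntegralCurve (scaledField F) x α a b →
          ∃ c : ℝ, 0 < c ∧ (∀ t ∈ Icc a b, dualF F (x t) (α t) = c) ∧ HasSpeed F x a b c ∧
            HasSpeed F (fun t => x (t / c)) (c * a) (c * b) 1 ∧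
            IsIntegralCurve (extendedField F) (fun t => x (t / c)) (fun t => α (t / c))
              (c * a) (c * b))) := by
  refine ⟨fun hF => ⟨hF.isPontryaginType, fun φ hφ ξ hξ => ⟨hF.bijOn_legendre hφ hξ,
    fun a ha => hF.exists_extendedField_eq hφ hξ ha⟩⟩,
    fun hF a b x hab hmin => minimizing_iff_integralCurve hF hab hmin⟩
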